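/- Let $Y$ be a (finite-dimensional, Hausdorff) complex manifold, let $\iota : X \to Y$ be a holomorphic embedding of a compact complex manifold $X$, i.e. the inclusion of a compact complex submanifold, and let $\mathcal{I} \subset \mathcal{O}_Y$ be the ideal sheaf of holomorphic functions vanishing on $X$. Let $X_1 = (X, \mathcal{O}_Y/\mathcal{I}^2)$ be the first infinitesimal neighbourhood of $X$ in $Y$. Let $\Omega^1_{Y|X}$ denote the restriction to $X$ of the holomorphic cotangent bundle $\Omega^1_Y$ of $Y$. Let $E \to X$ be a holomorphic vector bundle of finite rank, and let $\mathrm{At}(E) \in H^1(X, \Omega^1_X \otimes \mathrm{End}(E))$ be its Atiyah class: if $E$ is trivialised over the members of an open cover $\{U_i\}$ of $X$, with transition functions $g_{ij}$, then $\mathrm{At}(E)$ is the class of the Čech cocycle which over $U_i \cap U_j$ is given, in the trivialisation of $E$ with index $\lambda$, by the matrix of forms $g_{\lambda i}\,dg_{i\lambda} - g_{\lambda j}\,dg_{j\lambda}$. Then there exists a vector bundle $E_1 \to X_1$ (a locally free sheaf of $\mathcal{O}_{X_1}$-modules of finite rank) with $\iota^* E_1 \cong E$ if and only if $\mathrm{At}(E)$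 lies in the image of the map $$\iota^* : H^1(X, \Omega^1_{Y|X} \otimes \mathrm{End}(E)) \to H^1(X, \Omega^1_X \otimes \mathrm{End}(E))$$ induced by the restriction of forms $\Omega^1_{Y|X} \to \Omega^1_X$. -/

import Mathlib

open scoped Manifold ContDiff Topology Bundle
open Bundle TopologicalSpace

noncomputable section

namespace HolExt

/-! ### Holomorphic sections of holomorphic bundles and first Čech cohomology -/

section Cech

universe uX uE uG uW

variable {X : Type uX} [TopologicalSpace X]
  (EX : Type uE) [NormedAddCommGroup EX] [NormedSpace ℂ EX] [ChartedSpace EX X]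
  (G : Type uG) [NormedAddCommGroup G] [NormedSpace ℂ G]
  (W : X → Type uW) [TopologicalSpace (TotalSpace G W)] [∀ x, TopologicalSpace (W x)]
  [FiberBundle G W]

/-- `s` is a holomorphic section of the bundle `W` over the open set `U`. Sections over `U` are
represented by functions on all of `X`, whose values outside `U` are irrelevant. -/
def IsHolOn (U : Opens X) (s : ∀ x, W x) : Prop :=
  ContMDiffOn 𝓘(ℂ, EX) (𝓘(ℂ, EX).prod 𝓘(ℂ, G)) ω (fun x => TotalSpace.mk' G x (s x)) U

variable {EX G W} in
lemma IsHolOn.mono {U V : Opens X} {s : ∀ x, W x} (hs : IsHolOn EX G W V s) (h : U ≤ V) :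
    IsHolOn EX G W U s :=
  ContMDiffOn.mono hs h

/-- An open cover of `X` indexed by the points of `X`, the member `U x` being a neighbourhood of
`x`. Every open cover of `X` is refined by one of these. -/
def IsPointedCover (U : X → Opens X) : Prop := ∀ x, x ∈ U x

variable [∀ x, AddCommGroup (W x)]

/-- `c` is a Čech `1`-cocycle on the cover `U` with values in the sheaf of holomorphic sections
of `W`. -/
def IsCocycleOn (U : X → Opens X) (c : X → X → ∀ x, W x) : Prop :=
  (∀ i j, IsHolOn EX G W (U i ⊓ U j) (c i j)) ∧
    ∀ i j k, ∀ x ∈ U i ⊓ U j ⊓ U k, c i j x + c j k x = c i k x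

/-- `c` is a Čech `1`-coboundary on the cover `U` with values in the sheaf of holomorphic sections
of `W`. -/
def IsCoboundaryOn (U : X → Opens X) (c : X → X → ∀ x, W x) : Prop :=
  ∃ b : X → ∀ x, W x, (∀ i, IsHolOn EX G W (U i) (b i)) ∧
    ∀ i j, ∀ x ∈ U i ⊓ U j, c i j x = b i x - b j x

variable [∀ x, Module ℂ (W x)] [VectorBundle ℂ G W]

variable {EX G W} in
lemma IsHolOn.add {U : Opens X} {s t : ∀ x, W x}
    (hs : IsHolOn EX G W U s) (ht : IsHolOn EX G W U t) : IsHolOn EX G W U (s + t) :=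
  ContMDiffOn.add_section hs ht

variable {EX G W} in
lemma IsHolOn.neg {U : Opens X} {s : ∀ x, W x}
    (hs : IsHolOn EX G W U s) : IsHolOn EX G W U (-s) :=
  ContMDiffOn.neg_section hs

lemma isHolOn_zero (U : Opens X) : IsHolOn EX G W U 0 :=
  (contMDiff_zeroSection ℂ W).contMDiffOn

/-- The group of Čech `1`-cocycles, for varying covers, with values in the sheaf of holomorphic
sections of `W`. -/
def cocycles : AddSubgroup (X → X → ∀ x, W x) where
  carrier := {c | ∃ U, IsPointedCover U ∧ IsCocycleOn EX G W U c}
  zero_mem' := ⟨fun _ => ⊤, fun _ => trivial, fun _ _ => isHolOn_zero EX G W _, by simp⟩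
  add_mem' := by
    rintro a b ⟨U, hU, ha, ha'⟩ ⟨V, hV, hb, hb'⟩
    refine ⟨fun x => U x ⊓ V x, fun x => ⟨hU x, hV x⟩, fun i j => ?_, fun i j k x hx => ?_⟩
    · exact ((ha i j).mono (inf_le_inf inf_le_left inf_le_left)).add
        ((hb i j).mono (inf_le_inf inf_le_right inf_le_right))
    · have h1 := ha' i j k x ⟨⟨hx.1.1.1, hx.1.2.1⟩, hx.2.1⟩
      have h2 := hb' i j k x ⟨⟨hx.1.1.2, hx.1.2.2⟩, hx.2.2⟩
      simp only [Pi.add_apply, ← h1, ← h2]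
      abel
  neg_mem' := by
    rintro a ⟨U, hU, ha, ha'⟩
    refine ⟨U, hU, fun i j => (ha i j).neg, fun i j k x hx => ?_⟩
    simp only [Pi.neg_apply, ← ha' i j k x hx]
    abel

/-- The Čech `1`-cocycles which become coboundaries on a sufficiently fine cover. -/
def coboundaries : AddSubgroup (cocycles EX G W) where
  carrier := {c | ∃ U, IsPointedCover U ∧ IsCoboundaryOn EX G W U c.1}
  zero_mem' := ⟨fun _ => ⊤, fun _ => trivial, 0, fun _ => isHolOn_zero EX G W _, by simp⟩
  add_mem' := by
    rintro a b ⟨U, hU, p, hp, hp'⟩ ⟨V, hV, q, hq, hq'⟩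
    refine ⟨fun x => U x ⊓ V x, fun x => ⟨hU x, hV x⟩, p + q, fun i => ?_, fun i j x hx => ?_⟩
    · exact ((hp i).mono inf_le_left).add ((hq i).mono inf_le_right)
    · have h1 := hp' i j x ⟨hx.1.1, hx.2.1⟩
      have h2 := hq' i j x ⟨hx.1.2, hx.2.2⟩
      simp only [AddSubgroup.coe_add, Pi.add_apply, h1, h2]
      abel
  neg_mem' := by
    rintro a ⟨U, hU, p, hp, hp'⟩
    refine ⟨U, hU, -p, fun i => (hp i).neg, fun i j x hx => ?_⟩
    simp only [AddSubgroup.coe_neg, Pi.neg_apply, hp' i j x hx]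
    abel

/-- The first Čech cohomology group `H¹(X, W)` of the sheaf of holomorphic sections of `W`: the
direct limit, over the open covers of `X`, of the groups of cocycles modulo coboundaries. (As the
values of the sections outside their domains are irrelevant, a cocycle on a cover is literally a
cocycle on every finer cover, and the direct limit is the union of the groups of cocycles modulo
the union of the groups of coboundaries.) -/
abbrev CechH1 : Type (max uX uW) := cocycles EX G W ⧸ coboundaries EX G W

section Map

universe uG' uW'

variable {EX G W}
variable (G' : Type uG') [NormedAddCommGroup G'] [NormedSpace ℂ G']
  (W' : X → Type uW') [TopologicalSpace (TotalSpace G' W')] [∀ x, TopologicalSpace (W' x)]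
  [FiberBundle G' W'] [∀ x, AddCommGroup (W' x)] [∀ x, Module ℂ (W' x)] [VectorBundle ℂ G' W']

/-- The map on Čech cocycles induced by a family of additive maps between the fibres of two
bundles which takes holomorphic sections to holomorphic sections. -/
def cocyclesMap (φ : ∀ x, W x →+ W' x)
    (hφ : ∀ (U : Opens X) (s : ∀ x, W x), IsHolOn EX G W U s →
      IsHolOn EX G' W' U (fun x => φ x (s x))) :
    cocycles EX G W →+ cocycles EX G' W' where
  toFun c := ⟨fun i j x => φ x (c.1 i j x), by
    obtain ⟨U, hU, hc, hc'⟩ := c.2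
    exact ⟨U, hU, fun i j => hφ _ _ (hc i j), fun i j k x hx => by
      rw [← map_add, hc' i j k x hx]⟩⟩
  map_zero' := by ext; simp
  map_add' a b := by ext; simp

/-- The map on `H¹` induced by a family of additive maps between the fibres of two bundles which
takes holomorphic sections to holomorphic sections. -/
def CechH1.map (φ : ∀ x, W x →+ W' x)
    (hφ : ∀ (U : Opens X) (s : ∀ x, W x), IsHolOn EX G W U s →
      IsHolOn EX G' W' U (fun x => φ x (s x))) :
    CechH1 EX G W →+ CechH1 EX G' W' :=
  QuotientAddGroup.map _ _ (cocyclesMap G' W' φ hφ) (by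
    rintro c ⟨U, hU, b, hb, hb'⟩
    refine ⟨U, hU, fun i x => φ x (b i x), fun i => hφ _ _ (hb i), fun i j x hx => ?_⟩
    change φ x (c.1 i j x) = _
    rw [hb' i j x hx, map_sub])

end Map

end Cech

/-! ### The bundles `Ω¹_X ⊗ End E` and `Ω¹_{Y|X} ⊗ End E`, the Atiyah class and the map `ι^*` -/

instance instAddCommGroupPullback {B B' : Type*} (E : B → Type*) [∀ x, AddCommGroup (E x)]
    (f : B' → B) (x : B') : AddCommGroup ((f *ᵖ E) x) :=
  inferInstanceAs (AddCommGroup (E (f x)))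

section Atiyah

universe uX uY uEX uEY uF uV

variable {X : Type uX} [TopologicalSpace X]
  (EX : Type uEX) [NormedAddCommGroup EX] [NormedSpace ℂ EX] [ChartedSpace EX X]
  [IsManifold 𝓘(ℂ, EX) ω X]
  (F : Type uF) [NormedAddCommGroup F] [NormedSpace ℂ F]
  (V : X → Type uV) [TopologicalSpace (TotalSpace F V)]
  [∀ x, AddCommGroup (V x)] [∀ x, Module ℂ (V x)] [∀ x, TopologicalSpace (V x)]
  [∀ x, IsTopologicalAddGroup (V x)] [∀ x, ContinuousSMul ℂ (V x)]
  [FiberBundle F V] [VectorBundle ℂ F V] [ContMDiffVectorBundle ω F V 𝓘(ℂ, EX)]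

instance instContinuousAddEnd (x : X) : ContinuousAdd (V x →L[ℂ] V x) :=
  IsTopologicalAddGroup.toContinuousAdd

/-- The fibres of the bundle `Ω¹_X ⊗ End E = Hom(T_X, End E)`. -/
abbrev OmegaEnd (x : X) : Type (max uEX uV) :=
  TangentSpace 𝓘(ℂ, EX) x →L[ℂ] (V x →L[ℂ] V x)

/-- The cohomology group `H¹(X, Ω¹_X ⊗ End E)`. -/
abbrev H1OmegaEnd : Type (max uX uEX uV) :=
  CechH1 EX (EX →L[ℂ] (F →L[ℂ] F)) (OmegaEnd EX V)

variable {F}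

/-- For two trivialisations `e`, `e'` of `E` with transition function
`g = e ∘ e'⁻¹ : U → GL(F)`, the differential `dg`, seen as a section of `Ω¹_X ⊗ End E` by means
of `e` on the target and `e'` on the source. -/
def dTransition (e e' : Trivialization F (π F V)) [MemTrivializationAtlas e]
    [MemTrivializationAtlas e'] (x : X) : OmegaEnd EX V x :=
  ((ContinuousLinearMap.postcomp (V x) (e.symmL ℂ x)) ∘L
    (ContinuousLinearMap.precomp F (e'.continuousLinearMapAt ℂ x))) ∘L
  (mfderiv 𝓘(ℂ, EX) 𝓘(ℂ, F →L[ℂ] F) (fun p => (e'.coordChangeL ℂ e p : F →L[ℂ] F)) x)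

lemma end_coord (x₀ x : X) (hx : x ∈ (trivializationAt F V x₀).baseSet) (T : V x →L[ℂ] V x) :
    (trivializationAt (F →L[ℂ] F) (fun x => V x →L[ℂ] V x) x₀).continuousLinearMapAt ℂ x T =
      (trivializationAt F V x₀).continuousLinearMapAt ℂ x ∘L T ∘L
        (trivializationAt F V x₀).symmL ℂ x := by
  rw [Trivialization.continuousLinearMapAt_apply, Trivialization.coe_linearMapAt_of_mem]
  · rfl
  · simpa [hom_trivializationAt_baseSet] using hx

lemma coordChangeL_eq (a b : Trivialization F (π F V)) [MemTrivializationAtlas a]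
    [MemTrivializationAtlas b] {x : X} (h1 : x ∈ a.baseSet) (h2 : x ∈ b.baseSet) (u : F) :
    a.coordChangeL ℂ b x u = b.continuousLinearMapAt ℂ x (a.symmL ℂ x u) := by
  rw [Trivialization.coordChangeL_apply a b ⟨h1, h2⟩, Trivialization.continuousLinearMapAt_apply,
    Trivialization.coe_linearMapAt_of_mem _ h2, Trivialization.symmL_apply a h1]

lemma isHolOn_dTransition (e e' : Trivialization F (π F V)) [MemTrivializationAtlas e]
    [MemTrivializationAtlas e'] (U : Opens X) (hU : (U : Set X) ⊆ e.baseSet ∩ e'.baseSet) :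
    IsHolOn EX (EX →L[ℂ] (F →L[ℂ] F)) (OmegaEnd EX V) U (dTransition EX V e e') := by
  intro x₀ hx₀
  obtain ⟨he, he'⟩ := hU hx₀
  apply ContMDiffAt.contMDiffWithinAt
  rw [contMDiffAt_hom_bundle]
  refine ⟨contMDiffAt_id, ?_⟩
  set e₀ := trivializationAt F V x₀ with he₀
  have h0 : x₀ ∈ e₀.baseSet := mem_baseSet_trivializationAt F V x₀
  have hg : ContMDiffAt 𝓘(ℂ, EX) 𝓘(ℂ, F →L[ℂ] F) ω
      (fun p => (e'.coordChangeL ℂ e p : F →L[ℂ] F)) x₀ := contMDiffAt_coordChangeL he' he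
  have hd := hg.mfderiv_const (m := ω) le_top
  have ha : ContMDiffAt 𝓘(ℂ, EX) 𝓘(ℂ, F →L[ℂ] F) ω
      (fun p => (e.coordChangeL ℂ e₀ p : F →L[ℂ] F)) x₀ := contMDiffAt_coordChangeL he h0
  have hb : ContMDiffAt 𝓘(ℂ, EX) 𝓘(ℂ, F →L[ℂ] F) ω
      (fun p => (e₀.coordChangeL ℂ e' p : F →L[ℂ] F)) x₀ := contMDiffAt_coordChangeL h0 he'
  have key := ((ha.clm_postcomp (F₁ := F)).clm_comp (hb.clm_precomp (F₃ := F))).clm_comp hd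
  refine key.congr_of_eventuallyEq ?_
  filter_upwards [e₀.open_baseSet.mem_nhds h0, e.open_baseSet.mem_nhds he,
    e'.open_baseSet.mem_nhds he'] with x hx hxe hxe'
  ext v w
  simp only [ContinuousLinearMap.inCoordinates, inTangentCoordinates, dTransition,
    ContinuousLinearMap.comp_apply]
  rw [end_coord V x₀ x hx, TangentBundle.continuousLinearMapAt_model_space]
  simp only [ContinuousLinearMap.comp_apply, ContinuousLinearMap.postcomp_apply,
    ContinuousLinearMap.precomp_apply, id, ContinuousLinearEquiv.coe_coe]
  rw [coordChangeL_eq V e e₀ hxe hx, coordChangeL_eq V e₀ e' hx hxe']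
  rfl

lemma dTransition_add (a b c : Trivialization F (π F V)) [MemTrivializationAtlas a]
    [MemTrivializationAtlas b] [MemTrivializationAtlas c] {x : X} (ha : x ∈ a.baseSet)
    (hb : x ∈ b.baseSet) (hc : x ∈ c.baseSet) :
    dTransition EX V a b x + dTransition EX V b c x = dTransition EX V a c x := by
  have h1 : ContMDiffAt 𝓘(ℂ, EX) 𝓘(ℂ, F →L[ℂ] F) ω
      (fun p => (b.coordChangeL ℂ a p : F →L[ℂ] F)) x := contMDiffAt_coordChangeL hb ha
  have h2 : ContMDiffAt 𝓘(ℂ, EX) 𝓘(ℂ, F →L[ℂ] F) ω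
      (fun p => (c.coordChangeL ℂ b p : F →L[ℂ] F)) x := contMDiffAt_coordChangeL hc hb
  have d1 := (h1.mdifferentiableAt (by simp)).hasMFDerivAt
  have d2 := (h2.mdifferentiableAt (by simp)).hasMFDerivAt
  have d3 := d1.mul' d2
  have heq : (fun p => (c.coordChangeL ℂ a p : F →L[ℂ] F)) =ᶠ[𝓝 x]
      ((fun p => (b.coordChangeL ℂ a p : F →L[ℂ] F)) *
        (fun p => (c.coordChangeL ℂ b p : F →L[ℂ] F))) := by
    filter_upwards [a.open_baseSet.mem_nhds ha, b.open_baseSet.mem_nhds hb,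
      c.open_baseSet.mem_nhds hc] with p pa pb pc
    ext u
    simp only [Pi.mul_apply, mul_apply_eq_comp, ContinuousLinearEquiv.coe_coe]
    rw [coordChangeL_eq V c a pc pa, coordChangeL_eq V b a pb pa, coordChangeL_eq V c b pc pb,
      b.symmL_continuousLinearMapAt pb]
  have d4 := (d3.congr_of_eventuallyEq heq).mfderiv
  let D1 : EX →L[ℂ] (F →L[ℂ] F) := mfderiv 𝓘(ℂ, EX) 𝓘(ℂ, F →L[ℂ] F)
    (fun p => (b.coordChangeL ℂ a p : F →L[ℂ] F)) x
  let D2 : EX →L[ℂ] (F →L[ℂ] F) := mfderiv 𝓘(ℂ, EX) 𝓘(ℂ, F →L[ℂ] F)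
    (fun p => (c.coordChangeL ℂ b p : F →L[ℂ] F)) x
  ext v w
  simp only [dTransition]
  rw [d4]
  change a.symmL ℂ x (D1 v (b.continuousLinearMapAt ℂ x w)) +
    b.symmL ℂ x (D2 v (c.continuousLinearMapAt ℂ x w)) =
    a.symmL ℂ x (b.coordChangeL ℂ a x (D2 v (c.continuousLinearMapAt ℂ x w)) +
      D1 v (c.coordChangeL ℂ b x (c.continuousLinearMapAt ℂ x w)))
  have e1 : b.continuousLinearMapAt ℂ x w =
      c.coordChangeL ℂ b x (c.continuousLinearMapAt ℂ x w) := by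
    rw [coordChangeL_eq V c b hc hb, c.symmL_continuousLinearMapAt hc]
  have e2 : ∀ u : F, b.symmL ℂ x u = a.symmL ℂ x (b.coordChangeL ℂ a x u) := by
    intro u
    rw [coordChangeL_eq V b a hb ha, a.symmL_continuousLinearMapAt ha]
  rw [e1, e2, ← map_add, add_comm]

variable (F)

/-- The cocycle of the Atiyah class: for the trivialisations of `E` over the sets `U_i`, with
transition functions `g_ij`, it is the section of `Ω¹_X ⊗ End E` over `U_i ∩ U_j` which is the
matrix of forms `g_λi dg_iλ - g_λj dg_jλ` in the trivialisation with index `λ`; for `λ = j` this is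
`g_ji dg_ij`. -/
def atiyahCocycle : cocycles EX (EX →L[ℂ] (F →L[ℂ] F)) (OmegaEnd EX V) :=
  ⟨fun i j => dTransition EX V (trivializationAt F V i) (trivializationAt F V j),
    fun i => ⟨(trivializationAt F V i).baseSet, (trivializationAt F V i).open_baseSet⟩,
    fun i => mem_baseSet_trivializationAt F V i,
    fun _ _ => isHolOn_dTransition EX V _ _ _ (fun _ hx => hx),
    fun _ _ _ _ hx => dTransition_add EX V _ _ _ hx.1.1 hx.1.2 hx.2⟩

/-- The Atiyah class `At(E) ∈ H¹(X, Ω¹_X ⊗ End E)`. -/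
def atiyahClass : H1OmegaEnd EX F V :=
  QuotientAddGroup.mk (atiyahCocycle EX F V)

variable {Y : Type uY} [TopologicalSpace Y]
  {EX} {EY : Type uEY} [NormedAddCommGroup EY] [NormedSpace ℂ EY] [ChartedSpace EY Y]
  [IsManifold 𝓘(ℂ, EY) ω Y] (ι : C^ω⟮𝓘(ℂ, EX), X; 𝓘(ℂ, EY), Y⟯)

/-- The fibres of the bundle `Ω¹_{Y|X} ⊗ End E = Hom(ι^* T_Y, End E)`. -/
abbrev OmegaResEnd (x : X) : Type (max uEY uV) :=
  (ι *ᵖ (TangentSpace 𝓘(ℂ, EY) : Y → Type uEY)) x →L[ℂ] (V x →L[ℂ] V x)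

/-- The cohomology group `H¹(X, Ω¹_{Y|X} ⊗ End E)`. -/
abbrev H1OmegaResEnd : Type (max uX uEY uV) :=
  CechH1 EX (EY →L[ℂ] (F →L[ℂ] F)) (OmegaResEnd V ι)

/-- The map `ι^* : Ω¹_{Y|X} ⊗ End E → Ω¹_X ⊗ End E` on fibres: restriction of forms to vectors
tangent to `X`, i.e. composition with the differential of the embedding. -/
def restrictForm (x : X) : OmegaResEnd V ι x →+ OmegaEnd EX V x where
  toFun A := A ∘L (mfderiv 𝓘(ℂ, EX) 𝓘(ℂ, EY) ι x)
  map_zero' := rfl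
  map_add' _ _ := rfl

lemma isHolOn_restrictForm (U : Opens X) (A : ∀ x, OmegaResEnd V ι x)
    (hA : IsHolOn EX (EY →L[ℂ] (F →L[ℂ] F)) (OmegaResEnd V ι) U A) :
    IsHolOn EX (EX →L[ℂ] (F →L[ℂ] F)) (OmegaEnd EX V) U (fun x => restrictForm V ι x (A x)) := by
  intro x₀ hx₀
  have hA' := (hA.contMDiffAt (U.isOpen.mem_nhds hx₀))
  apply ContMDiffAt.contMDiffWithinAt
  rw [contMDiffAt_hom_bundle] at hA' ⊢
  refine ⟨contMDiffAt_id, ?_⟩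
  have hd := ι.contMDiff.contMDiffAt.mfderiv_const (x₀ := x₀) (m := ω) le_top
  have key := hA'.2.clm_comp hd
  refine key.congr_of_eventuallyEq ?_
  have h1 : ∀ᶠ x in 𝓝 x₀, ι x ∈ (trivializationAt EY (TangentSpace 𝓘(ℂ, EY)) (ι x₀)).baseSet :=
    ι.contMDiff.continuous.continuousAt.eventually
      ((trivializationAt EY (TangentSpace 𝓘(ℂ, EY)) (ι x₀)).open_baseSet.mem_nhds
        (mem_baseSet_trivializationAt _ _ _))
  filter_upwards [h1] with x hx
  have hx' : x ∈ (trivializationAt EY (ι *ᵖ (TangentSpace 𝓘(ℂ, EY) : Y → Type uEY)) x₀).baseSet :=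
    hx
  have h2 : ∀ u : TangentSpace 𝓘(ℂ, EY) (ι x),
      (trivializationAt EY (ι *ᵖ (TangentSpace 𝓘(ℂ, EY) : Y → Type uEY)) x₀).symmL ℂ x
        ((trivializationAt EY (TangentSpace 𝓘(ℂ, EY)) (ι x₀)).continuousLinearMapAt ℂ (ι x) u)
        = u := by
    intro u
    refine Eq.trans ?_ ((trivializationAt EY (ι *ᵖ (TangentSpace 𝓘(ℂ, EY) : Y → Type uEY))
      x₀).symmL_continuousLinearMapAt (R := ℂ) hx' u)
    congr 1
  ext v : 1
  simp only [ContinuousLinearMap.inCoordinates, inTangentCoordinates,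
    ContinuousLinearMap.comp_apply]
  congr 1
  exact congrArg (A x) (h2 _).symm

/-- The map `ι^* : H¹(X, Ω¹_{Y|X} ⊗ End E) → H¹(X, Ω¹_X ⊗ End E)`. -/
def restrictH1 : H1OmegaResEnd F V ι →+ H1OmegaEnd EX F V :=
  CechH1.map (EX →L[ℂ] (F →L[ℂ] F)) (OmegaEnd EX V) (restrictForm V ι)
    (isHolOn_restrictForm F V ι)

end Atiyah

/-! ### The first infinitesimal neighbourhood `X₁ = (X, O_Y / I²)` -/

section FirstOrder

universe uX uY uEX uEY uF uV

/-- The ring `O_{Y,y}` of germs of holomorphic functions at a point of a complex manifold. -/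
def HolGerm {Y : Type uY} [TopologicalSpace Y] (EY : Type uEY) [NormedAddCommGroup EY]
    [NormedSpace ℂ EY] [ChartedSpace EY Y] (y : Y) : Subring (Filter.Germ (𝓝 y) ℂ) where
  carrier := {φ | ∃ f : Y → ℂ, ContMDiffAt 𝓘(ℂ, EY) 𝓘(ℂ, ℂ) ω f y ∧ (f : Filter.Germ (𝓝 y) ℂ) = φ}
  zero_mem' := ⟨0, contMDiffAt_const, rfl⟩
  one_mem' := ⟨1, contMDiffAt_const, rfl⟩
  add_mem' := by
    rintro _ _ ⟨f, hf, rfl⟩ ⟨g, hg, rfl⟩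
    exact ⟨f + g, hf.add hg, rfl⟩
  mul_mem' := by
    rintro _ _ ⟨f, hf, rfl⟩ ⟨g, hg, rfl⟩
    exact ⟨f * g, hf.mul hg, rfl⟩
  neg_mem' := by
    rintro _ ⟨f, hf, rfl⟩
    exact ⟨-f, hf.neg, rfl⟩

variable {X : Type uX} [TopologicalSpace X]
  {EX : Type uEX} [NormedAddCommGroup EX] [NormedSpace ℂ EX] [ChartedSpace EX X]
  {Y : Type uY} [TopologicalSpace Y]
  {EY : Type uEY} [NormedAddCommGroup EY] [NormedSpace ℂ EY] [ChartedSpace EY Y]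
  (ι : C^ω⟮𝓘(ℂ, EX), X; 𝓘(ℂ, EY), Y⟯)

/-- Restriction to `X` of germs of functions on `Y`. -/
def germPullback (x : X) : Filter.Germ (𝓝 (ι x)) ℂ →+* Filter.Germ (𝓝 x) ℂ where
  toFun φ := φ.compTendsto ι (ι.contMDiff.continuous.tendsto x)
  map_zero' := rfl
  map_one' := rfl
  map_add' φ ψ := Filter.Germ.inductionOn₂ φ ψ fun _ _ => rfl
  map_mul' φ ψ := Filter.Germ.inductionOn₂ φ ψ fun _ _ => rfl

/-- The stalk `I_x ⊆ O_{Y,ι(x)}` of the ideal sheaf of `X`: germs of holomorphic functions on `Y`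
which vanish on `X`. -/
def idealStalk (x : X) : Ideal (HolGerm EY (ι x)) :=
  RingHom.ker ((germPullback ι x).comp (HolGerm EY (ι x)).subtype)

/-- The stalk `O_{Y,ι(x)} / I_x²` of the structure sheaf of `X₁`. -/
def O1Stalk (x : X) : Type uY :=
  HolGerm EY (ι x) ⧸ (idealStalk ι x) ^ 2

instance O1Stalk.instCommRing (x : X) : CommRing (O1Stalk ι x) :=
  inferInstanceAs (CommRing (HolGerm EY (ι x) ⧸ (idealStalk ι x) ^ 2))

/-- The element of `O_{Y,ι(x)} / I_x²` given by a function `f` which is holomorphic at `ι(x)`. -/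
def O1Stalk.of (x : X) (f : Y → ℂ) (hf : ContMDiffAt 𝓘(ℂ, EY) 𝓘(ℂ, ℂ) ω f (ι x)) :
    O1Stalk ι x :=
  Ideal.Quotient.mk _ ⟨(f : Filter.Germ (𝓝 (ι x)) ℂ), f, hf, rfl⟩

/-- The sections over `U` of the sheaf `O_{X₁} = O_Y / I²`: the families of
elements of the stalks `O_{Y,ι(x)} / I_x²`, `x ∈ U`, which are locally given by holomorphic
functions on open subsets of `Y`. -/
def O1Subring (U : Opens X) : Subring (∀ x : U, O1Stalk ι x) where
  carrier := {σ | ∀ x : U, ∃ f : Y → ℂ, ∀ᶠ x' : U in 𝓝 x,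
    ∃ hf : ContMDiffAt 𝓘(ℂ, EY) 𝓘(ℂ, ℂ) ω f (ι x'), σ x' = O1Stalk.of ι x' f hf}
  zero_mem' := fun _ => ⟨0, Filter.Eventually.of_forall fun _ => ⟨contMDiffAt_const, rfl⟩⟩
  one_mem' := fun _ => ⟨1, Filter.Eventually.of_forall fun _ => ⟨contMDiffAt_const, rfl⟩⟩
  add_mem' := by
    intro σ τ hσ hτ x
    obtain ⟨f, hf⟩ := hσ x
    obtain ⟨g, hg⟩ := hτ x
    refine ⟨f + g, ?_⟩
    filter_upwards [hf, hg] with x' ⟨h1, h2⟩ ⟨h3, h4⟩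
    exact ⟨h1.add h3, by rw [Pi.add_apply, h2, h4]; rfl⟩
  mul_mem' := by
    intro σ τ hσ hτ x
    obtain ⟨f, hf⟩ := hσ x
    obtain ⟨g, hg⟩ := hτ x
    refine ⟨f * g, ?_⟩
    filter_upwards [hf, hg] with x' ⟨h1, h2⟩ ⟨h3, h4⟩
    exact ⟨h1.mul h3, by rw [Pi.mul_apply, h2, h4]; rfl⟩
  neg_mem' := by
    intro σ hσ x
    obtain ⟨f, hf⟩ := hσ x
    refine ⟨-f, ?_⟩
    filter_upwards [hf] with x' ⟨h1, h2⟩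
    exact ⟨h1.neg, by rw [Pi.neg_apply, h2]; rfl⟩

/-- The ring `O_{X₁}(U)` of sections over `U` of the sheaf `O_{X₁} = O_Y / I²`. -/
def O1 (U : Opens X) : Type (max uX uY) :=
  O1Subring ι U

instance O1.instCommRing (U : Opens X) : CommRing (O1 ι U) :=
  inferInstanceAs (CommRing (O1Subring ι U))

/-- Restriction of sections of `O_{X₁}` to a smaller open set. -/
def O1.res {U V : Opens X} (h : U ≤ V) : O1 ι V →+* O1 ι U where
  toFun σ := ⟨fun x => σ.1 ⟨x.1, h x.2⟩, fun x => by
    obtain ⟨f, hf⟩ := σ.2 ⟨x.1, h x.2⟩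
    exact ⟨f, (continuous_inclusion h).continuousAt.eventually hf⟩⟩
  map_zero' := rfl
  map_one' := rfl
  map_add' _ _ := rfl
  map_mul' _ _ := rfl

/-- The value at `x` of an element of `O_{Y,ι(x)} / I_x²`. -/
def O1Stalk.value (x : X) : O1Stalk ι x →+* ℂ :=
  Ideal.Quotient.lift _ (Filter.Germ.valueRingHom.comp (HolGerm EY (ι x)).subtype) (by
    intro a ha
    have h1 : a ∈ idealStalk ι x := Ideal.pow_le_self two_ne_zero ha
    have h2 : ∀ φ : Filter.Germ (𝓝 (ι x)) ℂ, germPullback ι x φ = 0 → φ.value = 0 := by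
      intro φ
      induction φ using Filter.Germ.inductionOn with
      | h f => exact fun h => (Filter.Germ.coe_eq.mp h).self_of_nhds
    exact h2 a.1 h1)

/-- The homomorphism `O_{X₁}(U) → O_X(U)`, with sections of the structure sheaf `O_X` of the
(reduced) complex manifold `X` regarded as functions on `U`. -/
def O1.toFun (U : Opens X) : O1 ι U →+* (U → ℂ) where
  toFun σ x := O1Stalk.value ι x (σ.1 x)
  map_zero' := by ext x; exact map_zero (O1Stalk.value ι x.1)
  map_one' := by ext x; exact map_one (O1Stalk.value ι x.1)
  map_add' a b := by ext x; exact map_add (O1Stalk.value ι x.1) _ _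
  map_mul' a b := by ext x; exact map_mul (O1Stalk.value ι x.1) _ _

/-- The sections over `U` of the ideal sheaf `I / I²` of `X` in `X₁`, i.e. of the kernel of
`O_{X₁} → O_X`. -/
def O1.ideal (U : Opens X) : Ideal (O1 ι U) :=
  RingHom.ker (O1.toFun ι U)

/-- A sheaf of `O_{X₁}`-modules on `X`. -/
structure X1Module where
  /-- the sections over an open set -/
  sec : Opens X → Type (max uX uY)
  [addCommGroup : ∀ U, AddCommGroup (sec U)]
  [module : ∀ U, Module (O1 ι U) (sec U)]
  /-- the restriction maps -/
  res : ∀ {U V : Opens X}, U ≤ V → sec V →+ sec U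
  res_refl : ∀ (U : Opens X) (s : sec U), res (le_refl U) s = s
  res_res : ∀ {U V W : Opens X} (h : U ≤ V) (h' : V ≤ W) (s : sec W),
    res h (res h' s) = res (h.trans h') s
  res_smul : ∀ {U V : Opens X} (h : U ≤ V) (a : O1 ι V) (s : sec V),
    res h (a • s) = O1.res ι h a • res h s
  /-- the sheaf axiom: compatible sections over the members of a family of open sets glue to a
  unique section over the union -/
  existsUnique_glue : ∀ (𝒰 : Set (Opens X)) (s : ∀ U : 𝒰, sec U),
    (∀ U V : 𝒰, res (inf_le_left : (U : Opens X) ⊓ V ≤ U) (s U) =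
      res (inf_le_right : (U : Opens X) ⊓ V ≤ V) (s V)) →
    ∃! t : sec (sSup 𝒰), ∀ U : 𝒰, res (le_sSup U.2) t = s U

attribute [instance] X1Module.addCommGroup X1Module.module

variable {ι}

/-- A sheaf of `O_{X₁}`-modules is a (holomorphic) vector bundle over `X₁` if it is locally free
of finite rank: locally there is a finite family of sections in terms of which every section over
a smaller open set is uniquely a linear combination. -/
def X1Module.IsVectorBundle (M : X1Module ι) : Prop :=
  ∀ x : X, ∃ U : Opens X, x ∈ U ∧ ∃ (r : ℕ) (e : Fin r → M.sec U),
    ∀ (V : Opens X) (h : V ≤ U),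
      Function.Bijective fun a : Fin r → O1 ι V => ∑ k, a k • M.res h (e k)

variable (F : Type uF) [NormedAddCommGroup F] [NormedSpace ℂ F]
  (V : X → Type uV) [TopologicalSpace (TotalSpace F V)]
  [∀ x, AddCommGroup (V x)] [∀ x, Module ℂ (V x)] [∀ x, TopologicalSpace (V x)]
  [FiberBundle F V]

/-- An isomorphism `ι^* M ≅ E` over `X`, for a sheaf of `O_{X₁}`-modules `M` and a holomorphic
vector bundle `E → X`. Here `ι^* M = M ⊗ O_X = M / (I / I²) M`, so such an isomorphism is a
morphism `ρ` from `M` to the sheaf of holomorphic sections of `E` which is linear over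
`O_{X₁} → O_X`, is surjective as a morphism of sheaves, and has kernel `(I / I²) M`.
(The values of a section of `E` over `U` outside `U` are irrelevant.) -/
structure PullbackIso (M : X1Module ι) where
  /-- the morphism from `M` to the sheaf of sections of `E` -/
  ρ : ∀ U : Opens X, M.sec U → ∀ x, V x
  isHolOn : ∀ U s, IsHolOn EX F V U (ρ U s)
  map_add : ∀ U s t, ∀ x ∈ U, ρ U (s + t) x = ρ U s x + ρ U t x
  map_smul : ∀ U (a : O1 ι U) s (x : X) (hx : x ∈ U),
    ρ U (a • s) x = O1.toFun ι U a ⟨x, hx⟩ • ρ U s x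
  map_res : ∀ {U U' : Opens X} (h : U ≤ U') s, ∀ x ∈ U, ρ U (M.res h s) x = ρ U' s x
  surjective : ∀ U (t : ∀ x, V x), IsHolOn EX F V U t → ∀ x ∈ U,
    ∃ U' ≤ U, x ∈ U' ∧ ∃ s : M.sec U', ∀ x' ∈ U', ρ U' s x' = t x'
  ker : ∀ U s, (∀ x ∈ U, ρ U s x = 0) → ∀ x ∈ U,
    ∃ (U' : Opens X) (h : U' ≤ U), x ∈ U' ∧
      M.res h s ∈ (O1.ideal ι U' • ⊤ : Submodule (O1 ι U') (M.sec U'))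

variable (ι)

/-- The holomorphic vector bundle `E → X` extends to a vector bundle `E₁ → X₁`, i.e. there is a
vector bundle `E₁` over `X₁` with `ι^* E₁ ≅ E`. -/
def HasExtension : Prop :=
  ∃ M : X1Module ι, M.IsVectorBundle ∧ Nonempty (PullbackIso F V M)

end FirstOrder

end HolExt

end

/-! Sections of O_{X₁} are compatible 1-jets: pairs (f, θ) of a holomorphic function f on an open
subset of X and a holomorphic section θ of Ω¹_{Y|X} whose restriction to T_X is df. A section is
determined by its jet (`O1.ext_jet`) and every compatible pair occurs (`O1.exists_of_jet`). Both
facts are local and use coordinates in which X is linear (`exists_adaptedChart`), with a retraction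
p, equations ζᵢ of X and dual normal fields vᵢ. A function with zero 1-jet along X lies in I² by
Hadamard's lemma (`exists_analytic_quadratic`), and (f, θ) is the jet of f∘p + Σ ζᵢ·(θ(vᵢ)∘p).

The Atiyah cocycle is a_ij = ∇_i - ∇_j, where ∇_i is the flat connection of the i-th trivialisation
of E (`conn_sub_conn`).

Suppose that M extends E, with local frames over U_i. Differentiating coordinates in the i-th frame
gives an operator D_i from M to Ω¹_{Y|X} ⊗ E with D_i(as) = a D_i s + da ⊗ s. The differences D_i -
D_j are linear over O_{X₁} → O_X, so they factor through E (`PullbackIso.exists_factor`) and form a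
cocycle c_ij with values in Ω¹_{Y|X} ⊗ End E. Restricted to T_X, D_i satisfies the same Leibniz rule
as ∇_i, so D_i - ∇_i is a section b_i of Ω¹_X ⊗ End E. Hence ι^*c_ij = a_ij + b_i - b_j.

Conversely, let c and b satisfy this equation. Take for E₁ the sheaf of pairs consisting of a
section s of E and local forms φ_i in Ω¹_{Y|X} ⊗ E, with φ_i = φ_j + c_ij s and φ_i = ∇_i s + b_i s
on T_X. The equation says exactly that the second condition does not depend on i
(`AtiyahLift.IsGood.of_index`). The ring O_{X₁} acts by a(s, φ) = (as, aφ + da ⊗ s). Where dι has a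
holomorphic left inverse q, the pairs (e_k, b_i e_k ∘ q), for a frame e_k of E constant in the
trivialisation, form a basis: the coordinates of a section are again compatible pairs (f_k, θ_k),
that is, sections of O_{X₁} (`AtiyahLift.exists_frame`). -/

set_option linter.unusedSectionVars false

noncomputable section

namespace HolExt

/-! ### Hadamard's lemma for analytic functions -/

section Hadamard

variable {A B H : Type*} [NormedAddCommGroup A] [NormedSpace ℂ A] [NormedAddCommGroup B]
  [NormedSpace ℂ B] [NormedAddCommGroup H] [NormedSpace ℂ H]

variable (A B) in
/-- The linear map `(u, z) ↦ (u, t z)`. -/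
def scaleSnd (t : ℝ) : A × B →L[ℂ] A × B :=
  (ContinuousLinearMap.fst ℂ A B).prod ((t : ℂ) • ContinuousLinearMap.snd ℂ A B)

lemma norm_scaleSnd_le {t : ℝ} (ht : t ∈ Set.Icc (0 : ℝ) 1) : ‖scaleSnd A B t‖ ≤ 1 := by
  refine ContinuousLinearMap.opNorm_le_bound _ zero_le_one fun w => ?_
  rw [one_mul]
  refine max_le (norm_fst_le w) ?_
  change ‖(t : ℂ) • w.2‖ ≤ _
  rw [norm_smul, Complex.norm_real, Real.norm_of_nonneg ht.1]
  exact (mul_le_of_le_one_left (norm_nonneg _) ht.2).trans (norm_snd_le w)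

lemma continuous_scaleSnd : Continuous (scaleSnd A B) := by
  have : scaleSnd A B = fun t : ℝ =>
      (ContinuousLinearMap.inl ℂ A B) ∘L (ContinuousLinearMap.fst ℂ A B) +
        (t : ℂ) • ((ContinuousLinearMap.inr ℂ A B) ∘L (ContinuousLinearMap.snd ℂ A B)) := by
    ext t w <;> simp [scaleSnd]
  rw [this]
  fun_prop

/-- Precomposition is itself a continuous multilinear function of the linear maps inserted. This
makes the coefficients integrable in t. -/
lemma continuous_compScale {n : ℕ} (p : (A × B) [×n]→L[ℂ] H) :
    Continuous fun t : ℝ => p.compContinuousLinearMap fun _ => scaleSnd A B t :=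
  ((ContinuousMultilinearMap.compContinuousLinearMapContinuousMultilinear ℂ
    (fun _ : Fin n => A × B) (fun _ : Fin n => A × B) H).cont.comp
      (continuous_pi fun _ => continuous_scaleSnd)).clm_apply continuous_const

lemma norm_compScale_le {n : ℕ} (p : (A × B) [×n]→L[ℂ] H) {t : ℝ}
    (ht : t ∈ Set.Icc (0 : ℝ) 1) :
    ‖p.compContinuousLinearMap fun _ => scaleSnd A B t‖ ≤ ‖p‖ := by
  refine (p.norm_compContinuousLinearMap_le _).trans ?_
  refine mul_le_of_le_one_right (norm_nonneg _) ?_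
  exact Finset.prod_le_one (fun _ _ => norm_nonneg _) fun _ _ => norm_scaleSnd_le ht

lemma uIoc_subset_Icc {t : ℝ} (ht : t ∈ Set.uIoc (0 : ℝ) 1) : t ∈ Set.Icc (0 : ℝ) 1 := by
  rw [Set.uIoc_of_le zero_le_one] at ht
  exact Set.Ioc_subset_Icc_self ht

variable [CompleteSpace H]

/-- The average of an analytic function over the segments joining `(u, 0)` and `(u, z)` is
analytic. -/
lemma analyticAt_integral_scale {g : A × B → H} {a : A} (hg : AnalyticAt ℂ g (a, 0)) :
    AnalyticAt ℂ (fun w : A × B => ∫ t in (0 : ℝ)..1, g (w.1, (t : ℂ) • w.2)) (a, 0) := by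
  obtain ⟨p, r, hp⟩ := hg
  -- The expansion of the average is the average of the expansions, coefficient by coefficient.
  let q : FormalMultilinearSeries ℂ (A × B) H := fun n =>
    ∫ t in (0 : ℝ)..1, (p n).compContinuousLinearMap fun _ => scaleSnd A B t
  refine ⟨q, r, ?_, hp.r_pos, fun {y} hy => ?_⟩
  -- Scaling by t in [0, 1] is a contraction, so averaging does not increase the norms of the
  -- coefficients.
  · refine hp.r_le.trans (FormalMultilinearSeries.radius_le_of_le fun n => ?_)
    refine (intervalIntegral.norm_integral_le_of_norm_le_const
      (C := ‖p n‖) fun t ht => norm_compScale_le _ (uIoc_subset_Icc ht)).trans ?_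
    simp
  · have hq : ∀ n, q n (fun _ => y) =
        ∫ t in (0 : ℝ)..1, p n fun _ => scaleSnd A B t y := by
      intro n
      exact (ContinuousLinearMap.intervalIntegral_comp_comm
        (ContinuousMultilinearMap.apply ℂ (fun _ : Fin n => A × B) H fun _ => y)
        ((continuous_compScale (p n)).intervalIntegrable 0 1)).symm
    simp_rw [hq]
    have hy' : (‖y‖₊ : ENNReal) < p.radius := by
      refine lt_of_lt_of_le ?_ hp.r_le
      exact mem_eball_zero_iff.mp hy
    have hsum := p.summable_norm_mul_pow hy'
    -- Sum and integral are exchanged by domination with ‖p n‖ ‖y‖ ^ n, which is independent of t.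
    refine intervalIntegral.hasSum_integral_of_dominated_convergence
      (fun n _ => ‖p n‖ * ‖y‖ ^ n) ?_ ?_ ?_ ?_ ?_
    · intro n
      refine Continuous.aestronglyMeasurable ?_
      exact (p n).cont.comp (continuous_pi fun _ =>
        continuous_scaleSnd.clm_apply continuous_const)
    · refine fun n => Filter.Eventually.of_forall fun t ht => ?_
      exact ((p n).compContinuousLinearMap fun _ => scaleSnd A B t).le_of_opNorm_le
        (norm_compScale_le _ (uIoc_subset_Icc ht)) (fun _ => y) |>.trans (by simp)
    · exact Filter.Eventually.of_forall fun t _ => hsum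
    · exact intervalIntegrable_const
    · refine Filter.Eventually.of_forall fun t ht => ?_
      have hT : scaleSnd A B t y ∈ Metric.eball (0 : A × B) r := by
        have h1 : ‖scaleSnd A B t y‖ ≤ ‖y‖ := by
          simpa using (scaleSnd A B t).le_of_opNorm_le (norm_scaleSnd_le (uIoc_subset_Icc ht)) y
        rw [mem_eball_zero_iff] at hy ⊢
        exact lt_of_le_of_lt (enorm_le_iff_norm_le.mpr h1) hy
      have h2 := hp.hasSum hT
      convert h2 using 2
      simp [scaleSnd]

/-- **Hadamard's lemma**: near `(a, 0)`, the difference `f (u, z) - f (u, 0)` is linear in `z`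
with coefficients which are analytic functions of `(u, z)`. -/
lemma exists_analytic_factor {f : A × B → H} {a : A} (hf : AnalyticAt ℂ f (a, 0)) :
    ∃ h : A × B → B →L[ℂ] H, AnalyticAt ℂ h (a, 0) ∧
      (∀ᶠ w in 𝓝 ((a, 0) : A × B), f w = f (w.1, 0) + h w w.2) ∧
      ∀ u, h (u, 0) = (fderiv ℂ f (u, 0)) ∘L ContinuousLinearMap.inr ℂ A B := by
  -- The partial derivative in z. Its average over the segment from (u, 0) to (u, z), applied to z,
  -- is f (u, z) - f (u, 0) by the fundamental theorem of calculus.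
  let g : A × B → B →L[ℂ] H := fun w => (fderiv ℂ f w) ∘L ContinuousLinearMap.inr ℂ A B
  have hg : AnalyticAt ℂ g (a, 0) :=
    ((ContinuousLinearMap.compL ℂ B (A × B) H).flip
      (ContinuousLinearMap.inr ℂ A B)).analyticAt _ |>.comp hf.fderiv
  refine ⟨fun w => ∫ t in (0 : ℝ)..1, g (w.1, (t : ℂ) • w.2), analyticAt_integral_scale hg, ?_, ?_⟩
  · obtain ⟨ε, hε, hball⟩ := Metric.eventually_nhds_iff_ball.mp hf.eventually_analyticAt
    filter_upwards [Metric.ball_mem_nhds _ hε] with w hw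
    have hmem : ∀ t ∈ Set.Icc (0 : ℝ) 1, AnalyticAt ℂ f (w.1, (t : ℂ) • w.2) := by
      intro t ht
      refine hball _ ?_
      rw [Metric.mem_ball, dist_eq_norm] at hw ⊢
      refine lt_of_le_of_lt ?_ hw
      -- The contraction fixes (a, 0), so the whole segment stays in the ball.
      have h1 := (scaleSnd A B t).le_of_opNorm_le (norm_scaleSnd_le ht) (w - (a, 0))
      rw [one_mul] at h1
      refine le_trans (le_of_eq ?_) h1
      congr 1
      ext <;> simp [scaleSnd]
    have hder : ∀ t ∈ Set.uIcc (0 : ℝ) 1,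
        HasDerivAt (fun t : ℝ => f (w.1, (t : ℂ) • w.2)) (g (w.1, (t : ℂ) • w.2) w.2) t := by
      intro t ht
      rw [Set.uIcc_of_le zero_le_one] at ht
      have h1 : HasDerivAt (fun t : ℝ => ((w.1, (t : ℂ) • w.2) : A × B)) (0, w.2) t := by
        refine (hasDerivAt_const t w.1).prodMk ?_
        simpa using (Complex.ofRealCLM.hasDerivAt (x := t)).smul_const w.2
      exact ((hmem t ht).differentiableAt.hasFDerivAt.restrictScalars ℝ).comp_hasDerivAt t h1
    have hcont : ContinuousOn (fun t : ℝ => g (w.1, (t : ℂ) • w.2)) (Set.uIcc (0 : ℝ) 1) := by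
      intro t ht
      rw [Set.uIcc_of_le zero_le_one] at ht
      have h1 : ContinuousAt g (w.1, (t : ℂ) • w.2) :=
        ((ContinuousLinearMap.compL ℂ B (A × B) H).flip
          (ContinuousLinearMap.inr ℂ A B)).continuous.continuousAt.comp
            (hmem t ht).fderiv.continuousAt
      have h2 : ContinuousAt (fun t : ℝ => ((w.1, (t : ℂ) • w.2) : A × B)) t := by fun_prop
      exact (ContinuousAt.comp (f := fun t : ℝ => ((w.1, (t : ℂ) • w.2) : A × B))
        h1 h2).continuousWithinAt
    have hint := hcont.intervalIntegrable (μ := MeasureTheory.volume)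
    have h3 := intervalIntegral.integral_eq_sub_of_hasDerivAt hder
      (ContinuousOn.intervalIntegrable (hcont.clm_apply continuousOn_const))
    have h4 := ContinuousLinearMap.intervalIntegral_comp_comm
      (ContinuousLinearMap.apply ℂ H w.2) hint
    have h5 : (∫ t in (0 : ℝ)..1, g (w.1, (t : ℂ) • w.2)) w.2 = f w - f (w.1, 0) := by
      refine h4.symm.trans (h3.trans ?_)
      simp
    rw [h5]
    abel
  · intro u
    simp [g]

/-- An analytic function of `(u, z)` vanishing to second order along `z = 0` is quadratic in `z`
with analytic coefficients. -/
lemma exists_analytic_quadratic {f : A × B → H} {a : A} (hf : AnalyticAt ℂ f (a, 0))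
    (h0 : ∀ᶠ u in 𝓝 a, f (u, 0) = 0) (h1 : ∀ᶠ u in 𝓝 a, fderiv ℂ f (u, 0) = 0) :
    ∃ h : A × B → B →L[ℂ] B →L[ℂ] H, AnalyticAt ℂ h (a, 0) ∧
      ∀ᶠ w in 𝓝 ((a, 0) : A × B), f w = h w w.2 w.2 := by
  obtain ⟨g, hg, hfg, hg0⟩ := exists_analytic_factor hf
  -- The coefficient g is the normal derivative of f along z = 0, which vanishes, so g is in turn
  -- linear in z.
  obtain ⟨h, hh, hgh, -⟩ := exists_analytic_factor hg
  refine ⟨h, hh, ?_⟩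
  have hfst : Filter.Tendsto (Prod.fst : A × B → A) (𝓝 (a, 0)) (𝓝 a) := continuousAt_fst
  filter_upwards [hfg, hgh, hfst.eventually h0, hfst.eventually h1] with w h2 h3 h4 h5
  rw [h2, h3, h4, hg0, h5]
  simp

end Hadamard


/-! ### Sections of bundles which are holomorphic at a point -/

section HolAt

variable {X : Type*} [TopologicalSpace X]
  {EX : Type*} [NormedAddCommGroup EX] [NormedSpace ℂ EX] [ChartedSpace EX X]
  {G : Type*} [NormedAddCommGroup G] [NormedSpace ℂ G]
  {W : X → Type*} [TopologicalSpace (TotalSpace G W)] [∀ x, TopologicalSpace (W x)]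
  [FiberBundle G W]

variable (EX G W) in
/-- `s` is a holomorphic section of the bundle `W` near the point `x₀`. -/
def IsHolAt (s : ∀ x, W x) (x₀ : X) : Prop :=
  ContMDiffAt 𝓘(ℂ, EX) (𝓘(ℂ, EX).prod 𝓘(ℂ, G)) ω (fun x => TotalSpace.mk' G x (s x)) x₀

lemma isHolOn_iff {U : Opens X} {s : ∀ x, W x} :
    IsHolOn EX G W U s ↔ ∀ x ∈ U, IsHolAt EX G W s x :=
  ⟨fun h _ hx => h.contMDiffAt (U.isOpen.mem_nhds hx),
    fun h x hx => (h x hx).contMDiffWithinAt⟩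

lemma IsHolAt.congr {s t : ∀ x, W x} {x₀ : X} (hs : IsHolAt EX G W s x₀)
    (h : ∀ᶠ x in 𝓝 x₀, t x = s x) : IsHolAt EX G W t x₀ :=
  ContMDiffAt.congr_of_eventuallyEq hs (h.mono fun x hx => by simp only [hx])

variable [∀ x, AddCommGroup (W x)] [∀ x, Module ℂ (W x)] [VectorBundle ℂ G W]

lemma IsHolAt.add {s t : ∀ x, W x} {x₀ : X} (hs : IsHolAt EX G W s x₀)
    (ht : IsHolAt EX G W t x₀) : IsHolAt EX G W (fun x => s x + t x) x₀ :=
  ContMDiffAt.add_section hs ht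

lemma IsHolAt.sub {s t : ∀ x, W x} {x₀ : X} (hs : IsHolAt EX G W s x₀)
    (ht : IsHolAt EX G W t x₀) : IsHolAt EX G W (fun x => s x - t x) x₀ :=
  ContMDiffAt.sub_section hs ht

lemma IsHolAt.smul {f : X → ℂ} {s : ∀ x, W x} {x₀ : X}
    (hf : ContMDiffAt 𝓘(ℂ, EX) 𝓘(ℂ, ℂ) ω f x₀)
    (hs : IsHolAt EX G W s x₀) : IsHolAt EX G W (fun x => f x • s x) x₀ :=
  ContMDiffAt.smul_section hf hs

lemma IsHolAt.sum {κ : Type*} {T : Finset κ} {s : κ → ∀ x, W x} {x₀ : X}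
    (hs : ∀ i ∈ T, IsHolAt EX G W (s i) x₀) : IsHolAt EX G W (fun x => ∑ i ∈ T, s i x) x₀ :=
  ContMDiffAt.sum_section hs

lemma isHolAt_zero (x₀ : X) : IsHolAt EX G W (fun _ => 0) x₀ :=
  contMDiffAt_zeroSection ℂ W

variable [ContMDiffVectorBundle ω G W 𝓘(ℂ, EX)]

lemma isHolAt_iff_coord (e : Trivialization G (π G W)) [MemTrivializationAtlas e] {x₀ : X}
    (hx : x₀ ∈ e.baseSet) {s : ∀ x, W x} :
    IsHolAt EX G W s x₀ ↔
      ContMDiffAt 𝓘(ℂ, EX) 𝓘(ℂ, G) ω (fun x => e.continuousLinearMapAt ℂ x (s x)) x₀ := by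
  rw [IsHolAt, e.contMDiffAt_section_iff hx]
  refine Filter.EventuallyEq.contMDiffAt_iff ?_
  filter_upwards [e.open_baseSet.mem_nhds hx] with x hx
  rw [Trivialization.continuousLinearMapAt_apply, Trivialization.coe_linearMapAt_of_mem _ hx]

lemma isHolAt_symmL (e : Trivialization G (π G W)) [MemTrivializationAtlas e] {x₀ : X}
    (hx : x₀ ∈ e.baseSet) {f : X → G} (hf : ContMDiffAt 𝓘(ℂ, EX) 𝓘(ℂ, G) ω f x₀) :
    IsHolAt EX G W (fun x => e.symmL ℂ x (f x)) x₀ := by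
  rw [isHolAt_iff_coord e hx]
  refine hf.congr_of_eventuallyEq ?_
  filter_upwards [e.open_baseSet.mem_nhds hx] with x hx
  rw [e.continuousLinearMapAt_symmL hx]

section Hom

variable {G' : Type*} [NormedAddCommGroup G'] [NormedSpace ℂ G']
  {W' : X → Type*} [TopologicalSpace (TotalSpace G' W')] [∀ x, TopologicalSpace (W' x)]
  [FiberBundle G' W'] [∀ x, AddCommGroup (W' x)] [∀ x, Module ℂ (W' x)] [VectorBundle ℂ G' W']
  [∀ x, IsTopologicalAddGroup (W' x)] [∀ x, ContinuousSMul ℂ (W' x)]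
  [ContMDiffVectorBundle ω G' W' 𝓘(ℂ, EX)]

omit [ContMDiffVectorBundle ω G W 𝓘(ℂ, EX)] [ContMDiffVectorBundle ω G' W' 𝓘(ℂ, EX)] in
lemma IsHolAt.clm_apply {A : ∀ x, W x →L[ℂ] W' x} {v : ∀ x, W x} {x₀ : X}
    (hA : IsHolAt EX (G →L[ℂ] G') (fun x => W x →L[ℂ] W' x) A x₀)
    (hv : IsHolAt EX G W v x₀) : IsHolAt EX G' W' (fun x => A x (v x)) x₀ :=
  ContMDiffAt.clm_bundle_apply hA hv

/-- A family of linear maps between the fibres of two bundles is holomorphic if it takes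
holomorphic sections to holomorphic sections. -/
lemma isHolAt_clm [FiniteDimensional ℂ G] {A : ∀ x, W x →L[ℂ] W' x} {x₀ : X}
    (h : ∀ v : ∀ x, W x, IsHolAt EX G W v x₀ → IsHolAt EX G' W' (fun x => A x (v x)) x₀) :
    IsHolAt EX (G →L[ℂ] G') (fun x => W x →L[ℂ] W' x) A x₀ := by
  refine (contMDiffAt_hom_bundle _).mpr ⟨contMDiffAt_id, ?_⟩
  set e := trivializationAt G W x₀
  set e' := trivializationAt G' W' x₀
  have he : x₀ ∈ e.baseSet := mem_baseSet_trivializationAt G W x₀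
  have he' : x₀ ∈ e'.baseSet := mem_baseSet_trivializationAt G' W' x₀
  let b := Module.finBasis ℂ G
  have h1 : ∀ k, ContMDiffAt 𝓘(ℂ, EX) 𝓘(ℂ, G') ω
      (fun x => e'.continuousLinearMapAt ℂ x (A x (e.symmL ℂ x (b k)))) x₀ := fun k =>
    (isHolAt_iff_coord e' he').mp (h _ (isHolAt_symmL e he contMDiffAt_const))
  -- In coordinates A is the sum of its columns, each being the image of a basis vector tensored
  -- with the dual coordinate.
  have h2 : ContMDiffAt 𝓘(ℂ, EX) 𝓘(ℂ, G →L[ℂ] G') ω (fun x => ∑ k,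
      ContinuousLinearMap.smulRightL ℂ G G' (LinearMap.toContinuousLinearMap (b.coord k))
        (e'.continuousLinearMapAt ℂ x (A x (e.symmL ℂ x (b k))))) x₀ := by
    refine ContMDiffAt.sum fun k _ => ?_
    exact (ContinuousLinearMap.contMDiff _).contMDiffAt.comp x₀ (h1 k)
  refine h2.congr_of_eventuallyEq (Filter.Eventually.of_forall fun x => ?_)
  refine ContinuousLinearMap.coe_injective (b.ext fun j => ?_)
  simp only [ContinuousLinearMap.inCoordinates, ContinuousLinearMap.coe_coe,
    ContinuousLinearMap.comp_apply, FunLike.coe_sum, Finset.sum_apply,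
    ContinuousLinearMap.smulRightL_apply_apply, ContinuousLinearMap.smulRight_apply,
    LinearMap.coe_toContinuousLinearMap', Module.Basis.coord_apply, Module.Basis.repr_self]
  rw [Finset.sum_eq_single j (fun k _ hk => by rw [Finsupp.single_eq_of_ne hk, zero_smul])
    (by simp)]
  simp [e, e']

end Hom

end HolAt

/-! ### Holomorphic vector fields along maps -/

section Tangent

variable {X : Type*} [TopologicalSpace X]
  {EX : Type*} [NormedAddCommGroup EX] [NormedSpace ℂ EX] [ChartedSpace EX X]
  [IsManifold 𝓘(ℂ, EX) ω X]
  {Y : Type*} [TopologicalSpace Y]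
  {EY : Type*} [NormedAddCommGroup EY] [NormedSpace ℂ EY] [ChartedSpace EY Y]
  [IsManifold 𝓘(ℂ, EY) ω Y]
  {Z : Type*} [TopologicalSpace Z]
  {EZ : Type*} [NormedAddCommGroup EZ] [NormedSpace ℂ EZ] [ChartedSpace EZ Z]
  [IsManifold 𝓘(ℂ, EZ) ω Z]

/-- The differential of a holomorphic map takes a holomorphic vector field along a map to a
holomorphic vector field. -/
lemma contMDiffAt_mfderiv_apply {b : X → Y} {f : Y → Z} {x₀ : X}
    {v : ∀ x, TangentSpace 𝓘(ℂ, EY) (b x)}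
    (hf : ContMDiffAt 𝓘(ℂ, EY) 𝓘(ℂ, EZ) ω f (b x₀))
    (hb : ContMDiffAt 𝓘(ℂ, EX) 𝓘(ℂ, EY) ω b x₀)
    (hv : ContMDiffAt 𝓘(ℂ, EX) (𝓘(ℂ, EY).prod 𝓘(ℂ, EY)) ω
      (fun x => (⟨b x, v x⟩ : TangentBundle 𝓘(ℂ, EY) Y)) x₀) :
    ContMDiffAt 𝓘(ℂ, EX) (𝓘(ℂ, EZ).prod 𝓘(ℂ, EZ)) ω
      (fun x => (⟨f (b x), mfderiv 𝓘(ℂ, EY) 𝓘(ℂ, EZ) f (b x) (v x)⟩ :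
        TangentBundle 𝓘(ℂ, EZ) Z)) x₀ := by
  have h1 : IsManifold 𝓘(ℂ, EX) 1 X := IsManifold.of_le (n := ω) le_top
  have h2 : IsManifold 𝓘(ℂ, EY) 1 Y := IsManifold.of_le (n := ω) le_top
  have h3 : IsManifold 𝓘(ℂ, EZ) 1 Z := IsManifold.of_le (n := ω) le_top
  -- The map f is seen as a constant family parametrised by X, so that the holomorphic dependence of
  -- a derivative on parameters applies.
  have hf' : ContMDiffAt (𝓘(ℂ, EX).prod 𝓘(ℂ, EY)) 𝓘(ℂ, EZ) ω
      (Function.uncurry fun _ : X => f) (x₀, b x₀) :=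
    ContMDiffAt.comp (x₀, b x₀) (g := f) (f := Prod.snd) hf contMDiffAt_snd
  have hd := ContMDiffAt.mfderiv (m := ω) (fun _ : X => f) b hf' hb le_top
  exact ContMDiffAt.clm_apply_of_inCoordinates (F₁ := EY) (F₂ := EZ)
    (E₁ := (TangentSpace 𝓘(ℂ, EY) : Y → Type _)) (E₂ := (TangentSpace 𝓘(ℂ, EZ) : Z → Type _))
    (b₁ := b) (b₂ := fun x => f (b x)) (v := v)
    (ϕ := fun x => mfderiv 𝓘(ℂ, EY) 𝓘(ℂ, EZ) f (b x)) hd hv (hf.comp x₀ hb)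

lemma contMDiffAt_tangent_model {G : Type*} [NormedAddCommGroup G] [NormedSpace ℂ G]
    {b v : X → G} {x₀ : X} :
    ContMDiffAt 𝓘(ℂ, EX) (𝓘(ℂ, G).prod 𝓘(ℂ, G)) ω
      (fun x => (⟨b x, v x⟩ : TangentBundle 𝓘(ℂ, G) G)) x₀ ↔
    ContMDiffAt 𝓘(ℂ, EX) 𝓘(ℂ, G) ω b x₀ ∧ ContMDiffAt 𝓘(ℂ, EX) 𝓘(ℂ, G) ω v x₀ := by
  rw [contMDiffAt_totalSpace]
  refine and_congr Iff.rfl (Filter.EventuallyEq.contMDiffAt_iff ?_)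
  refine Filter.Eventually.of_forall fun x => ?_
  simp [trivializationAt_model_space_apply]

/-- A section of the pulled back tangent bundle is holomorphic if it is a holomorphic vector field
along the map. -/
lemma isHolAt_pullback_iff {ι : C^ω⟮𝓘(ℂ, EX), X; 𝓘(ℂ, EY), Y⟯}
    {v : ∀ x, (ι *ᵖ (TangentSpace 𝓘(ℂ, EY) : Y → Type _)) x} {x₀ : X} :
    IsHolAt EX EY (ι *ᵖ (TangentSpace 𝓘(ℂ, EY) : Y → Type _)) v x₀ ↔
      ContMDiffAt 𝓘(ℂ, EX) (𝓘(ℂ, EY).prod 𝓘(ℂ, EY)) ω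
        (fun x => (⟨ι x, v x⟩ : TangentBundle 𝓘(ℂ, EY) Y)) x₀ := by
  rw [IsHolAt, contMDiffAt_section, contMDiffAt_totalSpace]
  exact (and_iff_right ι.contMDiff.contMDiffAt).symm

end Tangent


/-! ### Adapted coordinates along an immersion -/

section Adapted

universe uX uY uEX uEY

variable {X : Type uX} [TopologicalSpace X]
  {EX : Type uEX} [NormedAddCommGroup EX] [NormedSpace ℂ EX] [ChartedSpace EX X]
  [IsManifold 𝓘(ℂ, EX) ω X]
  {Y : Type uY} [TopologicalSpace Y]
  {EY : Type uEY} [NormedAddCommGroup EY] [NormedSpace ℂ EY] [ChartedSpace EY Y]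
  [IsManifold 𝓘(ℂ, EY) ω Y]

/-- The differential of a function, with values in `ℂ`. -/
def dFun (f : Y → ℂ) (y : Y) : TangentSpace 𝓘(ℂ, EY) y →L[ℂ] ℂ :=
  mfderiv 𝓘(ℂ, EY) 𝓘(ℂ, ℂ) f y

/-- Local data adapted to an immersion `ι` near `x₀`: a holomorphic retraction `p` of a
neighbourhood of `ι x₀` to `X`, defining functions `ζ i` of `X` and vector fields `v i` normal
to `X` with dual forms `d (ζ i)`. -/
structure AdaptedChart (ι : C^ω⟮𝓘(ℂ, EX), X; 𝓘(ℂ, EY), Y⟯) (x₀ : X) where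
  /-- the codimension of `X` -/
  n : ℕ
  /-- the retraction -/
  p : Y → X
  /-- the defining functions -/
  ζ : Fin n → Y → ℂ
  /-- the normal vector fields -/
  v : Fin n → ∀ x, TangentSpace 𝓘(ℂ, EY) (ι x)
  contMDiffAt_p : ContMDiffAt 𝓘(ℂ, EY) 𝓘(ℂ, EX) ω p (ι x₀)
  contMDiffAt_ζ : ∀ i, ContMDiffAt 𝓘(ℂ, EY) 𝓘(ℂ, ℂ) ω (ζ i) (ι x₀)
  isHolAt_v : ∀ i, IsHolAt EX EY (ι *ᵖ (TangentSpace 𝓘(ℂ, EY) : Y → Type uEY)) (v i) x₀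
  p_ι : ∀ᶠ x in 𝓝 x₀, p (ι x) = x
  ζ_ι : ∀ᶠ x in 𝓝 x₀, ∀ i, ζ i (ι x) = 0
  decomp : ∀ᶠ x in 𝓝 x₀, ∀ w : TangentSpace 𝓘(ℂ, EY) (ι x),
    w = mfderiv 𝓘(ℂ, EX) 𝓘(ℂ, EY) ι x (mfderiv 𝓘(ℂ, EY) 𝓘(ℂ, EX) p (ι x) w) +
      ∑ i, dFun (ζ i) (ι x) w • v i x
  quadratic : ∀ f : Y → ℂ, ContMDiffAt 𝓘(ℂ, EY) 𝓘(ℂ, ℂ) ω f (ι x₀) →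
    (∀ᶠ x in 𝓝 x₀, f (ι x) = 0) →
    (∀ᶠ x in 𝓝 x₀, dFun (EY := EY) f (ι x) = 0) →
    ∃ h : Fin n → Fin n → Y → ℂ, (∀ i j, ContMDiffAt 𝓘(ℂ, EY) 𝓘(ℂ, ℂ) ω (h i j) (ι x₀)) ∧
      ∀ᶠ y in 𝓝 (ι x₀), f y = ∑ i, ∑ j, h i j y * (ζ i y * ζ j y)

lemma contMDiffAt_eventually {Z : Type*} [TopologicalSpace Z] {EZ : Type*} [NormedAddCommGroup EZ]
    [NormedSpace ℂ EZ] [ChartedSpace EZ Z] [IsManifold 𝓘(ℂ, EZ) ω Z] {f : Y → Z} {y : Y}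
    (hf : ContMDiffAt 𝓘(ℂ, EY) 𝓘(ℂ, EZ) ω f y) :
    ∀ᶠ y' in 𝓝 y, ContMDiffAt 𝓘(ℂ, EY) 𝓘(ℂ, EZ) ω f y' := by
  exact (contMDiffAt_iff_contMDiffAt_nhds (by simp)).mp hf

/-- Turns the quadratic form produced by Hadamard's lemma into a combination of the products ζᵢ ζⱼ.
-/
lemma bilin_apply_eq_sum {C κ : Type*} [NormedAddCommGroup C] [NormedSpace ℂ C] [Fintype κ]
    (β : Module.Basis κ ℂ C) (B : C →L[ℂ] C →L[ℂ] ℂ) (z : C) :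
    B z z = ∑ i, ∑ j, B (β i) (β j) * (β.coord i z * β.coord j z) := by
  have h : ∀ A : C →L[ℂ] ℂ, A z = ∑ j, β.coord j z * A (β j) := by
    intro A
    conv_lhs => rw [← β.sum_repr z, map_sum]
    simp
  have h' : B z = ∑ i, β.coord i z • B (β i) := by
    conv_lhs => rw [← β.sum_repr z, map_sum]
    simp
  rw [h', sum_apply]
  refine Finset.sum_congr rfl fun i _ => ?_
  rw [smul_apply, h, smul_eq_mul, Finset.mul_sum]
  exact Finset.sum_congr rfl fun j _ => by ring

/-- In the charts of the immersion ι becomes u ↦ (u, 0) in EX × C. With q these coordinates on Y and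
Q their inverse, p is the first component of q carried back to X, the ζᵢ are the coordinates of the
second, and the vᵢ are the images of a basis of C under dQ. -/
lemma exists_adaptedChart [FiniteDimensional ℂ EY] (ι : C^ω⟮𝓘(ℂ, EX), X; 𝓘(ℂ, EY), Y⟯) {x₀ : X}
    (hι : Manifold.IsImmersionAt 𝓘(ℂ, EX) 𝓘(ℂ, EY) ω ι x₀) : Nonempty (AdaptedChart ι x₀) := by
  obtain ⟨C, _, _, h⟩ := hι
  let φ := h.domChart
  let ψ := h.codChart
  let L := h.equiv
  have hφ := contMDiffOn_of_mem_maximalAtlas h.domChart_mem_maximalAtlas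
  have hφ' := contMDiffOn_symm_of_mem_maximalAtlas h.domChart_mem_maximalAtlas
  have hψ := contMDiffOn_of_mem_maximalAtlas h.codChart_mem_maximalAtlas
  have hψ' := contMDiffOn_symm_of_mem_maximalAtlas h.codChart_mem_maximalAtlas
  have hx₀ : x₀ ∈ φ.source := h.mem_domChart_source
  have hsrc : ∀ x ∈ φ.source, ι x ∈ ψ.source := h.mapsto_domChart_source_codChart_source
  have hloc : ∀ x ∈ φ.source, ψ (ι x) = L (φ x, 0) := by
    intro x hx
    have h2 : φ x ∈ (h.domChart.extend 𝓘(ℂ, EX)).target := by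
      simpa using φ.map_source hx
    have h1 := h.writtenInCharts h2
    simpa [φ.left_inv hx, φ, ψ, L] using h1
  have hC : FiniteDimensional ℂ C := by
    refine FiniteDimensional.of_injective
      (L.toLinearEquiv.toLinearMap ∘ₗ LinearMap.inr ℂ EX C) ?_
    exact L.injective.comp (LinearMap.inr_injective)
  let q : Y → EX × C := fun y => L.symm (ψ y)
  let Q : EX × C → Y := fun w => ψ.symm (L w)
  have hq : ∀ x ∈ φ.source, q (ι x) = (φ x, 0) := fun x hx => by
    simp only [q, hloc x hx, L.symm_apply_apply]
  have hQ : ∀ x ∈ φ.source, Q (φ x, 0) = ι x := fun x hx => by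
    simp only [Q, ← hloc x hx, ψ.left_inv (hsrc x hx)]
  have hq_hol : ∀ x ∈ φ.source, ContMDiffAt 𝓘(ℂ, EY) 𝓘(ℂ, EX × C) ω q (ι x) := fun x hx =>
    (L.symm : EY →L[ℂ] EX × C).contMDiff.contMDiffAt.comp _
      (hψ.contMDiffAt (ψ.open_source.mem_nhds (hsrc x hx)))
  have hQ_hol : ∀ x ∈ φ.source, ContMDiffAt 𝓘(ℂ, EX × C) 𝓘(ℂ, EY) ω Q (φ x, 0) := by
    intro x hx
    refine ContMDiffAt.comp _ (hψ'.contMDiffAt (ψ.open_target.mem_nhds ?_))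
      (L : EX × C →L[ℂ] EY).contMDiff.contMDiffAt
    rw [← hloc x hx]
    exact ψ.map_source (hsrc x hx)
  have hQq : ∀ x ∈ φ.source, ∀ᶠ y in 𝓝 (ι x), Q (q y) = y := by
    intro x hx
    filter_upwards [ψ.open_source.mem_nhds (hsrc x hx)] with y hy
    simp only [Q, q, L.apply_symm_apply, ψ.left_inv hy]
  let β := Module.finBasis ℂ C
  let ζc : Fin (Module.finrank ℂ C) → (EX × C →L[ℂ] ℂ) := fun i =>
    (LinearMap.toContinuousLinearMap (β.coord i)) ∘L (ContinuousLinearMap.snd ℂ EX C)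
  refine ⟨{
    n := Module.finrank ℂ C
    p := fun y => φ.symm (q y).1
    ζ := fun i y => ζc i (q y)
    v := fun i x => mfderiv 𝓘(ℂ, EX × C) 𝓘(ℂ, EY) Q (q (ι x)) ((0, β i) : EX × C)
    contMDiffAt_p := ?_
    contMDiffAt_ζ := ?_
    isHolAt_v := ?_
    p_ι := ?_
    ζ_ι := ?_
    decomp := ?_
    quadratic := ?_ }⟩
  · refine ContMDiffAt.comp (ι x₀) (hφ'.contMDiffAt (φ.open_target.mem_nhds ?_))
      ((ContinuousLinearMap.fst ℂ EX C).contMDiff.contMDiffAt.comp _ (hq_hol x₀ hx₀))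
    rw [hq x₀ hx₀]
    exact φ.map_source hx₀
  · exact fun i => (ζc i).contMDiff.contMDiffAt.comp _ (hq_hol x₀ hx₀)
  · intro i
    refine isHolAt_pullback_iff.mpr ?_
    have h1 : ContMDiffAt 𝓘(ℂ, EX) 𝓘(ℂ, EX × C) ω (fun x => q (ι x)) x₀ :=
      (hq_hol x₀ hx₀).comp x₀ ι.contMDiff.contMDiffAt
    have h2 := contMDiffAt_mfderiv_apply (b := fun x => q (ι x)) (f := Q)
      (v := fun _ => ((0, β i) : EX × C))
      (by simpa only [hq x₀ hx₀] using hQ_hol x₀ hx₀) h1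
      (contMDiffAt_tangent_model.mpr ⟨h1, contMDiffAt_const⟩)
    refine h2.congr_of_eventuallyEq ?_
    filter_upwards [φ.open_source.mem_nhds hx₀] with x hx
    have h3 : Q (q (ι x)) = ι x := (hQq x hx).self_of_nhds
    exact TotalSpace.ext h3.symm HEq.rfl
  · filter_upwards [φ.open_source.mem_nhds hx₀] with x hx
    rw [hq x hx, φ.left_inv hx]
  · filter_upwards [φ.open_source.mem_nhds hx₀] with x hx i
    rw [hq x hx]
    simp [ζc]
  · filter_upwards [φ.open_source.mem_nhds hx₀] with x hx w
    let dι : EX →L[ℂ] EY := mfderiv 𝓘(ℂ, EX) 𝓘(ℂ, EY) ι x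
    let dq : EY →L[ℂ] EX × C := mfderiv 𝓘(ℂ, EY) 𝓘(ℂ, EX × C) q (ι x)
    let dQ : EX × C →L[ℂ] EY := mfderiv 𝓘(ℂ, EX × C) 𝓘(ℂ, EY) Q (q (ι x))
    let dφ : EX →L[ℂ] EX := mfderiv 𝓘(ℂ, EX) 𝓘(ℂ, EX) φ.symm (q (ι x)).1
    have hqx : (q (ι x)).1 = φ x := by rw [hq x hx]
    have hdq : HasMFDerivAt 𝓘(ℂ, EY) 𝓘(ℂ, EX × C) q (ι x) dq :=
      ((hq_hol x hx).mdifferentiableAt (by simp)).hasMFDerivAt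
    have hdQ : HasMFDerivAt 𝓘(ℂ, EX × C) 𝓘(ℂ, EY) Q (q (ι x)) dQ := by
      refine (MDifferentiableAt.hasMFDerivAt ?_)
      rw [hq x hx]
      exact (hQ_hol x hx).mdifferentiableAt (by simp)
    have hdφ : HasMFDerivAt 𝓘(ℂ, EX) 𝓘(ℂ, EX) φ.symm (q (ι x)).1 dφ := by
      refine (MDifferentiableAt.hasMFDerivAt ?_)
      rw [hqx]
      exact (hφ'.contMDiffAt (φ.open_target.mem_nhds (φ.map_source hx))).mdifferentiableAt (by simp)
    -- The chain rule below needs dι at φ⁻¹(φ x), which is only propositionally equal to x; the free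
    -- point x' absorbs the transport.
    have hdι : ∀ x', x' = x → HasMFDerivAt 𝓘(ℂ, EX) 𝓘(ℂ, EY) ι x' dι := by
      rintro _ rfl
      exact (ι.contMDiff.contMDiffAt.mdifferentiableAt (by simp)).hasMFDerivAt
    have e1 : dQ ∘L dq = ContinuousLinearMap.id ℂ EY :=
      hasMFDerivAt_unique (hdQ.comp (ι x) hdq)
        ((hasMFDerivAt_id (I := 𝓘(ℂ, EY)) (ι x)).congr_of_eventuallyEq (hQq x hx))
    have e2 : (mfderiv 𝓘(ℂ, EY) 𝓘(ℂ, EX) (fun y => φ.symm (q y).1) (ι x) : EY →L[ℂ] EX) =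
        dφ ∘L (ContinuousLinearMap.fst ℂ EX C) ∘L dq :=
      (hdφ.comp (ι x) (((ContinuousLinearMap.fst ℂ EX C).hasMFDerivAt (x := q (ι x))).comp
        (ι x) hdq)).mfderiv
    -- Both sides differentiate the identity ι ∘ φ⁻¹ = Q(·, 0).
    have e3 : dι ∘L dφ = dQ ∘L ContinuousLinearMap.inl ℂ EX C := by
      have h1 : HasMFDerivAt 𝓘(ℂ, EX) 𝓘(ℂ, EY) (Q ∘ (ContinuousLinearMap.inl ℂ EX C))
          (q (ι x)).1 (dQ ∘L ContinuousLinearMap.inl ℂ EX C) := by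
        refine HasMFDerivAt.comp _ ?_ (ContinuousLinearMap.inl ℂ EX C).hasMFDerivAt
        have h2 : (ContinuousLinearMap.inl ℂ EX C) (q (ι x)).1 = q (ι x) := by
          rw [hq x hx]; rfl
        rw [h2]
        exact hdQ
      refine hasMFDerivAt_unique ((hdι _ (by rw [hqx, φ.left_inv hx])).comp _ hdφ)
        (h1.congr_of_eventuallyEq ?_)
      rw [hqx]
      filter_upwards [φ.open_target.mem_nhds (φ.map_source hx)] with u hu
      have h3 := hQ _ (φ.map_target hu)
      rw [φ.right_inv hu] at h3
      exact h3.symm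
    have e4 : ∀ i, (mfderiv 𝓘(ℂ, EY) 𝓘(ℂ, ℂ) (fun y => ζc i (q y)) (ι x) : EY →L[ℂ] ℂ) =
        (ζc i) ∘L dq := fun i => (((ζc i).hasMFDerivAt (x := q (ι x))).comp (ι x) hdq).mfderiv
    have e5 : (w : EY) = dι (dφ (dq w).1) + ∑ i, ζc i (dq w) • dQ (0, β i) := by
      have h1 : dι (dφ (dq w).1) = dQ ((dq w).1, 0) :=
        DFunLike.congr_fun e3 (dq w).1
      have h2 : ∑ i, ζc i (dq w) • dQ (0, β i) = dQ (0, (dq w).2) := by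
        have h3 : ((0, (dq w).2) : EX × C) = ∑ i, ζc i (dq w) • ((0, β i) : EX × C) := by
          refine Prod.ext (by simp [Prod.fst_sum]) ?_
          simp [Prod.snd_sum, ζc]
        rw [h3, map_sum]
        exact Finset.sum_congr rfl fun i _ => (map_smul dQ _ _).symm
      rw [h1, h2, ← map_add, Prod.mk_add_mk, add_zero, zero_add]
      exact (DFunLike.congr_fun e1 w).symm
    refine Eq.trans e5 ?_
    refine congrArg₂ (fun a b : EY => a + b) ?_ (Finset.sum_congr rfl fun i _ => ?_)
    · exact congrArg dι (DFunLike.congr_fun e2 w).symm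
    · exact congrArg (fun a : ℂ => a • dQ (0, β i)) (DFunLike.congr_fun (e4 i) w).symm
  · intro f hf h0 h1
    let g : EX × C → ℂ := fun w => f (Q w)
    have hg : ContMDiffAt 𝓘(ℂ, EX × C) 𝓘(ℂ, ℂ) ω g (φ x₀, 0) := by
      refine ContMDiffAt.comp _ ?_ (hQ_hol x₀ hx₀)
      rwa [hQ x₀ hx₀]
    have hsymm : Filter.Tendsto φ.symm (𝓝 (φ x₀)) (𝓝 x₀) := by
      have := φ.continuousAt_symm (φ.map_source hx₀)
      rwa [ContinuousAt, φ.left_inv hx₀] at this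
    have hQs : ∀ u ∈ φ.target, Q (u, 0) = ι (φ.symm u) := by
      intro u hu
      have h3 := hQ _ (φ.map_target hu)
      rwa [φ.right_inv hu] at h3
    have htarget := φ.open_target.mem_nhds (φ.map_source hx₀)
    obtain ⟨h, hh, hgh⟩ := exists_analytic_quadratic
      (contMDiffAt_iff_contDiffAt.mp hg).analyticAt (by
        filter_upwards [hsymm.eventually h0, htarget] with u h2 hu
        simp only [g, hQs u hu, h2]) (by
        have hd : ∀ᶠ x in 𝓝 x₀, ContMDiffAt 𝓘(ℂ, EY) 𝓘(ℂ, ℂ) ω f (ι x) :=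
          ι.contMDiff.continuous.continuousAt.eventually (contMDiffAt_eventually hf)
        filter_upwards [hsymm.eventually h1, hsymm.eventually hd, htarget] with u h2 h3 hu
        have h4 : HasMFDerivAt 𝓘(ℂ, EY) 𝓘(ℂ, ℂ) f (Q (u, 0)) (0 : EY →L[ℂ] ℂ) := by
          rw [hQs u hu]
          have := (h3.mdifferentiableAt (by simp)).hasMFDerivAt
          have h5 : mfderiv 𝓘(ℂ, EY) 𝓘(ℂ, ℂ) f (ι (φ.symm u)) = 0 := h2
          rwa [h5] at this
        have h6 := hQ_hol _ (φ.map_target hu)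
        rw [φ.right_inv hu] at h6
        let dQ : EX × C →L[ℂ] EY := mfderiv 𝓘(ℂ, EX × C) 𝓘(ℂ, EY) Q (u, 0)
        have hdQ : HasMFDerivAt 𝓘(ℂ, EX × C) 𝓘(ℂ, EY) Q (u, 0) dQ :=
          (h6.mdifferentiableAt (by simp)).hasMFDerivAt
        have h7 : HasFDerivAt g ((0 : EY →L[ℂ] ℂ) ∘L dQ) (u, 0) :=
          hasMFDerivAt_iff_hasFDerivAt.mp (h4.comp (u, 0) hdQ)
        rw [h7.fderiv, ContinuousLinearMap.zero_comp])
    refine ⟨fun i j y => h (q y) (β i) (β j), fun i j => ?_, ?_⟩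
    · have h2 : ContDiffAt ℂ ω (fun w => h w (β i) (β j)) (φ x₀, 0) :=
        (hh.contDiffAt.clm_apply contDiffAt_const).clm_apply contDiffAt_const
      rw [← hq x₀ hx₀] at h2
      exact h2.contMDiffAt.comp (ι x₀) (hq_hol x₀ hx₀)
    · have h2 : Filter.Tendsto q (𝓝 (ι x₀)) (𝓝 (φ x₀, 0)) := by
        rw [← hq x₀ hx₀]
        exact (hq_hol x₀ hx₀).continuousAt
      filter_upwards [h2.eventually hgh, hQq x₀ hx₀] with y h3 h4
      simp only [g, h4] at h3
      rw [h3]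
      exact bilin_apply_eq_sum β (h (q y)) (q y).2

end Adapted


/-! ### Differentials of functions -/

section DFun

variable {Y : Type*} [TopologicalSpace Y]
  {EY : Type*} [NormedAddCommGroup EY] [NormedSpace ℂ EY] [ChartedSpace EY Y]

lemma dFun_congr {f g : Y → ℂ} {y : Y} (h : f =ᶠ[𝓝 y] g) :
    dFun (EY := EY) f y = dFun g y :=
  h.mfderiv_eq

variable [IsManifold 𝓘(ℂ, EY) ω Y]

lemma hasMFDerivAt_dFun {f : Y → ℂ} {y : Y} (hf : ContMDiffAt 𝓘(ℂ, EY) 𝓘(ℂ, ℂ) ω f y) :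
    HasMFDerivAt 𝓘(ℂ, EY) 𝓘(ℂ, ℂ) f y (dFun f y) :=
  (hf.mdifferentiableAt (by simp)).hasMFDerivAt

lemma dFun_add {f g : Y → ℂ} {y : Y} (hf : ContMDiffAt 𝓘(ℂ, EY) 𝓘(ℂ, ℂ) ω f y)
    (hg : ContMDiffAt 𝓘(ℂ, EY) 𝓘(ℂ, ℂ) ω g y) :
    dFun (EY := EY) (f + g) y = dFun f y + dFun g y :=
  ((hasMFDerivAt_dFun hf).add (hasMFDerivAt_dFun hg)).mfderiv

lemma dFun_sub {f g : Y → ℂ} {y : Y} (hf : ContMDiffAt 𝓘(ℂ, EY) 𝓘(ℂ, ℂ) ω f y)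
    (hg : ContMDiffAt 𝓘(ℂ, EY) 𝓘(ℂ, ℂ) ω g y) :
    dFun (EY := EY) (f - g) y = dFun f y - dFun g y :=
  ((hasMFDerivAt_dFun hf).sub (hasMFDerivAt_dFun hg)).mfderiv

lemma dFun_mul {f g : Y → ℂ} {y : Y} (hf : ContMDiffAt 𝓘(ℂ, EY) 𝓘(ℂ, ℂ) ω f y)
    (hg : ContMDiffAt 𝓘(ℂ, EY) 𝓘(ℂ, ℂ) ω g y) :
    dFun (EY := EY) (f * g) y = f y • dFun g y + g y • dFun f y :=
  ((hasMFDerivAt_dFun hf).mul (hasMFDerivAt_dFun hg)).mfderiv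

lemma dFun_mul_apply {f g : Y → ℂ} {y : Y} (hf : ContMDiffAt 𝓘(ℂ, EY) 𝓘(ℂ, ℂ) ω f y)
    (hg : ContMDiffAt 𝓘(ℂ, EY) 𝓘(ℂ, ℂ) ω g y) (w : TangentSpace 𝓘(ℂ, EY) y) :
    dFun (f * g) y w = f y * dFun g y w + g y * dFun f y w := by
  rw [dFun_mul hf hg]; rfl

lemma dFun_const (c : ℂ) (y : Y) : dFun (EY := EY) (fun _ : Y => c) y = 0 :=
  mfderiv_const

lemma dFun_sum {κ : Type*} (T : Finset κ) {f : κ → Y → ℂ} {y : Y}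
    (hf : ∀ i ∈ T, ContMDiffAt 𝓘(ℂ, EY) 𝓘(ℂ, ℂ) ω (f i) y) :
    dFun (EY := EY) (∑ i ∈ T, f i) y = ∑ i ∈ T, dFun (f i) y := by
  classical
  induction T using Finset.induction_on with
  | empty => exact dFun_const 0 y
  | insert i T hi ih =>
    have h1 : ContMDiffAt 𝓘(ℂ, EY) 𝓘(ℂ, ℂ) ω (∑ i ∈ T, f i) y := by
      have := ContMDiffAt.sum (t := T) fun j hj => hf j (Finset.mem_insert_of_mem hj)
      convert this using 1
      ext; simp
    rw [Finset.sum_insert hi, Finset.sum_insert hi, dFun_add (hf i (Finset.mem_insert_self i T)) h1,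
      ih fun j hj => hf j (Finset.mem_insert_of_mem hj)]

lemma dFun_comp {X : Type*} [TopologicalSpace X]
    {EX : Type*} [NormedAddCommGroup EX] [NormedSpace ℂ EX] [ChartedSpace EX X]
    [IsManifold 𝓘(ℂ, EX) ω X] {f : Y → ℂ} {b : X → Y} {x : X}
    (hf : ContMDiffAt 𝓘(ℂ, EY) 𝓘(ℂ, ℂ) ω f (b x)) (hb : ContMDiffAt 𝓘(ℂ, EX) 𝓘(ℂ, EY) ω b x) :
    dFun (EY := EX) (fun x => f (b x)) x = dFun f (b x) ∘L mfderiv 𝓘(ℂ, EX) 𝓘(ℂ, EY) b x :=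
  ((hasMFDerivAt_dFun hf).comp x (hb.mdifferentiableAt (by simp)).hasMFDerivAt).mfderiv

end DFun

/-! ### The structure sheaf of the first infinitesimal neighbourhood in terms of jets -/

section Jets

universe uX uY uEX uEY

variable {X : Type uX} [TopologicalSpace X]
  {EX : Type uEX} [NormedAddCommGroup EX] [NormedSpace ℂ EX] [ChartedSpace EX X]
  {Y : Type uY} [TopologicalSpace Y]
  {EY : Type uEY} [NormedAddCommGroup EY] [NormedSpace ℂ EY] [ChartedSpace EY Y]
  {ι : C^ω⟮𝓘(ℂ, EX), X; 𝓘(ℂ, EY), Y⟯}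

/-! ### Values and differentials on the stalks of O_{X₁} -/

namespace O1Stalk

lemma exists_of {x : X} (σ : O1Stalk ι x) : ∃ f hf, σ = of ι x f hf := by
  obtain ⟨⟨_, f, hf, rfl⟩, rfl⟩ := Ideal.Quotient.mk_surjective σ
  exact ⟨f, hf, rfl⟩

lemma value_of {x : X} {f : Y → ℂ} (hf : ContMDiffAt 𝓘(ℂ, EY) 𝓘(ℂ, ℂ) ω f (ι x)) :
    value ι x (of ι x f hf) = f (ι x) := rfl

lemma eq_zero_of_mem_idealStalk {x : X} {f : Y → ℂ}
    (hf : ContMDiffAt 𝓘(ℂ, EY) 𝓘(ℂ, ℂ) ω f (ι x))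
    (h : (⟨f, f, hf, rfl⟩ : HolGerm EY (ι x)) ∈ idealStalk ι x) : f (ι x) = 0 :=
  (Filter.Germ.coe_eq.mp (show ((f ∘ ι : X → ℂ) : Filter.Germ (𝓝 x) ℂ) = ((0 : X → ℂ) :) from
    h)).self_of_nhds

lemma mem_idealStalk {x : X} {f : Y → ℂ}
    (hf : ContMDiffAt 𝓘(ℂ, EY) 𝓘(ℂ, ℂ) ω f (ι x)) (h : ∀ᶠ x' in 𝓝 x, f (ι x') = 0) :
    (⟨f, f, hf, rfl⟩ : HolGerm EY (ι x)) ∈ idealStalk ι x :=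
  show ((f ∘ ι : X → ℂ) : Filter.Germ (𝓝 x) ℂ) = ((0 : X → ℂ) :) from Filter.Germ.coe_eq.mpr h

variable [IsManifold 𝓘(ℂ, EY) ω Y]

/-- By the Leibniz rule a product of two functions vanishing at a point has zero differential there.
So the differential descends to O_Y / I². -/
lemma dFun_eq_zero_of_mem {x : X} {a : HolGerm EY (ι x)} (ha : a ∈ idealStalk ι x ^ 2)
    {f : Y → ℂ} (hfa : (f : Filter.Germ (𝓝 (ι x)) ℂ) = a) :
    dFun (EY := EY) f (ι x) = 0 := by
  rw [pow_two] at ha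
  induction ha using Submodule.mul_induction_on' generalizing f with
  | mem_mul_mem m hm n hn =>
    obtain ⟨_, g, hg, rfl⟩ := m
    obtain ⟨_, h, hh, rfl⟩ := n
    have h1 : f =ᶠ[𝓝 (ι x)] g * h := Filter.Germ.coe_eq.mp hfa
    rw [dFun_congr h1]
    ext w
    rw [dFun_mul_apply hg hh, eq_zero_of_mem_idealStalk hg hm,
      eq_zero_of_mem_idealStalk hh hn, zero_mul, zero_mul, add_zero]
    rfl
  | add a _ b _ iha ihb =>
    obtain ⟨_, g, hg, rfl⟩ := a
    obtain ⟨_, h, hh, rfl⟩ := b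
    have h1 : f =ᶠ[𝓝 (ι x)] g + h := Filter.Germ.coe_eq.mp hfa
    rw [dFun_congr h1, dFun_add hg hh, iha rfl, ihb rfl, add_zero]

lemma dFun_eq_of_of_eq {x : X} {f g : Y → ℂ} {hf : ContMDiffAt 𝓘(ℂ, EY) 𝓘(ℂ, ℂ) ω f (ι x)}
    {hg : ContMDiffAt 𝓘(ℂ, EY) 𝓘(ℂ, ℂ) ω g (ι x)} (h : of ι x f hf = of ι x g hg) :
    dFun (EY := EY) f (ι x) = dFun g (ι x) := by
  rw [← sub_eq_zero, ← dFun_sub hf hg]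
  exact dFun_eq_zero_of_mem (Ideal.Quotient.eq.mp h) rfl

/-- The differential of an element of `O_{Y,ι(x)} / I_x²`, a linear form on the tangent space of
`Y`. -/
def d {x : X} (σ : O1Stalk ι x) : TangentSpace 𝓘(ℂ, EY) (ι x) →L[ℂ] ℂ :=
  dFun σ.exists_of.choose (ι x)

lemma d_of {x : X} {f : Y → ℂ} (hf : ContMDiffAt 𝓘(ℂ, EY) 𝓘(ℂ, ℂ) ω f (ι x)) :
    d (of ι x f hf) = dFun f (ι x) :=
  (dFun_eq_of_of_eq (exists_of (of ι x f hf)).choose_spec.choose_spec).symm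

lemma d_add {x : X} (σ τ : O1Stalk ι x) : d (σ + τ) = d σ + d τ := by
  obtain ⟨f, hf, rfl⟩ := σ.exists_of
  obtain ⟨g, hg, rfl⟩ := τ.exists_of
  rw [d_of, d_of, ← dFun_add hf hg]
  exact d_of (hf.add hg)

lemma d_mul {x : X} (σ τ : O1Stalk ι x) :
    d (σ * τ) = value ι x σ • d τ + value ι x τ • d σ := by
  obtain ⟨f, hf, rfl⟩ := σ.exists_of
  obtain ⟨g, hg, rfl⟩ := τ.exists_of
  rw [d_of, d_of, value_of, value_of, ← dFun_mul hf hg]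
  exact d_of (hf.mul hg)

lemma d_one {x : X} : d (1 : O1Stalk ι x) = 0 :=
  (d_of (contMDiffAt_const (c := (1 : ℂ)))).trans (dFun_const 1 _)

lemma d_zero {x : X} : d (0 : O1Stalk ι x) = 0 :=
  (d_of (contMDiffAt_const (c := (0 : ℂ)))).trans (dFun_const 0 _)

variable [IsManifold 𝓘(ℂ, EX) ω X]

/-- Functions with the same `1`-jet along `X` agree modulo the square of the ideal of `X`. -/
lemma of_eq_of {x : X} (A : AdaptedChart ι x) {f g : Y → ℂ}
    (hf : ContMDiffAt 𝓘(ℂ, EY) 𝓘(ℂ, ℂ) ω f (ι x)) (hg : ContMDiffAt 𝓘(ℂ, EY) 𝓘(ℂ, ℂ) ω g (ι x))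
    (h : ∀ᶠ x' in 𝓝 x, f (ι x') = g (ι x') ∧ dFun (EY := EY) f (ι x') = dFun g (ι x')) :
    of ι x f hf = of ι x g hg := by
  have hd : ∀ᶠ x' in 𝓝 x, dFun (EY := EY) (f - g) (ι x') = 0 := by
    have h1 := ι.contMDiff.continuous.continuousAt.eventually
      ((contMDiffAt_eventually hf).and (contMDiffAt_eventually hg))
    filter_upwards [h, h1] with x' h2 h3
    rw [dFun_sub h3.1 h3.2, h2.2, sub_self]
  -- The difference has zero 1-jet along X, so it is a combination of the products ζᵢ ζⱼ, and each
  -- ζᵢ lies in the ideal.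
  obtain ⟨k, hk, hfk⟩ := A.quadratic (f - g) (hf.sub hg)
    (h.mono fun x' h1 => by rw [Pi.sub_apply, h1.1, sub_self]) hd
  refine Ideal.Quotient.eq.mpr ?_
  let Z : Fin A.n → HolGerm EY (ι x) := fun i => ⟨A.ζ i, A.ζ i, A.contMDiffAt_ζ i, rfl⟩
  have hZ : ∀ i, Z i ∈ idealStalk ι x := fun i =>
    mem_idealStalk (A.contMDiffAt_ζ i) (A.ζ_ι.mono fun _ h1 => h1 i)
  let K : Fin A.n → Fin A.n → HolGerm EY (ι x) := fun i j => ⟨k i j, k i j, hk i j, rfl⟩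
  have h2 : (⟨f, f, hf, rfl⟩ - ⟨g, g, hg, rfl⟩ : HolGerm EY (ι x)) =
      ∑ i, ∑ j, K i j * (Z i * Z j) := by
    refine Subtype.ext ?_
    have h3 : ((f - g : Y → ℂ) : Filter.Germ (𝓝 (ι x)) ℂ) =
        ((∑ i, ∑ j, k i j * (A.ζ i * A.ζ j) : Y → ℂ) :) := by
      refine Filter.Germ.coe_eq.mpr (hfk.mono fun y h3 => ?_)
      rw [h3]
      simp [Finset.sum_apply]
    refine h3.trans ?_
    have h4 : ∀ F : Y → ℂ, (F : Filter.Germ (𝓝 (ι x)) ℂ) =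
      Filter.Germ.coeRingHom (𝓝 (ι x)) F := fun _ => rfl
    simp only [AddSubmonoidClass.coe_finsetSum, Subring.coe_mul, K, Z, h4, map_sum, map_mul]
  rw [h2, pow_two]
  exact Ideal.sum_mem _ fun i _ => Ideal.sum_mem _ fun j _ =>
    Ideal.mul_mem_left _ _ (Ideal.mul_mem_mul (hZ i) (hZ j))

end O1Stalk

/-! ### The 1-jet of a section of O_{X₁} -/

namespace O1

variable {U : Opens X}

open Classical in
/-- The function on `X` underlying a section of `O_{X₁}`, extended by zero. -/
def val (a : O1 ι U) (x : X) : ℂ :=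
  if h : x ∈ U then O1.toFun ι U a ⟨x, h⟩ else 0

lemma val_of_mem (a : O1 ι U) {x : X} (h : x ∈ U) :
    a.val x = O1Stalk.value ι x (a.1 ⟨x, h⟩) := dif_pos h

lemma toFun_eq_val (a : O1 ι U) {x : X} (h : x ∈ U) : O1.toFun ι U a ⟨x, h⟩ = a.val x :=
  (val_of_mem a h).symm

variable [IsManifold 𝓘(ℂ, EY) ω Y]

open Classical in
/-- The differential of a section of `O_{X₁}`, extended by zero. -/
def d (a : O1 ι U) (x : X) : TangentSpace 𝓘(ℂ, EY) (ι x) →L[ℂ] ℂ :=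
  if h : x ∈ U then O1Stalk.d (a.1 ⟨x, h⟩) else 0

lemma d_of_mem (a : O1 ι U) {x : X} (h : x ∈ U) :
    a.d x = O1Stalk.d (a.1 ⟨x, h⟩) := dif_pos h

lemma val_add (a b : O1 ι U) {x : X} (h : x ∈ U) : (a + b).val x = a.val x + b.val x := by
  simp only [val_of_mem _ h, ← map_add]; rfl

lemma val_mul (a b : O1 ι U) {x : X} (h : x ∈ U) : (a * b).val x = a.val x * b.val x := by
  simp only [val_of_mem _ h, ← map_mul]; rfl

lemma d_add (a b : O1 ι U) {x : X} (h : x ∈ U) : (a + b).d x = a.d x + b.d x := by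
  simp only [d_of_mem _ h, ← O1Stalk.d_add]; rfl

lemma d_mul (a b : O1 ι U) {x : X} (h : x ∈ U) :
    (a * b).d x = a.val x • b.d x + b.val x • a.d x := by
  simp only [d_of_mem _ h, val_of_mem _ h, ← O1Stalk.d_mul]; rfl

lemma val_one {x : X} (h : x ∈ U) : (1 : O1 ι U).val x = 1 := by
  rw [val_of_mem _ h]; exact map_one (O1Stalk.value ι x)

lemma val_zero {x : X} (h : x ∈ U) : (0 : O1 ι U).val x = 0 := by
  rw [val_of_mem _ h]; exact map_zero (O1Stalk.value ι x)

lemma d_one {x : X} (h : x ∈ U) : (1 : O1 ι U).d x = 0 := by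
  rw [d_of_mem _ h]; exact O1Stalk.d_one

lemma d_zero {x : X} (h : x ∈ U) : (0 : O1 ι U).d x = 0 := by
  rw [d_of_mem _ h]; exact O1Stalk.d_zero

lemma val_res {V : Opens X} (h : V ≤ U) (a : O1 ι U) {x : X} (hx : x ∈ V) :
    (O1.res ι h a).val x = a.val x := by
  rw [val_of_mem _ hx, val_of_mem _ (h hx)]; rfl

lemma d_res {V : Opens X} (h : V ≤ U) (a : O1 ι U) {x : X} (hx : x ∈ V) :
    (O1.res ι h a).d x = a.d x := by
  rw [d_of_mem _ hx, d_of_mem _ (h hx)]; rfl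

/-- One function on Y serves all nearby stalks, so holomorphy and derivatives of the jet can be read
off from it. -/
lemma exists_rep (a : O1 ι U) {x₀ : X} (hx₀ : x₀ ∈ U) : ∃ f : Y → ℂ, ∀ᶠ x in 𝓝 x₀,
    ∃ (hx : x ∈ U) (hf : ContMDiffAt 𝓘(ℂ, EY) 𝓘(ℂ, ℂ) ω f (ι x)),
      a.1 ⟨x, hx⟩ = O1Stalk.of ι x f hf ∧ a.val x = f (ι x) ∧ a.d x = dFun f (ι x) := by
  obtain ⟨f, hf⟩ := a.2 ⟨x₀, hx₀⟩
  refine ⟨f, ?_⟩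
  rw [← U.isOpen.isOpenEmbedding_subtypeVal.map_nhds_eq ⟨x₀, hx₀⟩, Filter.eventually_map]
  filter_upwards [hf] with x ⟨h1, h2⟩
  refine ⟨x.2, h1, h2, ?_, ?_⟩
  · exact (val_of_mem a x.2).trans (congrArg (O1Stalk.value ι x.1) h2)
  · exact (d_of_mem a x.2).trans ((congrArg O1Stalk.d h2).trans (O1Stalk.d_of h1))

variable [IsManifold 𝓘(ℂ, EX) ω X]

lemma contMDiffAt_val (a : O1 ι U) {x₀ : X} (hx₀ : x₀ ∈ U) :
    ContMDiffAt 𝓘(ℂ, EX) 𝓘(ℂ, ℂ) ω a.val x₀ := by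
  obtain ⟨f, hf⟩ := a.exists_rep hx₀
  obtain ⟨_, h, -⟩ := hf.self_of_nhds
  refine (h.comp x₀ ι.contMDiff.contMDiffAt).congr_of_eventuallyEq ?_
  filter_upwards [hf] with x ⟨_, _, _, h1, _⟩ using h1

lemma contMDiffAt_d (a : O1 ι U) {x₀ : X} (hx₀ : x₀ ∈ U)
    {v : ∀ x, TangentSpace 𝓘(ℂ, EY) (ι x)}
    (hv : IsHolAt EX EY (ι *ᵖ (TangentSpace 𝓘(ℂ, EY) : Y → Type uEY)) v x₀) :
    ContMDiffAt 𝓘(ℂ, EX) 𝓘(ℂ, ℂ) ω (fun x => a.d x (v x)) x₀ := by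
  obtain ⟨f, hf⟩ := a.exists_rep hx₀
  obtain ⟨_, h, -⟩ := hf.self_of_nhds
  have h1 := contMDiffAt_mfderiv_apply h ι.contMDiff.contMDiffAt (isHolAt_pullback_iff.mp hv)
  refine (contMDiffAt_tangent_model.mp h1).2.congr_of_eventuallyEq ?_
  filter_upwards [hf] with x ⟨_, _, _, _, h2⟩
  rw [h2]; rfl

/-- The chain rule for f ∘ ι, with f a local representative. This is the compatibility condition on
jets. -/
lemma d_mfderiv (a : O1 ι U) {x : X} (hx : x ∈ U) (w : TangentSpace 𝓘(ℂ, EX) x) :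
    a.d x (mfderiv 𝓘(ℂ, EX) 𝓘(ℂ, EY) ι x w) = dFun a.val x w := by
  obtain ⟨f, hf⟩ := a.exists_rep hx
  obtain ⟨_, h, _, _, h1⟩ := hf.self_of_nhds
  have h2 : a.val =ᶠ[𝓝 x] fun x => f (ι x) := by
    filter_upwards [hf] with x ⟨_, _, _, h1, _⟩ using h1
  rw [dFun_congr h2, h1, dFun_comp h ι.contMDiff.contMDiffAt]
  rfl

/-- Local representatives with the same 1-jet along X differ by an element of I², by
`O1Stalk.of_eq_of`. -/
lemma ext_jet (hA : ∀ x, Nonempty (AdaptedChart ι x)) {a b : O1 ι U}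
    (h : ∀ x ∈ U, a.val x = b.val x) (h' : ∀ x ∈ U, a.d x = b.d x) : a = b := by
  refine Subtype.ext (funext fun ⟨x, hx⟩ => ?_)
  obtain ⟨f, hf⟩ := a.exists_rep hx
  obtain ⟨g, hg⟩ := b.exists_rep hx
  obtain ⟨_, hf1, hf2, -⟩ := hf.self_of_nhds
  obtain ⟨_, hg1, hg2, -⟩ := hg.self_of_nhds
  rw [hf2, hg2]
  refine O1Stalk.of_eq_of (hA x).some hf1 hg1 ?_
  filter_upwards [hf, hg, U.isOpen.mem_nhds hx] with x' ⟨_, _, _, h1, h2⟩ ⟨_, _, _, h3, h4⟩ hx'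
  exact ⟨by rw [← h1, ← h3, h x' hx'], by rw [← h2, ← h4, h' x' hx']⟩

end O1

/-- A compatible pair consisting of a function on `X` and a section of `Ω¹_{Y|X}` is locally the
`1`-jet of a holomorphic function on `Y`. -/
lemma AdaptedChart.exists_jet [IsManifold 𝓘(ℂ, EX) ω X] [IsManifold 𝓘(ℂ, EY) ω Y] {x₀ : X}
    (A : AdaptedChart ι x₀) {f : X → ℂ} {θ : ∀ x, TangentSpace 𝓘(ℂ, EY) (ι x) →L[ℂ] ℂ}
    (hf : ContMDiffAt 𝓘(ℂ, EX) 𝓘(ℂ, ℂ) ω f x₀)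
    (hθ : ∀ v : ∀ x, TangentSpace 𝓘(ℂ, EY) (ι x),
      IsHolAt EX EY (ι *ᵖ (TangentSpace 𝓘(ℂ, EY) : Y → Type uEY)) v x₀ →
      ContMDiffAt 𝓘(ℂ, EX) 𝓘(ℂ, ℂ) ω (fun x => θ x (v x)) x₀)
    (hfθ : ∀ᶠ x in 𝓝 x₀, ∀ w : TangentSpace 𝓘(ℂ, EX) x,
      θ x (mfderiv 𝓘(ℂ, EX) 𝓘(ℂ, EY) ι x w) = dFun f x w) :
    ∃ F : Y → ℂ, ∀ᶠ x in 𝓝 x₀, ContMDiffAt 𝓘(ℂ, EY) 𝓘(ℂ, ℂ) ω F (ι x) ∧ F (ι x) = f x ∧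
      dFun F (ι x) = θ x := by
  let g : Fin A.n → X → ℂ := fun i x => θ x (A.v i x)
  have hg : ∀ i, ContMDiffAt 𝓘(ℂ, EX) 𝓘(ℂ, ℂ) ω (g i) x₀ := fun i => hθ _ (A.isHolAt_v i)
  -- A first order Taylor polynomial in the normal direction: the first term gives the value f and
  -- the tangential derivative, the second corrects the derivative along vᵢ to θ(vᵢ).
  refine ⟨(fun y => f (A.p y)) + ∑ i, A.ζ i * (fun y => g i (A.p y)), ?_⟩
  have hp := ι.contMDiff.continuous.continuousAt.eventually (contMDiffAt_eventually A.contMDiffAt_p)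
  have hζ := ι.contMDiff.continuous.continuousAt.eventually
    (Filter.eventually_all.mpr fun i => contMDiffAt_eventually (A.contMDiffAt_ζ i))
  filter_upwards [hp, hζ, contMDiffAt_eventually hf,
    Filter.eventually_all.mpr fun i => contMDiffAt_eventually (hg i), A.p_ι, A.ζ_ι, A.decomp, hfθ]
    with x hp hζ hf hg hpι hζι hdec hfθ
  have hf1 : ContMDiffAt 𝓘(ℂ, EX) 𝓘(ℂ, ℂ) ω f (A.p (ι x)) := by rwa [hpι]
  have hg1 : ∀ i, ContMDiffAt 𝓘(ℂ, EX) 𝓘(ℂ, ℂ) ω (g i) (A.p (ι x)) := by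
    intro i; rw [hpι]; exact hg i
  have hf2 : ContMDiffAt 𝓘(ℂ, EY) 𝓘(ℂ, ℂ) ω (fun y => f (A.p y)) (ι x) := hf1.comp (ι x) hp
  have hg2 : ∀ i, ContMDiffAt 𝓘(ℂ, EY) 𝓘(ℂ, ℂ) ω (fun y => g i (A.p y)) (ι x) :=
    fun i => (hg1 i).comp (ι x) hp
  have hm : ∀ i, ContMDiffAt 𝓘(ℂ, EY) 𝓘(ℂ, ℂ) ω (A.ζ i * fun y => g i (A.p y)) (ι x) :=
    fun i => (hζ i).mul (hg2 i)
  have hs : ContMDiffAt 𝓘(ℂ, EY) 𝓘(ℂ, ℂ) ω (∑ i, A.ζ i * fun y => g i (A.p y)) (ι x) := by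
    have := ContMDiffAt.sum (t := Finset.univ) fun i _ => hm i
    convert this using 1
    ext; simp
  refine ⟨hf2.add hs, ?_, ?_⟩
  · simp [hpι, hζι]
  · rw [dFun_add hf2 hs, dFun_sum _ fun i _ => hm i]
    ext w
    have h1 : dFun (fun y => f (A.p y)) (ι x) w =
        dFun f (A.p (ι x)) (mfderiv 𝓘(ℂ, EY) 𝓘(ℂ, EX) A.p (ι x) w) := by
      rw [dFun_comp hf1 hp]; rfl
    have h2 : ∀ i, dFun (A.ζ i * fun y => g i (A.p y)) (ι x) w = dFun (A.ζ i) (ι x) w * g i x := by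
      intro i
      rw [dFun_mul_apply (hζ i) (hg2 i), hζι, zero_mul, zero_add, hpι, mul_comm]
    have h3 : dFun f (A.p (ι x)) (mfderiv 𝓘(ℂ, EY) 𝓘(ℂ, EX) A.p (ι x) w) =
        dFun f x (mfderiv 𝓘(ℂ, EY) 𝓘(ℂ, EX) A.p (ι x) w) := by
      have h4 : ∀ x', x' = x → ∀ u : EX, dFun (EY := EX) f x' u = dFun (EY := EX) f x u := by
        rintro _ rfl _; rfl
      exact h4 _ hpι _
    rw [add_apply, sum_apply, h1, h3, Finset.sum_congr rfl fun i _ => h2 i]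
    conv_rhs => rw [hdec w, map_add, map_sum]
    refine congrArg₂ (· + ·) (hfθ _).symm (Finset.sum_congr rfl fun i _ => ?_)
    exact ((θ x).map_smul _ _).symm

namespace O1

variable {U : Opens X} [IsManifold 𝓘(ℂ, EX) ω X] [IsManifold 𝓘(ℂ, EY) ω Y]

/-- Local functions with the prescribed jet glue, since their germs modulo I² are determined by that
jet. -/
lemma exists_of_jet (hA : ∀ x, Nonempty (AdaptedChart ι x)) {f : X → ℂ}
    {θ : ∀ x, TangentSpace 𝓘(ℂ, EY) (ι x) →L[ℂ] ℂ}
    (hf : ∀ x ∈ U, ContMDiffAt 𝓘(ℂ, EX) 𝓘(ℂ, ℂ) ω f x)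
    (hθ : ∀ x₀ ∈ U, ∀ v : ∀ x, TangentSpace 𝓘(ℂ, EY) (ι x),
      IsHolAt EX EY (ι *ᵖ (TangentSpace 𝓘(ℂ, EY) : Y → Type uEY)) v x₀ →
      ContMDiffAt 𝓘(ℂ, EX) 𝓘(ℂ, ℂ) ω (fun x => θ x (v x)) x₀)
    (hfθ : ∀ x ∈ U, ∀ w : TangentSpace 𝓘(ℂ, EX) x,
      θ x (mfderiv 𝓘(ℂ, EX) 𝓘(ℂ, EY) ι x w) = dFun f x w) :
    ∃ a : O1 ι U, ∀ x ∈ U, a.val x = f x ∧ a.d x = θ x := by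
  have h1 : ∀ x₀ : U, ∃ F : Y → ℂ, ∀ᶠ x in 𝓝 x₀.1, ContMDiffAt 𝓘(ℂ, EY) 𝓘(ℂ, ℂ) ω F (ι x) ∧
      F (ι x) = f x ∧ dFun F (ι x) = θ x := fun x₀ =>
    (hA x₀).some.exists_jet (hf _ x₀.2) (hθ _ x₀.2)
      (by filter_upwards [U.isOpen.mem_nhds x₀.2] with x hx using hfθ x hx)
  choose F hF using h1
  -- Each stalk uses the function chosen for its own point; near x₀ the function chosen for x₀ has
  -- the same jet and defines the same elements.
  let a : O1 ι U := ⟨fun x => O1Stalk.of ι x (F x) (hF x).self_of_nhds.1, fun x₀ => ⟨F x₀, by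
    have h2 := continuous_subtype_val.continuousAt.eventually (hF x₀).eventually_nhds
    filter_upwards [h2] with x hx
    refine ⟨hx.self_of_nhds.1, O1Stalk.of_eq_of (hA x).some _ _ ?_⟩
    filter_upwards [hx, hF x] with x' h3 h4
    exact ⟨h4.2.1.trans h3.2.1.symm, h4.2.2.trans h3.2.2.symm⟩⟩⟩
  refine ⟨a, fun x hx => ⟨?_, ?_⟩⟩
  · rw [val_of_mem a hx]
    exact (hF ⟨x, hx⟩).self_of_nhds.2.1
  · rw [d_of_mem a hx]
    exact (O1Stalk.d_of (hF ⟨x, hx⟩).self_of_nhds.1).trans (hF ⟨x, hx⟩).self_of_nhds.2.2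

end O1

end Jets


/-! ### The connection given by a trivialisation -/

section Connection

variable {X : Type*} [TopologicalSpace X]
  {EX : Type*} [NormedAddCommGroup EX] [NormedSpace ℂ EX] [ChartedSpace EX X]
  [IsManifold 𝓘(ℂ, EX) ω X]
  {F : Type*} [NormedAddCommGroup F] [NormedSpace ℂ F]
  {V : X → Type*} [TopologicalSpace (TotalSpace F V)]
  [∀ x, AddCommGroup (V x)] [∀ x, Module ℂ (V x)] [∀ x, TopologicalSpace (V x)]
  [∀ x, IsTopologicalAddGroup (V x)] [∀ x, ContinuousSMul ℂ (V x)]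
  [FiberBundle F V] [VectorBundle ℂ F V] [ContMDiffVectorBundle ω F V 𝓘(ℂ, EX)]

variable (EX) in
/-- The flat connection on the domain of a trivialisation `e` for which the sections which are
constant in `e` are parallel. -/
def conn (e : Trivialization F (π F V)) [MemTrivializationAtlas e] (s : ∀ x, V x) (x : X) :
    TangentSpace 𝓘(ℂ, EX) x →L[ℂ] V x :=
  (e.symmL ℂ x) ∘L (mfderiv 𝓘(ℂ, EX) 𝓘(ℂ, F) (fun p => e.continuousLinearMapAt ℂ p (s p)) x :
    TangentSpace 𝓘(ℂ, EX) x →L[ℂ] F)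

variable (e e' : Trivialization F (π F V)) [MemTrivializationAtlas e] [MemTrivializationAtlas e']

lemma conn_congr {s t : ∀ x, V x} {x : X} (h : ∀ᶠ p in 𝓝 x, s p = t p) :
    conn EX e s x = conn EX e t x := by
  have h1 : (fun p => e.continuousLinearMapAt ℂ p (s p)) =ᶠ[𝓝 x]
      fun p => e.continuousLinearMapAt ℂ p (t p) := h.mono fun p hp => by simp only [hp]
  rw [conn, h1.mfderiv_eq, conn]

variable {e e'}

lemma hasMFDerivAt_coord {s : ∀ x, V x} {x : X} (hx : x ∈ e.baseSet)
    (hs : IsHolAt EX F V s x) :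
    HasMFDerivAt 𝓘(ℂ, EX) 𝓘(ℂ, F) (fun p => e.continuousLinearMapAt ℂ p (s p)) x
      (mfderiv 𝓘(ℂ, EX) 𝓘(ℂ, F) (fun p => e.continuousLinearMapAt ℂ p (s p)) x) :=
  (((isHolAt_iff_coord e hx).mp hs).mdifferentiableAt (by simp)).hasMFDerivAt

omit [IsManifold 𝓘(ℂ, EX) ω X] in
-- The product rule in the form needed both for scalar multiplication and for a matrix applied to a
-- vector.
lemma hasMFDerivAt_bilin {A B C : Type*} [NormedAddCommGroup A] [NormedSpace ℂ A]
    [NormedAddCommGroup B] [NormedSpace ℂ B] [NormedAddCommGroup C] [NormedSpace ℂ C]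
    (b : A →L[ℂ] B →L[ℂ] C) {f : X → A} {g : X → B} {x : X} {f' : EX →L[ℂ] A} {g' : EX →L[ℂ] B}
    (hf : HasMFDerivAt 𝓘(ℂ, EX) 𝓘(ℂ, A) f x f') (hg : HasMFDerivAt 𝓘(ℂ, EX) 𝓘(ℂ, B) g x g') :
    HasMFDerivAt 𝓘(ℂ, EX) 𝓘(ℂ, C) (fun x => b (f x) (g x)) x
      (b (f x) ∘L g' + b.flip (g x) ∘L f') := by
  have h1 : HasMFDerivAt 𝓘(ℂ, EX) 𝓘(ℂ, A × B) (fun x => (f x, g x)) x (f'.prod g') :=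
    ⟨hf.1.prodMk hg.1, hf.2.prodMk hg.2⟩
  have h2 : HasFDerivAt (fun p : A × B => b p.1 p.2)
      (b (f x) ∘L ContinuousLinearMap.snd ℂ A B + b.flip (g x) ∘L ContinuousLinearMap.fst ℂ A B)
      (f x, g x) := by
    have h3 := b.hasFDerivAt_of_bilinear (hasFDerivAt_fst (𝕜 := ℂ) (p := (f x, g x)))
      (hasFDerivAt_snd (𝕜 := ℂ) (p := (f x, g x)))
    refine h3.congr_fderiv ?_
    ext <;> simp
  exact h2.hasMFDerivAt.comp x h1

lemma conn_eq {s : ∀ x, V x} {x : X} {D : EX →L[ℂ] F}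
    (h : HasMFDerivAt 𝓘(ℂ, EX) 𝓘(ℂ, F) (fun p => e.continuousLinearMapAt ℂ p (s p)) x D)
    (w : TangentSpace 𝓘(ℂ, EX) x) : conn EX e s x w = e.symmL ℂ x (D w) := by
  rw [conn, h.mfderiv]; rfl

lemma conn_add {s t : ∀ x, V x} {x : X} (hx : x ∈ e.baseSet)
    (hs : IsHolAt EX F V s x) (ht : IsHolAt EX F V t x) (w : TangentSpace 𝓘(ℂ, EX) x) :
    conn EX e (fun x => s x + t x) x w = conn EX e s x w + conn EX e t x w := by
  have h1 := ((hasMFDerivAt_coord hx hs).add (hasMFDerivAt_coord hx ht)).mfderiv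
  have h2 : (fun p => e.continuousLinearMapAt ℂ p (s p + t p)) =
      (fun p => e.continuousLinearMapAt ℂ p (s p)) +
        fun p => e.continuousLinearMapAt ℂ p (t p) := by
    ext p; simp
  rw [conn, h2, h1]
  exact map_add (e.symmL ℂ x) _ _

lemma conn_smul {f : X → ℂ} {s : ∀ x, V x} {x : X} (hx : x ∈ e.baseSet)
    (hf : ContMDiffAt 𝓘(ℂ, EX) 𝓘(ℂ, ℂ) ω f x) (hs : IsHolAt EX F V s x)
    (w : TangentSpace 𝓘(ℂ, EX) x) :
    conn EX e (fun x => f x • s x) x w = f x • conn EX e s x w + dFun f x w • s x := by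
  have h1 := hasMFDerivAt_bilin (ContinuousLinearMap.lsmul ℂ ℂ) (hasMFDerivAt_dFun hf)
    (hasMFDerivAt_coord hx hs)
  have h2 : (fun p => e.continuousLinearMapAt ℂ p (f p • s p)) =
      fun p => ContinuousLinearMap.lsmul ℂ ℂ (f p) (e.continuousLinearMapAt ℂ p (s p)) := by
    ext p; simp
  rw [← h2] at h1
  rw [conn_eq h1]
  have h3 : e.symmL ℂ x (e.continuousLinearMapAt ℂ x (s x)) = s x :=
    e.symmL_continuousLinearMapAt hx _
  conv_rhs => rw [← h3]
  refine Eq.trans (map_add (e.symmL ℂ x) _ _) ?_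
  exact congrArg₂ (· + ·) (map_smul (e.symmL ℂ x) _ _) (map_smul (e.symmL ℂ x) _ _)

/-- Let g be the transition function, and u', gu' the coordinates of s in e' and e. In d(gu') = g
du' + dg u' the first term is the connection of e' and the second is the Atiyah cocycle applied to
s. -/
lemma conn_sub_conn {s : ∀ x, V x} {x : X} (hx : x ∈ e.baseSet) (hx' : x ∈ e'.baseSet)
    (hs : IsHolAt EX F V s x) (w : TangentSpace 𝓘(ℂ, EX) x) :
    conn EX e s x w - conn EX e' s x w = dTransition EX V e e' x w (s x) := by
  have hg : ContMDiffAt 𝓘(ℂ, EX) 𝓘(ℂ, F →L[ℂ] F) ω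
      (fun p => (e'.coordChangeL ℂ e p : F →L[ℂ] F)) x := contMDiffAt_coordChangeL hx' hx
  let dg : EX →L[ℂ] F →L[ℂ] F := mfderiv 𝓘(ℂ, EX) 𝓘(ℂ, F →L[ℂ] F)
    (fun p => (e'.coordChangeL ℂ e p : F →L[ℂ] F)) x
  let ds : EX →L[ℂ] F := mfderiv 𝓘(ℂ, EX) 𝓘(ℂ, F)
    (fun p => e'.continuousLinearMapAt ℂ p (s p)) x
  have hdg : HasMFDerivAt 𝓘(ℂ, EX) 𝓘(ℂ, F →L[ℂ] F)
      (fun p => (e'.coordChangeL ℂ e p : F →L[ℂ] F)) x dg :=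
    (hg.mdifferentiableAt (by simp)).hasMFDerivAt
  have h1 := hasMFDerivAt_bilin (ContinuousLinearMap.id ℂ (F →L[ℂ] F)) hdg
    (hasMFDerivAt_coord hx' hs)
  have h2 : (fun p => e.continuousLinearMapAt ℂ p (s p)) =ᶠ[𝓝 x] fun p =>
      (e'.coordChangeL ℂ e p : F →L[ℂ] F) (e'.continuousLinearMapAt ℂ p (s p)) := by
    filter_upwards [e.open_baseSet.mem_nhds hx, e'.open_baseSet.mem_nhds hx'] with p hp hp'
    rw [ContinuousLinearEquiv.coe_coe, coordChangeL_eq V e' e hp' hp,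
      e'.symmL_continuousLinearMapAt hp']
  rw [sub_eq_iff_eq_add', conn_eq (h1.congr_of_eventuallyEq h2)]
  refine Eq.trans (map_add (e.symmL ℂ x) (e'.coordChangeL ℂ e x (ds w))
    (dg w (e'.continuousLinearMapAt ℂ x (s x)))) ?_
  refine congrArg₂ (fun a b : V x => a + b) ?_ rfl
  rw [coordChangeL_eq V e' e hx' hx, e.symmL_continuousLinearMapAt hx]
  rfl

variable [FiniteDimensional ℂ EX]

lemma isHolAt_conn {s : ∀ x, V x} {x : X} (hx : x ∈ e.baseSet) (hs : IsHolAt EX F V s x) :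
    IsHolAt EX (EX →L[ℂ] F) (fun x => TangentSpace 𝓘(ℂ, EX) x →L[ℂ] V x) (conn EX e s) x := by
  refine isHolAt_clm fun v hv => ?_
  refine isHolAt_symmL e hx (f := fun p => mfderiv 𝓘(ℂ, EX) 𝓘(ℂ, F)
    (fun p => e.continuousLinearMapAt ℂ p (s p)) p (v p)) ?_
  exact (contMDiffAt_tangent_model.mp (contMDiffAt_mfderiv_apply (b := fun x => x)
    ((isHolAt_iff_coord e hx).mp hs) contMDiffAt_id hv)).2

omit [FiniteDimensional ℂ EX] in
lemma conn_symmL {x : X} (hx : x ∈ e.baseSet) (u : F) :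
    conn EX e (fun x => e.symmL ℂ x u) x = 0 := by
  have h1 : (fun p => e.continuousLinearMapAt ℂ p (e.symmL ℂ p u)) =ᶠ[𝓝 x] fun _ => u := by
    filter_upwards [e.open_baseSet.mem_nhds hx] with p hp
    rw [e.continuousLinearMapAt_symmL hp]
  rw [conn, h1.mfderiv_eq, mfderiv_const]
  exact ContinuousLinearMap.comp_zero _

end Connection


/-! ### From an extension to a preimage of the Atiyah class -/

section Necessity

universe uX uY uEX uEY uF uV

/-- Factoring through the fibre of E yields maps taking the vector of E first, while forms with
values in End E take the tangent vector first. Finite dimension makes everything continuous. -/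
lemma exists_clm_flip {A B : Type*} [AddCommGroup A] [Module ℂ A] [TopologicalSpace A]
    [IsTopologicalAddGroup A] [ContinuousSMul ℂ A] [T2Space A] [FiniteDimensional ℂ A]
    [AddCommGroup B] [Module ℂ B] [TopologicalSpace B]
    [IsTopologicalAddGroup B] [ContinuousSMul ℂ B] [T2Space B] [FiniteDimensional ℂ B]
    (Φ : B →ₗ[ℂ] (A →L[ℂ] B)) : ∃ Ψ : A →L[ℂ] (B →L[ℂ] B), ∀ w v, Ψ w v = Φ v w := by
  let Ψ : A →ₗ[ℂ] (B →L[ℂ] B) :=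
    { toFun := fun w => LinearMap.toContinuousLinearMap
        { toFun := fun v => Φ v w
          map_add' := fun v v' => by rw [map_add]; rfl
          map_smul' := fun c v => by rw [map_smul]; rfl }
      map_add' := fun w w' => by ext v; exact map_add (Φ v) w w'
      map_smul' := fun c w => by ext v; exact map_smul (Φ v) c w }
  exact ⟨LinearMap.toContinuousLinearMap Ψ, fun _ _ => rfl⟩

variable {X : Type uX} [TopologicalSpace X]
  {EX : Type uEX} [NormedAddCommGroup EX] [NormedSpace ℂ EX] [ChartedSpace EX X]
  [IsManifold 𝓘(ℂ, EX) ω X]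
  {Y : Type uY} [TopologicalSpace Y]
  {EY : Type uEY} [NormedAddCommGroup EY] [NormedSpace ℂ EY] [ChartedSpace EY Y]
  [IsManifold 𝓘(ℂ, EY) ω Y]
  {ι : C^ω⟮𝓘(ℂ, EX), X; 𝓘(ℂ, EY), Y⟯}
  {F : Type uF} [NormedAddCommGroup F] [NormedSpace ℂ F]
  {V : X → Type uV} [TopologicalSpace (TotalSpace F V)]
  [∀ x, AddCommGroup (V x)] [∀ x, Module ℂ (V x)] [∀ x, TopologicalSpace (V x)]
  [FiberBundle F V]

lemma finiteDimensional_fibre [VectorBundle ℂ F V] [FiniteDimensional ℂ F]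
    (e : Trivialization F (π F V)) [MemTrivializationAtlas e] {x : X} (hx : x ∈ e.baseSet) :
    FiniteDimensional ℂ (V x) :=
  (e.continuousLinearEquivAt ℂ x hx).symm.toLinearEquiv.finiteDimensional

lemma t2Space_fibre [VectorBundle ℂ F V]
    (e : Trivialization F (π F V)) [MemTrivializationAtlas e] {x : X} (hx : x ∈ e.baseSet) :
    T2Space (V x) :=
  (e.continuousLinearEquivAt ℂ x hx).toHomeomorph.symm.t2Space

/-- A function which is holomorphic at a point of `X` lifts to a section of `O_{X₁}` near this
point. -/
lemma AdaptedChart.exists_val_eq {x₀ : X} (A : AdaptedChart ι x₀) {f : X → ℂ}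
    (hf : ContMDiffAt 𝓘(ℂ, EX) 𝓘(ℂ, ℂ) ω f x₀) {W : Opens X} (hx₀ : x₀ ∈ W) :
    ∃ W' ≤ W, x₀ ∈ W' ∧ ∃ a : O1 ι W', ∀ x ∈ W', a.val x = f x := by
  have h1 : ∀ᶠ x in 𝓝 x₀, ContMDiffAt 𝓘(ℂ, EX) 𝓘(ℂ, ℂ) ω f x ∧
      ContMDiffAt 𝓘(ℂ, EY) 𝓘(ℂ, EX) ω A.p (ι x) ∧ A.p (ι x) = x ∧ x ∈ W :=
    (contMDiffAt_eventually hf).and ((ι.contMDiff.continuous.continuousAt.eventually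
      (contMDiffAt_eventually A.contMDiffAt_p)).and (A.p_ι.and (W.isOpen.mem_nhds hx₀)))
  obtain ⟨S, hS, hSo, hxS⟩ := eventually_nhds_iff.mp h1
  have h2 : ∀ x ∈ S, ContMDiffAt 𝓘(ℂ, EY) 𝓘(ℂ, ℂ) ω (fun y => f (A.p y)) (ι x) := by
    intro x hx
    obtain ⟨h3, h4, h5, -⟩ := hS x hx
    refine ContMDiffAt.comp (ι x) ?_ h4
    rwa [h5]
  -- The lift is f ∘ p, with p the local retraction onto X.
  let a : O1 ι ⟨S, hSo⟩ := ⟨fun x => O1Stalk.of ι x _ (h2 x x.2), fun _ =>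
    ⟨_, Filter.Eventually.of_forall fun x => ⟨h2 x x.2, rfl⟩⟩⟩
  refine ⟨⟨S, hSo⟩, fun x hx => (hS x hx).2.2.2, hxS, a, fun x hx => ?_⟩
  rw [O1.val_of_mem a hx]
  exact congrArg f (hS x hx).2.2.1

/-! ### Linear rules on an extension factor through the fibres of E -/

namespace PullbackIso

variable {M : X1Module ι} (P : PullbackIso F V M)

/-- The value at a point of the section of `E` underlying a section of an extension of `E`. -/
def ev (W : Opens X) {x : X} (hx : x ∈ W) : M.sec W →+ V x :=
  AddMonoidHom.mk' (fun s => P.ρ W s x) fun s t => P.map_add W s t x hx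

lemma ev_res {W W' : Opens X} (h : W ≤ W') {x : X} (hx : x ∈ W) (s : M.sec W') :
    P.ev W hx (M.res h s) = P.ev W' (h hx) s :=
  P.map_res h s x hx

lemma ev_smul {W : Opens X} {x : X} (hx : x ∈ W) (a : O1 ι W) (s : M.sec W) :
    P.ev W hx (a • s) = a.val x • P.ev W hx s :=
  (P.map_smul W a s x hx).trans (congrArg (· • P.ev W hx s) (O1.toFun_eq_val a hx))

lemma isHolAt_ρ {W : Opens X} (s : M.sec W) {x : X} (hx : x ∈ W) :
    IsHolAt EX F V (P.ρ W s) x :=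
  isHolOn_iff.mp (P.isHolOn W s) x hx

variable [VectorBundle ℂ F V] [ContMDiffVectorBundle ω F V 𝓘(ℂ, EX)]

lemma exists_lift_section {t : ∀ x, V x} {x : X} (ht : IsHolAt EX F V t x) {W : Opens X}
    (hx : x ∈ W) : ∃ W' ≤ W, x ∈ W' ∧ ∃ s : M.sec W', ∀ x' ∈ W', P.ρ W' s x' = t x' := by
  obtain ⟨u, hu, hxu⟩ := (contMDiffAt_iff_contMDiffOn_nhds (by simp)).mp ht
  obtain ⟨S, hSu, hSo, hxS⟩ := mem_nhds_iff.mp hu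
  obtain ⟨W', h1, h2, h3⟩ := P.surjective (⟨S, hSo⟩ ⊓ W) t
    (hxu.mono fun y hy => hSu hy.1) x ⟨hxS, hx⟩
  exact ⟨W', h1.trans inf_le_right, h2, h3⟩

lemma exists_lift_vector {x : X} (v : V x) {W : Opens X} (hx : x ∈ W) :
    ∃ (W' : Opens X) (_ : W' ≤ W) (hx' : x ∈ W') (s : M.sec W'), P.ev W' hx' s = v := by
  let e := trivializationAt F V x
  have he : x ∈ e.baseSet := mem_baseSet_trivializationAt F V x
  obtain ⟨W', h1, h2, s, hs⟩ := P.exists_lift_section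
    (isHolAt_symmL (EX := EX) e he (contMDiffAt_const (c := e.continuousLinearMapAt ℂ x v))) hx
  refine ⟨W', h1, h2, s, (hs x h2).trans ?_⟩
  exact e.symmL_continuousLinearMapAt he v

variable [FiniteDimensional ℂ F]

/-- A rule which is linear over `O_{X₁} → ℂ` on the stalk of `M` at `x` vanishes on the sections
whose image in the fibre of `E` at `x` is zero. -/
lemma eq_zero_of_ev_eq_zero (hA : ∀ x, Nonempty (AdaptedChart ι x)) {x : X} {U : Opens X}
    {T : Type*} [AddCommGroup T] [Module ℂ T]
    (Δ : ∀ W : Opens X, W ≤ U → x ∈ W → M.sec W →+ T)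
    (hsmul : ∀ W h hx (a : O1 ι W) s, Δ W h hx (a • s) = a.val x • Δ W h hx s)
    (hres : ∀ W W' (h : W ≤ W') (h' : W' ≤ U) (hx : x ∈ W) s,
      Δ W (h.trans h') hx (M.res h s) = Δ W' h' (h hx) s)
    {W : Opens X} (hWU : W ≤ U) (hx : x ∈ W) (s : M.sec W) (hs : P.ev W hx s = 0) :
    Δ W hWU hx s = 0 := by
  let e := trivializationAt F V x
  have he : x ∈ e.baseSet := mem_baseSet_trivializationAt F V x
  let β := Module.finBasis ℂ F
  have h1 : ∀ k, ∃ W' ≤ W ⊓ ⟨e.baseSet, e.open_baseSet⟩, x ∈ W' ∧ ∃ t : M.sec W',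
      ∀ p ∈ W', P.ρ W' t p = e.symmL ℂ p (β k) := fun k =>
    P.exists_lift_section (isHolAt_symmL e he contMDiffAt_const) ⟨hx, he⟩
  choose W₁ hW₁ hxW₁ t ht using h1
  let f : Fin (Module.finrank ℂ F) → X → ℂ := fun k p =>
    LinearMap.toContinuousLinearMap (β.coord k) (e.continuousLinearMapAt ℂ p (P.ρ W s p))
  have hf : ∀ k, ContMDiffAt 𝓘(ℂ, EX) 𝓘(ℂ, ℂ) ω (f k) x := fun k =>
    (ContinuousLinearMap.contMDiff _).contMDiffAt.comp x
      ((isHolAt_iff_coord e he).mp (P.isHolAt_ρ s hx))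
  have h2 : ∀ k, ∃ W' ≤ W₁ k, x ∈ W' ∧ ∃ a : O1 ι W', ∀ p ∈ W', a.val p = f k p := fun k =>
    (hA x).some.exists_val_eq (hf k) (hxW₁ k)
  choose W₂ hW₂ hxW₂ a ha using h2
  let W₃ : Opens X := ⟨(⋂ k, (W₂ k : Set X)) ∩ (W ⊓ ⟨e.baseSet, e.open_baseSet⟩ : Opens X),
    (isOpen_iInter_of_finite fun k => (W₂ k).isOpen).inter (Opens.isOpen _)⟩
  have hx₃ : x ∈ W₃ := ⟨Set.mem_iInter.mpr hxW₂, hx, he⟩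
  have h32 : ∀ k, W₃ ≤ W₂ k := fun k p hp => Set.mem_iInter.mp hp.1 k
  have h3 : W₃ ≤ W := fun p hp => hp.2.1
  have h31 : ∀ k, W₃ ≤ W₁ k := fun k => (h32 k).trans (hW₂ k)
  -- The t k lift a frame of E and the a k lift the coordinates of the image of s, so s' maps to
  -- zero in E and lies locally in (I / I²) M, where Δ vanishes. The subtracted terms contribute
  -- nothing either, because the values of the a k at x are the coordinates of a zero vector.
  let s' : M.sec W₃ := M.res h3 s - ∑ k, O1.res ι (h32 k) (a k) • M.res (h31 k) (t k)
  have hs' : ∀ p ∈ W₃, P.ρ W₃ s' p = 0 := by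
    intro p hp
    change P.ev W₃ hp s' = 0
    rw [map_sub, map_sum, sub_eq_zero, P.ev_res h3 hp]
    have h4 : P.ev W (h3 hp) s = e.symmL ℂ p (∑ k, f k p • β k) := by
      refine (e.symmL_continuousLinearMapAt (R := ℂ) hp.2.2 _).symm.trans ?_
      exact congrArg _ (β.sum_repr _).symm
    rw [h4, map_sum]
    refine Finset.sum_congr rfl fun k _ => ?_
    rw [P.ev_smul, O1.val_res (h32 k) _ hp, ha k p (h32 k hp), P.ev_res, _root_.map_smul]
    exact congrArg _ (ht k p (h31 k hp)).symm
  obtain ⟨W₄, h43, hx₄, hmem⟩ := P.ker W₃ s' hs' x hx₃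
  have h5 : ∀ u ∈ (O1.ideal ι W₄ • ⊤ : Submodule (O1 ι W₄) (M.sec W₄)),
      Δ W₄ ((h43.trans h3).trans hWU) hx₄ u = 0 := by
    intro u hu
    refine Submodule.smul_induction_on hu (fun a ha u _ => ?_) fun u u' h h' => ?_
    · have h6 : a.val x = 0 :=
        (O1.toFun_eq_val a hx₄).symm.trans (congrFun (RingHom.mem_ker.mp ha) ⟨x, hx₄⟩)
      rw [hsmul, h6, zero_smul]
    · rw [_root_.map_add, h, h', add_zero]
  have h6 : Δ W₃ (h3.trans hWU) hx₃ s' = 0 := by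
    rw [← hres W₄ W₃ h43 (h3.trans hWU) hx₄]
    exact h5 _ hmem
  rw [map_sub, map_sum, hres W₃ W h3 hWU hx₃, sub_eq_zero] at h6
  rw [h6]
  refine Finset.sum_eq_zero fun k _ => ?_
  have h7 : f k x = 0 := by
    have h8 : P.ρ W s x = 0 := hs
    simp only [f, h8, map_zero]
  rw [hsmul, O1.val_res (h32 k) _ hx₃, ha k x (h32 k hx₃), h7, zero_smul]

/-- A rule which is linear over `O_{X₁} → ℂ` on the stalk of `M` at `x` factors through the fibre
of `E` at `x`. -/
lemma exists_factor (hA : ∀ x, Nonempty (AdaptedChart ι x)) {x : X} {U : Opens X} (hxU : x ∈ U)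
    {T : Type*} [AddCommGroup T] [Module ℂ T]
    (Δ : ∀ W : Opens X, W ≤ U → x ∈ W → M.sec W →+ T)
    (hsmul : ∀ W h hx (a : O1 ι W) s, Δ W h hx (a • s) = a.val x • Δ W h hx s)
    (hres : ∀ W W' (h : W ≤ W') (h' : W' ≤ U) (hx : x ∈ W) s,
      Δ W (h.trans h') hx (M.res h s) = Δ W' h' (h hx) s) :
    ∃ Φ : V x →ₗ[ℂ] T, ∀ W h hx s, Φ (P.ev W hx s) = Δ W h hx s := by
  -- Well-definedness on the fibre: the vanishing lemma is applied to a difference of restrictions.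
  have key : ∀ W h hx s W' h' hx' s', P.ev W hx s = P.ev W' hx' s' →
      Δ W h hx s = Δ W' h' hx' s' := by
    intro W h hx s W' h' hx' s' heq
    have h1 : x ∈ W ⊓ W' := ⟨hx, hx'⟩
    rw [← hres (W ⊓ W') W inf_le_left h h1, ← hres (W ⊓ W') W' inf_le_right h' h1,
      ← sub_eq_zero, ← map_sub]
    refine P.eq_zero_of_ev_eq_zero hA Δ hsmul hres _ h1 _ ?_
    rw [map_sub, P.ev_res, P.ev_res, heq, sub_self]
  have hl : ∀ v : V x, ∃ (W' : Opens X) (_ : W' ≤ U) (hx' : x ∈ W') (s : M.sec W'),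
      P.ev W' hx' s = v := fun v => P.exists_lift_vector v hxU
  choose W hW hxW s hs using hl
  refine ⟨{ toFun := fun v => Δ (W v) (hW v) (hxW v) (s v), map_add' := fun v v' => ?_,
            map_smul' := fun c v => ?_ }, fun W' h' hx' s' => ?_⟩
  · have h1 : x ∈ W v ⊓ W v' := ⟨hxW v, hxW v'⟩
    rw [← hres (W v ⊓ W v') (W v) inf_le_left (hW v) h1,
      ← hres (W v ⊓ W v') (W v') inf_le_right (hW v') h1, ← _root_.map_add]
    refine key _ _ _ _ _ _ _ _ ?_
    rw [_root_.map_add, P.ev_res, P.ev_res, hs, hs, hs]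
  -- The sections of M are modules over O_{X₁} only, so the scalar c acts through a section with
  -- constant value c.
  · obtain ⟨W', h1, h2, a, ha⟩ := (hA x).some.exists_val_eq (f := fun _ => c) contMDiffAt_const
      (hxW v)
    rw [← hres W' (W v) h1 (hW v) h2, RingHom.id_apply, ← ha x h2, ← hsmul]
    refine key _ _ _ _ _ _ _ _ ?_
    rw [P.ev_smul, P.ev_res, hs, hs]
  · exact key _ _ _ _ _ _ _ _ (hs _)

end PullbackIso

/-- A basis of the sections of `M` over the open subsets of `U`. -/
structure X1Module.Frame (M : X1Module ι) (U : Opens X) where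
  /-- the rank -/
  r : ℕ
  /-- the basis -/
  e : Fin r → M.sec U
  bijective : ∀ (W : Opens X) (h : W ≤ U),
    Function.Bijective fun a : Fin r → O1 ι W => ∑ k, a k • M.res h (e k)

/-! ### Coordinates and the derivative attached to a frame of an extension -/

namespace X1Module.Frame

variable {M : X1Module ι} {U : Opens X} (fr : M.Frame U)

/-- The coordinates of a section with respect to a frame. -/
def coord {W : Opens X} (h : W ≤ U) (s : M.sec W) : Fin fr.r → O1 ι W :=
  ((fr.bijective W h).2 s).choose

lemma sum_coord {W : Opens X} (h : W ≤ U) (s : M.sec W) :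
    ∑ k, fr.coord h s k • M.res h (fr.e k) = s :=
  ((fr.bijective W h).2 s).choose_spec

lemma coord_eq {W : Opens X} (h : W ≤ U) {s : M.sec W} {a : Fin fr.r → O1 ι W}
    (ha : ∑ k, a k • M.res h (fr.e k) = s) : fr.coord h s = a :=
  (fr.bijective W h).1 ((fr.sum_coord h s).trans ha.symm)

lemma coord_add {W : Opens X} (h : W ≤ U) (s t : M.sec W) :
    fr.coord h (s + t) = fr.coord h s + fr.coord h t :=
  fr.coord_eq h (by simp only [Pi.add_apply, add_smul, Finset.sum_add_distrib, sum_coord])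

lemma coord_smul {W : Opens X} (h : W ≤ U) (a : O1 ι W) (s : M.sec W) :
    fr.coord h (a • s) = fun k => a * fr.coord h s k :=
  fr.coord_eq h (by simp only [mul_smul, ← Finset.smul_sum, sum_coord])

lemma coord_res {W W' : Opens X} (h : W ≤ W') (h' : W' ≤ U) (s : M.sec W') :
    fr.coord (h.trans h') (M.res h s) = fun k => O1.res ι h (fr.coord h' s k) := by
  refine fr.coord_eq _ ?_
  conv_rhs => rw [← fr.sum_coord h' s, map_sum]
  exact Finset.sum_congr rfl fun k _ => by rw [M.res_smul, M.res_res]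

variable (P : PullbackIso F V M)

lemma ev_eq_sum {W : Opens X} (h : W ≤ U) {x : X} (hx : x ∈ W) (s : M.sec W) :
    P.ev W hx s = ∑ k, (fr.coord h s k).val x • P.ev U (h hx) (fr.e k) := by
  conv_lhs => rw [← fr.sum_coord h s, map_sum]
  exact Finset.sum_congr rfl fun k _ => by rw [P.ev_smul, P.ev_res]

variable [∀ x, IsTopologicalAddGroup (V x)] [∀ x, ContinuousSMul ℂ (V x)]

/-- The derivative of a section of `M` along `Y` with respect to a frame. -/
def deriv {W : Opens X} (h : W ≤ U) {x : X} (hx : x ∈ W) :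
    M.sec W →+ (TangentSpace 𝓘(ℂ, EY) (ι x) →L[ℂ] V x) :=
  AddMonoidHom.mk' (fun s => ∑ k, ((fr.coord h s k).d x).smulRight (P.ρ U (fr.e k) x)) fun s t => by
    rw [← Finset.sum_add_distrib]
    refine Finset.sum_congr rfl fun k _ => ?_
    rw [fr.coord_add, Pi.add_apply, O1.d_add _ _ hx]
    ext w
    exact add_smul _ _ _

lemma deriv_apply {W : Opens X} (h : W ≤ U) {x : X} (hx : x ∈ W) (s : M.sec W)
    (w : TangentSpace 𝓘(ℂ, EY) (ι x)) :
    fr.deriv P h hx s w = ∑ k, (fr.coord h s k).d x w • P.ρ U (fr.e k) x := by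
  change (∑ k, ((fr.coord h s k).d x).smulRight (P.ρ U (fr.e k) x)) w = _
  rw [sum_apply]
  rfl

/-- The Leibniz rule. The term with da involves only the image of s in E and not the frame, so it
cancels in differences. -/
lemma deriv_smul {W : Opens X} (h : W ≤ U) {x : X} (hx : x ∈ W) (a : O1 ι W) (s : M.sec W)
    (w : TangentSpace 𝓘(ℂ, EY) (ι x)) :
    fr.deriv P h hx (a • s) w = a.val x • fr.deriv P h hx s w + a.d x w • P.ev W hx s := by
  rw [deriv_apply, deriv_apply, fr.ev_eq_sum P h, Finset.smul_sum, Finset.smul_sum,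
    ← Finset.sum_add_distrib]
  refine Finset.sum_congr rfl fun k _ => ?_
  rw [fr.coord_smul, O1.d_mul _ _ hx, smul_smul, smul_smul, mul_comm (a.d x w)]
  exact add_smul _ _ _

lemma deriv_res {W W' : Opens X} (h : W ≤ W') (h' : W' ≤ U) {x : X} (hx : x ∈ W) (s : M.sec W') :
    fr.deriv P (h.trans h') hx (M.res h s) = fr.deriv P h' (h hx) s := by
  ext w
  rw [deriv_apply, deriv_apply]
  refine Finset.sum_congr rfl fun k _ => ?_
  rw [fr.coord_res, O1.d_res _ _ hx]

variable [VectorBundle ℂ F V]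

open Classical in
lemma isHolAt_deriv_apply {W : Opens X} (h : W ≤ U) {x₀ : X} (hx₀ : x₀ ∈ W) (s : M.sec W)
    {w : ∀ x, TangentSpace 𝓘(ℂ, EY) (ι x)}
    (hw : IsHolAt EX EY (ι *ᵖ (TangentSpace 𝓘(ℂ, EY) : Y → Type uEY)) w x₀) :
    IsHolAt EX F V (fun x => if hx : x ∈ W then fr.deriv P h hx s (w x) else 0) x₀ := by
  refine IsHolAt.congr (s := fun x => ∑ k, (fr.coord h s k).d x (w x) • P.ρ U (fr.e k) x) ?_ ?_
  · exact IsHolAt.sum fun k _ => IsHolAt.smul ((fr.coord h s k).contMDiffAt_d hx₀ hw)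
      (P.isHolAt_ρ _ (h hx₀))
  · filter_upwards [W.isOpen.mem_nhds hx₀] with x hx
    rw [dif_pos (show x ∈ W from hx), fr.deriv_apply P h hx s]

end X1Module.Frame

/-! ### Comparing the derivatives of two frames, and of a frame and a trivialisation -/

namespace PullbackIso

variable [∀ x, IsTopologicalAddGroup (V x)] [∀ x, ContinuousSMul ℂ (V x)] [VectorBundle ℂ F V]
  [ContMDiffVectorBundle ω F V 𝓘(ℂ, EX)] {M : X1Module ι} (P : PullbackIso F V M)
  [FiniteDimensional ℂ F]

/-- Both derivatives obey the same Leibniz rule, so their difference is linear and `exists_factor`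
applies at each point of the overlap. -/
lemma exists_deriv_sub_deriv [FiniteDimensional ℂ EY] (hA : ∀ x, Nonempty (AdaptedChart ι x))
    {U U' : Opens X} (fr : M.Frame U) (fr' : M.Frame U') :
    ∃ c : ∀ x, OmegaResEnd V ι x, ∀ (W : Opens X) (h : W ≤ U) (h' : W ≤ U') (x : X) (hx : x ∈ W)
      (s : M.sec W) (w : TangentSpace 𝓘(ℂ, EY) (ι x)),
      c x w (P.ev W hx s) = fr.deriv P h hx s w - fr'.deriv P h' hx s w := by
  have key : ∀ x, ∃ c : OmegaResEnd V ι x, ∀ (W : Opens X) (h : W ≤ U) (h' : W ≤ U')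
      (hx : x ∈ W) (s : M.sec W) (w : TangentSpace 𝓘(ℂ, EY) (ι x)),
      c w (P.ev W hx s) = fr.deriv P h hx s w - fr'.deriv P h' hx s w := by
    intro x
    by_cases hxU : x ∈ U ⊓ U'
    swap
    · exact ⟨0, fun W h h' hx => absurd ⟨h hx, h' hx⟩ hxU⟩
    obtain ⟨Φ, hΦ⟩ := P.exists_factor hA hxU
      (fun W h hx => fr.deriv P (h.trans inf_le_left) hx - fr'.deriv P (h.trans inf_le_right) hx)
      (fun W h hx a s => by
        ext w
        change fr.deriv P _ hx (a • s) w - fr'.deriv P _ hx (a • s) w =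
          a.val x • (fr.deriv P _ hx s w - fr'.deriv P _ hx s w)
        rw [fr.deriv_smul, fr'.deriv_smul, smul_sub]
        abel)
      (fun W W' h h' hx s => by
        change fr.deriv P _ hx _ - fr'.deriv P _ hx _ = fr.deriv P _ _ _ - fr'.deriv P _ _ _
        rw [fr.deriv_res P h (h'.trans inf_le_left), fr'.deriv_res P h (h'.trans inf_le_right)])
    have := finiteDimensional_fibre _ (mem_baseSet_trivializationAt F V x)
    have := t2Space_fibre _ (mem_baseSet_trivializationAt F V x)
    have : FiniteDimensional ℂ (TangentSpace 𝓘(ℂ, EY) (ι x)) :=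
      inferInstanceAs (FiniteDimensional ℂ EY)
    have : T2Space (TangentSpace 𝓘(ℂ, EY) (ι x)) := inferInstanceAs (T2Space EY)
    obtain ⟨Ψ, hΨ⟩ := exists_clm_flip Φ
    exact ⟨Ψ, fun W h h' hx s w => (hΨ w _).trans
      (congrArg (fun T => T w) (hΦ W (le_inf h h') hx s))⟩
  choose c hc using key
  exact ⟨c, fun W h h' x => hc x W h h'⟩

/-- On vectors tangent to X the differential of a section of O_{X₁} is that of its value
(`O1.d_mfderiv`). So the derivative of the frame and the flat connection have the same Leibniz term
there. -/
lemma exists_deriv_sub_conn [FiniteDimensional ℂ EX] (hA : ∀ x, Nonempty (AdaptedChart ι x))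
    {U : Opens X} (fr : M.Frame U) (e : Trivialization F (π F V)) [MemTrivializationAtlas e] :
    ∃ b : ∀ x, OmegaEnd EX V x, ∀ (W : Opens X) (h : W ≤ U)
      (_ : W ≤ ⟨e.baseSet, e.open_baseSet⟩) (x : X) (hx : x ∈ W)
      (s : M.sec W) (w : TangentSpace 𝓘(ℂ, EX) x),
      b x w (P.ev W hx s) =
        fr.deriv P h hx s (mfderiv 𝓘(ℂ, EX) 𝓘(ℂ, EY) ι x w) - conn EX e (P.ρ W s) x w := by
  have key : ∀ x, ∃ b : OmegaEnd EX V x, ∀ (W : Opens X) (h : W ≤ U)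
      (_ : W ≤ ⟨e.baseSet, e.open_baseSet⟩) (hx : x ∈ W)
      (s : M.sec W) (w : TangentSpace 𝓘(ℂ, EX) x),
      b w (P.ev W hx s) =
        fr.deriv P h hx s (mfderiv 𝓘(ℂ, EX) 𝓘(ℂ, EY) ι x w) - conn EX e (P.ρ W s) x w := by
    intro x
    by_cases hxU : x ∈ U ⊓ ⟨e.baseSet, e.open_baseSet⟩
    swap
    · exact ⟨0, fun W h h' hx => absurd ⟨h hx, h' hx⟩ hxU⟩
    obtain ⟨Φ, hΦ⟩ := P.exists_factor hA hxU
      (T := TangentSpace 𝓘(ℂ, EX) x →L[ℂ] V x)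
      (fun W h hx => AddMonoidHom.mk' (fun s =>
          (fr.deriv P (h.trans inf_le_left) hx s) ∘L (mfderiv 𝓘(ℂ, EX) 𝓘(ℂ, EY) ι x) -
            conn EX e (P.ρ W s) x) fun s t => by
        ext w
        have h1 : conn EX e (P.ρ W (s + t)) x = conn EX e (fun p => P.ρ W s p + P.ρ W t p) x :=
          conn_congr e (Filter.eventually_of_mem (W.isOpen.mem_nhds hx) fun p hp =>
            P.map_add W s t p hp)
        change fr.deriv P _ hx (s + t) _ - conn EX e (P.ρ W (s + t)) x w =
          (fr.deriv P _ hx s _ - conn EX e (P.ρ W s) x w) +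
          (fr.deriv P _ hx t _ - conn EX e (P.ρ W t) x w)
        rw [h1, conn_add hxU.2 (P.isHolAt_ρ s hx) (P.isHolAt_ρ t hx), _root_.map_add,
          add_apply]
        abel)
      (fun W h hx a s => by
        ext w
        have h1 : conn EX e (P.ρ W (a • s)) x = conn EX e (fun p => a.val p • P.ρ W s p) x :=
          conn_congr e (Filter.eventually_of_mem (W.isOpen.mem_nhds hx) fun p hp =>
            P.ev_smul hp a s)
        change fr.deriv P _ hx (a • s) _ - conn EX e (P.ρ W (a • s)) x w =
          a.val x • (fr.deriv P _ hx s _ - conn EX e (P.ρ W s) x w)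
        rw [h1, conn_smul hxU.2 (a.contMDiffAt_val hx) (P.isHolAt_ρ s hx), fr.deriv_smul, smul_sub]
        have h2 := congrArg (· • P.ρ W s x) (a.d_mfderiv hx w)
        refine (congrArg (fun z => _ + z - _) h2).trans ?_
        abel)
      (fun W W' h h' hx s => by
        ext w
        have h1 : conn EX e (P.ρ W (M.res h s)) x = conn EX e (P.ρ W' s) x :=
          conn_congr e (Filter.eventually_of_mem (W.isOpen.mem_nhds hx) fun p hp =>
            P.map_res h s p hp)
        change fr.deriv P _ hx _ _ - conn EX e _ x w = fr.deriv P _ _ _ _ - conn EX e _ x w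
        rw [h1, fr.deriv_res P h (h'.trans inf_le_left)])
    have := finiteDimensional_fibre _ (mem_baseSet_trivializationAt F V x)
    have := t2Space_fibre _ (mem_baseSet_trivializationAt F V x)
    have : FiniteDimensional ℂ (TangentSpace 𝓘(ℂ, EX) x) :=
      inferInstanceAs (FiniteDimensional ℂ EX)
    have : T2Space (TangentSpace 𝓘(ℂ, EX) x) := inferInstanceAs (T2Space EX)
    obtain ⟨Ψ, hΨ⟩ := exists_clm_flip Φ
    exact ⟨Ψ, fun W h h' hx s w => (hΨ w _).trans
      (congrArg (fun T => T w) (hΦ W (le_inf h h') hx s))⟩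
  choose b hb using key
  exact ⟨b, fun W h h' x => hb x W h h'⟩

/-- Holomorphy may be tested on local sections of E. These lift to M, and there c is a difference of
holomorphic expressions. -/
lemma isHolAt_deriv_sub_deriv [FiniteDimensional ℂ EY] {U U' : Opens X} {fr : M.Frame U}
    {fr' : M.Frame U'} {c : ∀ x, OmegaResEnd V ι x}
    (hc : ∀ (W : Opens X) (h : W ≤ U) (h' : W ≤ U') (x : X) (hx : x ∈ W)
      (s : M.sec W) (w : TangentSpace 𝓘(ℂ, EY) (ι x)),
      c x w (P.ev W hx s) = fr.deriv P h hx s w - fr'.deriv P h' hx s w)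
    {x₀ : X} (hx₀ : x₀ ∈ U ⊓ U') :
    IsHolAt EX (EY →L[ℂ] (F →L[ℂ] F)) (OmegaResEnd V ι) c x₀ := by
  classical
  refine isHolAt_clm fun w hw => isHolAt_clm fun v hv => ?_
  obtain ⟨W, hW, hxW, s, hs⟩ := P.exists_lift_section hv hx₀
  refine ((fr.isHolAt_deriv_apply P (hW.trans inf_le_left) hxW s hw).sub
    (fr'.isHolAt_deriv_apply P (hW.trans inf_le_right) hxW s hw)).congr ?_
  filter_upwards [W.isOpen.mem_nhds hxW] with x hx
  have hx' : x ∈ W := hx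
  rw [dif_pos hx', dif_pos hx', ← hs x hx]
  exact hc W _ _ x hx' s (w x)

lemma isHolAt_deriv_sub_conn [FiniteDimensional ℂ EX] {U : Opens X} {fr : M.Frame U}
    {e : Trivialization F (π F V)} [MemTrivializationAtlas e] {b : ∀ x, OmegaEnd EX V x}
    (hb : ∀ (W : Opens X) (h : W ≤ U)
      (_ : W ≤ ⟨e.baseSet, e.open_baseSet⟩) (x : X) (hx : x ∈ W)
      (s : M.sec W) (w : TangentSpace 𝓘(ℂ, EX) x),
      b x w (P.ev W hx s) =
        fr.deriv P h hx s (mfderiv 𝓘(ℂ, EX) 𝓘(ℂ, EY) ι x w) - conn EX e (P.ρ W s) x w)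
    {x₀ : X} (hx₀ : x₀ ∈ U ⊓ ⟨e.baseSet, e.open_baseSet⟩) :
    IsHolAt EX (EX →L[ℂ] (F →L[ℂ] F)) (OmegaEnd EX V) b x₀ := by
  classical
  refine isHolAt_clm fun w hw => isHolAt_clm fun v hv => ?_
  obtain ⟨W, hW, hxW, s, hs⟩ := P.exists_lift_section hv hx₀
  have hw' : IsHolAt EX EY (ι *ᵖ (TangentSpace 𝓘(ℂ, EY) : Y → Type uEY))
      (fun x => mfderiv 𝓘(ℂ, EX) 𝓘(ℂ, EY) ι x (w x)) x₀ :=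
    isHolAt_pullback_iff.mpr
      (contMDiffAt_mfderiv_apply ι.contMDiff.contMDiffAt contMDiffAt_id hw)
  refine ((fr.isHolAt_deriv_apply P (hW.trans inf_le_left) hxW s hw').sub
    ((isHolAt_conn hx₀.2 (P.isHolAt_ρ s hxW)).clm_apply hw)).congr ?_
  filter_upwards [W.isOpen.mem_nhds hxW] with x hx
  have hx' : x ∈ W := hx
  rw [dif_pos hx', ← hb W _ (hW.trans inf_le_right) x hx', ← hs x hx]
  rfl

end PullbackIso

variable [∀ x, IsTopologicalAddGroup (V x)] [∀ x, ContinuousSMul ℂ (V x)] [VectorBundle ℂ F V]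
  [ContMDiffVectorBundle ω F V 𝓘(ℂ, EX)]
  [FiniteDimensional ℂ EX] [FiniteDimensional ℂ EY] [FiniteDimensional ℂ F]

theorem atiyahClass_mem_range_of_hasExtension (hA : ∀ x, Nonempty (AdaptedChart ι x))
    (h : HasExtension ι F V) : atiyahClass EX F V ∈ Set.range (restrictH1 F V ι) := by
  obtain ⟨M, hM, ⟨P⟩⟩ := h
  have h1 : ∀ x, ∃ U : Opens X, x ∈ U ∧ Nonempty (M.Frame U) := fun x => by
    obtain ⟨U, hx, r, e, he⟩ := hM x
    exact ⟨U, hx, ⟨⟨r, e, he⟩⟩⟩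
  choose U hxU hfr using h1
  let fr := fun x => (hfr x).some
  choose c hc using fun i j => P.exists_deriv_sub_deriv hA (fr i) (fr j)
  choose b hb using fun i => P.exists_deriv_sub_conn hA (fr i) (trivializationAt F V i)
  -- Every vector of E is the value of a section of M, on which c i j is D_i - D_j; the cocycle
  -- identity is then a telescoping sum.
  let C : cocycles EX (EY →L[ℂ] (F →L[ℂ] F)) (OmegaResEnd V ι) := ⟨c, U, hxU, fun i j =>
    isHolOn_iff.mpr fun x hx => P.isHolAt_deriv_sub_deriv (hc i j) hx, fun i j k x hx => by
      ext w v
      obtain ⟨W, hW, hxW, s, rfl⟩ := P.exists_lift_vector v hx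
      have h1 := hc i j W (hW.trans (inf_le_left.trans inf_le_left))
        (hW.trans (inf_le_left.trans inf_le_right)) x hxW s w
      have h2 := hc j k W (hW.trans (inf_le_left.trans inf_le_right))
        (hW.trans inf_le_right) x hxW s w
      have h3 := hc i k W (hW.trans (inf_le_left.trans inf_le_left))
        (hW.trans inf_le_right) x hxW s w
      change c i j x w _ + c j k x w _ = c i k x w _
      rw [h1, h2, h3]
      abel⟩
  refine ⟨QuotientAddGroup.mk C, ?_⟩
  -- Equality of classes is stated for -ι^*c + a, whence the cochain -b.
  refine QuotientAddGroup.eq.mpr ⟨fun i => U i ⊓ ⟨(trivializationAt F V i).baseSet,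
    (trivializationAt F V i).open_baseSet⟩,
    fun i => ⟨hxU i, mem_baseSet_trivializationAt F V i⟩, fun i => -b i, fun i =>
      (isHolOn_iff.mpr fun x hx => P.isHolAt_deriv_sub_conn (hb i) hx).neg, fun i j x hx => ?_⟩
  ext w v
  obtain ⟨W, hW, hxW, s, rfl⟩ := P.exists_lift_vector v hx
  have h1 := hc i j W (hW.trans (inf_le_left.trans inf_le_left))
    (hW.trans (inf_le_right.trans inf_le_left)) x hxW s (mfderiv 𝓘(ℂ, EX) 𝓘(ℂ, EY) ι x w)
  have h2 := hb i W (hW.trans (inf_le_left.trans inf_le_left))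
    (hW.trans (inf_le_left.trans inf_le_right)) x hxW s w
  have h3 := hb j W (hW.trans (inf_le_right.trans inf_le_left))
    (hW.trans (inf_le_right.trans inf_le_right)) x hxW s w
  have h4 := conn_sub_conn (e := trivializationAt F V i) (e' := trivializationAt F V j) hx.1.2 hx.2.2
    (P.isHolAt_ρ s hxW) w
  change -(c i j x (mfderiv 𝓘(ℂ, EX) 𝓘(ℂ, EY) ι x w) (P.ev W hxW s)) +
    dTransition EX V (trivializationAt F V i) (trivializationAt F V j) x w (P.ρ W s x) =
    -(b i x w (P.ev W hxW s)) - -(b j x w (P.ev W hxW s))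
  rw [h1, h2, h3, ← h4]
  abel

end Necessity


/-! ### From a preimage of the Atiyah class to an extension -/

section Sufficiency

universe uX uY uEX uEY uF uV

variable {X : Type uX} [TopologicalSpace X]
  {EX : Type uEX} [NormedAddCommGroup EX] [NormedSpace ℂ EX] [ChartedSpace EX X]
  [IsManifold 𝓘(ℂ, EX) ω X]
  {Y : Type uY} [TopologicalSpace Y]
  {EY : Type uEY} [NormedAddCommGroup EY] [NormedSpace ℂ EY] [ChartedSpace EY Y]
  [IsManifold 𝓘(ℂ, EY) ω Y]
  {F : Type uF} [NormedAddCommGroup F] [NormedSpace ℂ F]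
  {V : X → Type uV} [TopologicalSpace (TotalSpace F V)]
  [∀ x, AddCommGroup (V x)] [∀ x, Module ℂ (V x)] [∀ x, TopologicalSpace (V x)]
  [∀ x, IsTopologicalAddGroup (V x)] [∀ x, ContinuousSMul ℂ (V x)]
  [FiberBundle F V] [VectorBundle ℂ F V] [ContMDiffVectorBundle ω F V 𝓘(ℂ, EX)]
  {ι : C^ω⟮𝓘(ℂ, EX), X; 𝓘(ℂ, EY), Y⟯}

variable (F V ι) in
/-- A cocycle with values in `Ω¹_{Y|X} ⊗ End E` whose restriction to `X` differs from the cocycle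
of the Atiyah class by the coboundary of `b`. -/
structure AtiyahLift where
  /-- the cover -/
  U : X → Opens X
  /-- the cocycle -/
  c : X → X → ∀ x, OmegaResEnd V ι x
  /-- the cochain -/
  b : X → ∀ x, OmegaEnd EX V x
  mem : ∀ i, i ∈ U i
  mem_baseSet : ∀ {i x}, x ∈ U i → x ∈ (trivializationAt F V i).baseSet
  isHolAt_c : ∀ {i j x}, x ∈ U i → x ∈ U j →
    IsHolAt EX (EY →L[ℂ] (F →L[ℂ] F)) (OmegaResEnd V ι) (c i j) x
  isHolAt_b : ∀ {i x}, x ∈ U i → IsHolAt EX (EX →L[ℂ] (F →L[ℂ] F)) (OmegaEnd EX V) (b i) x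
  cocycle : ∀ {i j k x}, x ∈ U i → x ∈ U j → x ∈ U k → c i j x + c j k x = c i k x
  restrict : ∀ {i j x}, x ∈ U i → x ∈ U j → restrictForm V ι x (c i j x) =
    dTransition EX V (trivializationAt F V i) (trivializationAt F V j) x + b i x - b j x

/-- Unfolds equality of cohomology classes over a common refinement by trivialising sets. The
quotient gives -ι^*c + a as a coboundary, so its cochain changes sign. -/
lemma nonempty_atiyahLift (h : atiyahClass EX F V ∈ Set.range (restrictH1 F V ι)) :
    Nonempty (AtiyahLift F V ι) := by
  obtain ⟨z, hz⟩ := h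
  obtain ⟨⟨c, U, hU, hc, hc'⟩, rfl⟩ := QuotientAddGroup.mk_surjective z
  obtain ⟨U', hU', b, hb, hb'⟩ := QuotientAddGroup.eq.mp hz
  refine ⟨⟨fun i => U i ⊓ U' i ⊓ ⟨(trivializationAt F V i).baseSet,
    (trivializationAt F V i).open_baseSet⟩, c, fun i => -b i, fun i =>
      ⟨⟨hU i, hU' i⟩, mem_baseSet_trivializationAt F V i⟩, fun h => h.2, ?_, ?_, ?_, ?_⟩⟩
  · exact fun hi hj => isHolOn_iff.mp (hc _ _) _ ⟨hi.1.1, hj.1.1⟩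
  · exact fun hi => isHolOn_iff.mp (hb _).neg _ hi.1.2
  · exact fun hi hj hk => hc' _ _ _ _ ⟨⟨hi.1.1, hj.1.1⟩, hk.1.1⟩
  · intro i j x hi hj
    have h1 : -restrictForm V ι x (c i j x) +
      dTransition EX V (trivializationAt F V i) (trivializationAt F V j) x = b i x - b j x :=
      hb' i j x ⟨hi.1.2, hj.1.2⟩
    rw [neg_add_eq_iff_eq_add] at h1
    rw [h1, Pi.neg_apply, Pi.neg_apply]
    abel

variable (V ι) in
/-- The fibres of the bundle of first order jets along `Y` of sections of `E`. -/
abbrev Jet (x : X) : Type (max uEY uV) := V x × (TangentSpace 𝓘(ℂ, EY) (ι x) →L[ℂ] V x)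

/-! ### The sheaf of jets compatible with the cocycle -/

namespace AtiyahLift

variable (L : AtiyahLift F V ι)

/-- The differential part of a jet with respect to the trivialisation of `E` with index `i`. -/
def form (i : X) (σ : ∀ x, Jet V ι x) (x : X) (w : TangentSpace 𝓘(ℂ, EY) (ι x)) : V x :=
  (σ x).2 w + L.c i x x w (σ x).1

/-- The cover being indexed by points, the second component of a jet at x is its form in the index x
itself, and c i x converts it to the index i. No gluing of bundles is needed, but that component
need not vary holomorphically; only the forms in a fixed index do. The rule is the cocycle identity
for i, j, x. -/
lemma form_eq_add {i j x : X} (hi : x ∈ L.U i) (hj : x ∈ L.U j) (σ : ∀ x, Jet V ι x)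
    (w : TangentSpace 𝓘(ℂ, EY) (ι x)) :
    L.form i σ x w = L.form j σ x w + L.c i j x w (σ x).1 := by
  rw [form, form, ← L.cocycle hi hj (L.mem x), add_assoc]
  refine congrArg _ ?_
  exact add_comm (L.c i j x w (σ x).1) _

/-- Holomorphy and integrability at `x₀` of a family of jets. -/
structure IsGood (σ : ∀ x, Jet V ι x) (x₀ : X) : Prop where
  isHolAt_fst : IsHolAt EX F V (fun x => (σ x).1) x₀
  isHolAt_form : ∀ i, x₀ ∈ L.U i → ∀ w : ∀ x, TangentSpace 𝓘(ℂ, EY) (ι x),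
    IsHolAt EX EY (ι *ᵖ (TangentSpace 𝓘(ℂ, EY) : Y → Type uEY)) w x₀ →
    IsHolAt EX F V (fun x => L.form i σ x (w x)) x₀
  form_mfderiv : ∀ i, x₀ ∈ L.U i → ∀ w : TangentSpace 𝓘(ℂ, EX) x₀,
    L.form i σ x₀ (mfderiv 𝓘(ℂ, EX) 𝓘(ℂ, EY) ι x₀ w) =
      conn EX (trivializationAt F V i) (fun x => (σ x).1) x₀ w + L.b i x₀ w (σ x₀).1

variable {L}

/-- Changing i to j adds c_ji s to the form. On T_X this is (∇_j - ∇_i) s + b_j s - b_i s, by the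
equation relating c, b and the Atiyah cocycle. -/
lemma IsGood.of_index {σ : ∀ x, Jet V ι x} {i x₀ : X} (hx₀ : x₀ ∈ L.U i)
    (h1 : IsHolAt EX F V (fun x => (σ x).1) x₀)
    (h2 : ∀ w : ∀ x, TangentSpace 𝓘(ℂ, EY) (ι x),
      IsHolAt EX EY (ι *ᵖ (TangentSpace 𝓘(ℂ, EY) : Y → Type uEY)) w x₀ →
      IsHolAt EX F V (fun x => L.form i σ x (w x)) x₀)
    (h3 : ∀ w : TangentSpace 𝓘(ℂ, EX) x₀,
      L.form i σ x₀ (mfderiv 𝓘(ℂ, EX) 𝓘(ℂ, EY) ι x₀ w) =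
        conn EX (trivializationAt F V i) (fun x => (σ x).1) x₀ w + L.b i x₀ w (σ x₀).1) :
    L.IsGood σ x₀ := by
  refine ⟨h1, fun j hj w hw => ?_, fun j hj w => ?_⟩
  · refine ((h2 w hw).add (((L.isHolAt_c hj hx₀).clm_apply hw).clm_apply h1)).congr ?_
    filter_upwards [(L.U i).isOpen.mem_nhds hx₀, (L.U j).isOpen.mem_nhds hj] with x hxi hxj
    exact L.form_eq_add hxj hxi σ (w x)
  · rw [L.form_eq_add hj hx₀, h3]
    have h4 := conn_sub_conn (L.mem_baseSet hj) (L.mem_baseSet hx₀) h1 w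
    have h5 : L.c j i x₀ (mfderiv 𝓘(ℂ, EX) 𝓘(ℂ, EY) ι x₀ w) (σ x₀).1 =
        dTransition EX V (trivializationAt F V j) (trivializationAt F V i) x₀ w (σ x₀).1 +
          L.b j x₀ w (σ x₀).1 - L.b i x₀ w (σ x₀).1 :=
      congrArg (fun T : OmegaEnd EX V x₀ => T w (σ x₀).1) (L.restrict hj hx₀)
    rw [h5, ← h4]
    abel

lemma form_congr {i x : X} {σ τ : ∀ x, Jet V ι x} (h : σ x = τ x)
    (w : TangentSpace 𝓘(ℂ, EY) (ι x)) : L.form i σ x w = L.form i τ x w := by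
  rw [form, form, h]

lemma IsGood.congr {σ τ : ∀ x, Jet V ι x} {x₀ : X} (h : L.IsGood σ x₀)
    (hστ : ∀ᶠ x in 𝓝 x₀, τ x = σ x) : L.IsGood τ x₀ := by
  have h1 : ∀ᶠ x in 𝓝 x₀, (τ x).1 = (σ x).1 := hστ.mono fun x hx => by rw [hx]
  refine ⟨h.isHolAt_fst.congr h1, fun i hi w hw => (h.isHolAt_form i hi w hw).congr
    (hστ.mono fun x hx => form_congr hx _), fun i hi w => ?_⟩
  rw [form_congr hστ.self_of_nhds, h.form_mfderiv i hi, conn_congr _ h1, hστ.self_of_nhds]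

lemma form_add (i : X) (σ τ : ∀ x, Jet V ι x) (x : X) (w : TangentSpace 𝓘(ℂ, EY) (ι x)) :
    L.form i (σ + τ) x w = L.form i σ x w + L.form i τ x w := by
  have h : L.c i x x w ((σ x).1 + (τ x).1) = L.c i x x w (σ x).1 + L.c i x x w (τ x).1 :=
    map_add _ _ _
  change (σ x).2 w + (τ x).2 w + L.c i x x w ((σ x).1 + (τ x).1) = _
  rw [h, form, form]
  abel

lemma IsGood.add {σ τ : ∀ x, Jet V ι x} {x₀ : X} (hσ : L.IsGood σ x₀) (hτ : L.IsGood τ x₀) :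
    L.IsGood (σ + τ) x₀ := by
  refine ⟨hσ.isHolAt_fst.add hτ.isHolAt_fst, fun i hi w hw => ?_, fun i hi w => ?_⟩
  · exact ((hσ.isHolAt_form i hi w hw).add (hτ.isHolAt_form i hi w hw)).congr
      (Filter.Eventually.of_forall fun x => form_add i σ τ x _)
  · rw [form_add, hσ.form_mfderiv i hi, hτ.form_mfderiv i hi]
    have h1 := conn_add (L.mem_baseSet hi) hσ.isHolAt_fst hτ.isHolAt_fst w
    have h2 : L.b i x₀ w ((σ x₀).1 + (τ x₀).1) = L.b i x₀ w (σ x₀).1 + L.b i x₀ w (τ x₀).1 :=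
      map_add _ _ _
    change _ = conn EX _ (fun x => (σ x).1 + (τ x).1) x₀ w + L.b i x₀ w ((σ x₀).1 + (τ x₀).1)
    rw [h1, h2]
    abel

/-- The product of a function with given differential and a jet. -/
def jetSMul (f : X → ℂ) (θ : ∀ x, TangentSpace 𝓘(ℂ, EY) (ι x) →L[ℂ] ℂ) (σ : ∀ x, Jet V ι x) :
    ∀ x, Jet V ι x :=
  fun x => (f x • (σ x).1, f x • (σ x).2 + (θ x).smulRight (σ x).1)

lemma form_jetSMul (i : X) (f : X → ℂ) (θ : ∀ x, TangentSpace 𝓘(ℂ, EY) (ι x) →L[ℂ] ℂ)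
    (σ : ∀ x, Jet V ι x) (x : X) (w : TangentSpace 𝓘(ℂ, EY) (ι x)) :
    L.form i (jetSMul f θ σ) x w = f x • L.form i σ x w + θ x w • (σ x).1 := by
  have h : L.c i x x w (f x • (σ x).1) = f x • L.c i x x w (σ x).1 := map_smul _ _ _
  change f x • (σ x).2 w + θ x w • (σ x).1 + L.c i x x w (f x • (σ x).1) = _
  rw [h, form, smul_add]
  abel

lemma IsGood.jetSMul {f : X → ℂ} {θ : ∀ x, TangentSpace 𝓘(ℂ, EY) (ι x) →L[ℂ] ℂ}
    {σ : ∀ x, Jet V ι x} {x₀ : X} (hf : ContMDiffAt 𝓘(ℂ, EX) 𝓘(ℂ, ℂ) ω f x₀)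
    (hθ : ∀ w : ∀ x, TangentSpace 𝓘(ℂ, EY) (ι x),
      IsHolAt EX EY (ι *ᵖ (TangentSpace 𝓘(ℂ, EY) : Y → Type uEY)) w x₀ →
      ContMDiffAt 𝓘(ℂ, EX) 𝓘(ℂ, ℂ) ω (fun x => θ x (w x)) x₀)
    (hfθ : ∀ w : TangentSpace 𝓘(ℂ, EX) x₀,
      θ x₀ (mfderiv 𝓘(ℂ, EX) 𝓘(ℂ, EY) ι x₀ w) = dFun f x₀ w)
    (hσ : L.IsGood σ x₀) : L.IsGood (jetSMul f θ σ) x₀ := by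
  refine ⟨IsHolAt.smul hf hσ.isHolAt_fst, fun i hi w hw => ?_,
    fun i hi w => ?_⟩
  · exact ((IsHolAt.smul hf (hσ.isHolAt_form i hi w hw)).add
      (IsHolAt.smul (hθ w hw) hσ.isHolAt_fst)).congr
      (Filter.Eventually.of_forall fun x => form_jetSMul i _ _ σ x _)
  · rw [form_jetSMul, hσ.form_mfderiv i hi]
    have h1 := conn_smul (L.mem_baseSet hi) hf hσ.isHolAt_fst w
    have h2 : L.b i x₀ w (f x₀ • (σ x₀).1) = f x₀ • L.b i x₀ w (σ x₀).1 :=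
      map_smul _ _ _
    have h3 := congrArg (· • (σ x₀).1) (hfθ w)
    change _ = conn EX _ (fun x => f x • (σ x).1) x₀ w + L.b i x₀ w (f x₀ • (σ x₀).1)
    rw [h1, h2]
    refine (congrArg (_ + ·) h3).trans ?_
    rw [smul_add]
    abel

lemma isGood_zero (x₀ : X) : L.IsGood 0 x₀ := by
  have h0 : ∀ i x w, L.form i 0 x w = 0 := fun i x w => by
    have h : L.c i x x w 0 = 0 := map_zero _
    change (0 : V x) + L.c i x x w 0 = 0
    rw [h, add_zero]
  refine ⟨isHolAt_zero x₀, fun i hi w hw => (isHolAt_zero x₀).congr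
    (Filter.Eventually.of_forall fun x => h0 i x _), fun i hi w => ?_⟩
  have h1 := conn_smul (f := fun _ => 0) (L.mem_baseSet hi) contMDiffAt_const
    (isHolAt_zero (EX := EX) (G := F) (W := V) x₀) w
  have h2 : L.b i x₀ w 0 = 0 := map_zero _
  simp only [smul_zero, zero_smul, add_zero] at h1
  rw [h0]
  change 0 = conn EX _ (fun x => (0 : V x)) x₀ w + L.b i x₀ w 0
  rw [h1, h2, add_zero]

variable (L)

/-- The jets over `W`, extended by zero. -/
def jets (W : Opens X) : AddSubgroup (∀ x, Jet V ι x) where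
  carrier := {σ | (∀ x ∉ W, σ x = 0) ∧ ∀ x ∈ W, L.IsGood σ x}
  zero_mem' := ⟨fun _ _ => rfl, fun x _ => isGood_zero x⟩
  add_mem' := fun {σ τ} hσ hτ => ⟨fun x hx => by
    rw [Pi.add_apply, hσ.1 x hx, hτ.1 x hx, add_zero], fun x hx => (hσ.2 x hx).add (hτ.2 x hx)⟩
  neg_mem' := fun {σ} hσ => ⟨fun x hx => by rw [Pi.neg_apply, hσ.1 x hx, neg_zero], fun x hx => by
    -- Negation is the action of the constant function -1, whose differential is zero.
    refine ((hσ.2 x hx).jetSMul (f := fun _ => -1) (θ := fun _ => 0) contMDiffAt_const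
      (fun _ _ => contMDiffAt_const) fun w => ?_).congr (Filter.Eventually.of_forall fun p => ?_)
    · rw [dFun_const]; rfl
    · refine Prod.ext (neg_one_smul ℂ _).symm ?_
      ext w
      change -((σ p).2 w) = (-1 : ℂ) • (σ p).2 w + (0 : ℂ) • (σ p).1
      rw [neg_one_smul, zero_smul, add_zero]⟩

variable {L}

lemma jetSMul_mem {W : Opens X} (a : O1 ι W) {σ : ∀ x, Jet V ι x} (hσ : σ ∈ L.jets W) :
    jetSMul a.val a.d σ ∈ L.jets W := by
  refine ⟨fun x hx => ?_, fun x hx => (hσ.2 x hx).jetSMul (a.contMDiffAt_val hx)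
    (fun w hw => a.contMDiffAt_d hx hw) (a.d_mfderiv hx)⟩
  have h := hσ.1 x hx
  refine Prod.ext ?_ ?_
  · change a.val x • (σ x).1 = 0
    rw [h, Prod.fst_zero, smul_zero]
  · ext w
    change a.val x • (σ x).2 w + a.d x w • (σ x).1 = 0
    rw [h, Prod.fst_zero, smul_zero, add_zero]
    exact smul_zero _

/-- Two jets are equal if their values and differentials with respect to a trivialisation are. -/
lemma jet_ext {i x : X} {σ τ : ∀ x, Jet V ι x} (h1 : (σ x).1 = (τ x).1)
    (h2 : ∀ w, L.form i σ x w = L.form i τ x w) : σ x = τ x := by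
  refine Prod.ext h1 ?_
  ext w
  have h3 := h2 w
  rw [form, form, h1] at h3
  exact add_right_cancel h3

lemma ext_of_mem {W : Opens X} {σ τ : ∀ x, Jet V ι x} (hσ : σ ∈ L.jets W) (hτ : τ ∈ L.jets W)
    (h : ∀ x ∈ W, σ x = τ x) : σ = τ :=
  funext fun x => (em (x ∈ W)).elim (h x) fun hx => (hσ.1 x hx).trans (hτ.1 x hx).symm

instance (W : Opens X) : SMul (O1 ι W) (L.jets W) :=
  ⟨fun a σ => ⟨jetSMul a.val a.d σ.1, jetSMul_mem a σ.2⟩⟩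

lemma coe_smul {W : Opens X} (a : O1 ι W) (σ : L.jets W) :
    (a • σ : L.jets W).1 = jetSMul a.val a.d σ.1 := rfl

lemma jets_ext {W : Opens X} {σ τ : L.jets W} (h : ∀ x ∈ W, (σ.1 x).1 = (τ.1 x).1)
    (h' : ∀ x ∈ W, ∀ w, (σ.1 x).2 w = (τ.1 x).2 w) : σ = τ := by
  refine Subtype.ext (ext_of_mem σ.2 τ.2 fun x hx => Prod.ext (h x hx) ?_)
  ext w
  exact h' x hx w

instance (W : Opens X) : Module (O1 ι W) (L.jets W) where
  one_smul σ := by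
    refine jets_ext (fun x hx => ?_) fun x hx w => ?_
    · change (1 : O1 ι W).val x • (σ.1 x).1 = _
      rw [O1.val_one hx, one_smul]
    · change (1 : O1 ι W).val x • (σ.1 x).2 w + (1 : O1 ι W).d x w • (σ.1 x).1 = _
      rw [O1.val_one hx, O1.d_one hx, one_smul]
      exact (congrArg (_ + ·) (zero_smul ℂ _)).trans (add_zero _)
  mul_smul a b σ := by
    refine jets_ext (fun x hx => ?_) fun x hx w => ?_
    · change (a * b).val x • (σ.1 x).1 = a.val x • b.val x • (σ.1 x).1
      rw [O1.val_mul _ _ hx, mul_smul]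
    · change (a * b).val x • (σ.1 x).2 w + (a * b).d x w • (σ.1 x).1 =
        a.val x • (b.val x • (σ.1 x).2 w + b.d x w • (σ.1 x).1) + a.d x w • b.val x • (σ.1 x).1
      have h : (a * b).d x w = a.val x * b.d x w + b.val x * a.d x w := by
        rw [O1.d_mul _ _ hx]; rfl
      rw [O1.val_mul _ _ hx, h, mul_comm (b.val x)]
      simp only [mul_smul, add_smul, smul_add, add_assoc]
  smul_zero a := by
    refine jets_ext (fun x hx => smul_zero _) fun x hx w => ?_
    change a.val x • (0 : V x) + a.d x w • (0 : V x) = 0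
    rw [smul_zero, smul_zero, add_zero]
  smul_add a σ τ := by
    refine jets_ext (fun x hx => smul_add _ _ _) fun x hx w => ?_
    change a.val x • ((σ.1 x).2 w + (τ.1 x).2 w) + a.d x w • ((σ.1 x).1 + (τ.1 x).1) =
      (a.val x • (σ.1 x).2 w + a.d x w • (σ.1 x).1) + (a.val x • (τ.1 x).2 w + a.d x w • (τ.1 x).1)
    simp only [smul_add]
    abel
  add_smul a b σ := by
    refine jets_ext (fun x hx => ?_) fun x hx w => ?_
    · change (a + b).val x • (σ.1 x).1 = a.val x • (σ.1 x).1 + b.val x • (σ.1 x).1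
      rw [O1.val_add _ _ hx, add_smul]
    · change (a + b).val x • (σ.1 x).2 w + (a + b).d x w • (σ.1 x).1 =
        (a.val x • (σ.1 x).2 w + a.d x w • (σ.1 x).1) +
          (b.val x • (σ.1 x).2 w + b.d x w • (σ.1 x).1)
      have h : (a + b).d x w = a.d x w + b.d x w := by
        rw [O1.d_add _ _ hx]; rfl
      rw [O1.val_add _ _ hx, h]
      simp only [add_smul]
      abel
  zero_smul σ := by
    refine jets_ext (fun x hx => ?_) fun x hx w => ?_
    · change (0 : O1 ι W).val x • (σ.1 x).1 = 0
      rw [O1.val_zero hx, zero_smul]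
    · change (0 : O1 ι W).val x • (σ.1 x).2 w + (0 : O1 ι W).d x w • (σ.1 x).1 = 0
      rw [O1.val_zero hx, O1.d_zero hx, zero_smul, zero_add]
      exact zero_smul ℂ _

open Classical in
/-- Restriction of jets to a smaller open set. -/
def restr {W W' : Opens X} (h : W ≤ W') : L.jets W' →+ L.jets W where
  toFun σ := ⟨fun x => if x ∈ W then σ.1 x else 0, fun x hx => if_neg hx, fun x hx =>
    (σ.2.2 x (h hx)).congr (by
      filter_upwards [W.isOpen.mem_nhds hx] with p hp using if_pos hp)⟩
  map_zero' := Subtype.ext (funext fun x => ite_self _)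
  map_add' σ τ := Subtype.ext (funext fun x => by
    change (if x ∈ W then σ.1 x + τ.1 x else 0) =
      (if x ∈ W then σ.1 x else 0) + (if x ∈ W then τ.1 x else 0)
    split_ifs <;> simp)

lemma restr_apply {W W' : Opens X} (h : W ≤ W') (σ : L.jets W') {x : X} (hx : x ∈ W) :
    (restr h σ).1 x = σ.1 x := if_pos hx

lemma existsUnique_glue (𝒰 : Set (Opens X)) (s : ∀ U : 𝒰, L.jets U)
    (hs : ∀ U W : 𝒰, ∀ x ∈ (U : Opens X), x ∈ (W : Opens X) → (s U).1 x = (s W).1 x) :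
    ∃! t : L.jets (sSup 𝒰), ∀ U : 𝒰, ∀ x ∈ (U : Opens X), t.1 x = (s U).1 x := by
  classical
  let t : ∀ x, Jet V ι x := fun x =>
    if h : ∃ U : 𝒰, x ∈ (U : Opens X) then (s h.choose).1 x else 0
  have ht : ∀ U : 𝒰, ∀ x ∈ (U : Opens X), t x = (s U).1 x := by
    intro U x hx
    have h : ∃ U : 𝒰, x ∈ (U : Opens X) := ⟨U, hx⟩
    exact (dif_pos h).trans (hs _ _ x h.choose_spec hx)
  have hmem : ∀ x, x ∈ sSup 𝒰 → ∃ U : 𝒰, x ∈ (U : Opens X) := fun x hx => by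
    obtain ⟨U, hU, hxU⟩ := Opens.mem_sSup.mp hx
    exact ⟨⟨U, hU⟩, hxU⟩
  refine ⟨⟨t, fun x hx => dif_neg ?_, fun x hx => ?_⟩, ht, fun t' ht' => ?_⟩
  · rintro ⟨U, hU⟩
    exact hx (Opens.mem_sSup.mpr ⟨U, U.2, hU⟩)
  · obtain ⟨U, hU⟩ := hmem x hx
    refine ((s U).2.2 x hU).congr ?_
    filter_upwards [(U : Opens X).isOpen.mem_nhds hU] with p hp using ht U p hp
  · refine Subtype.ext (funext fun x => ?_)
    by_cases hx : x ∈ sSup 𝒰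
    · obtain ⟨U, hU⟩ := hmem x hx
      exact (ht' U x hU).trans (ht U x hU).symm
    · refine (t'.2.1 x hx).trans (show t x = 0 from dif_neg ?_).symm
      rintro ⟨U, hU⟩
      exact hx (Opens.mem_sSup.mpr ⟨U, U.2, hU⟩)

/-- The sections of an `X1Module` live in the universe of X and Y, while jets also involve those of
V and EY. The fibres, being finite-dimensional over ℂ, are equivalent to powers of ℂ. -/
instance small_jets [FiniteDimensional ℂ F] [FiniteDimensional ℂ EY] (W : Opens X) :
    Small.{max uX uY} (L.jets W) := by
  have h0 : ∀ (A : Type uV) [AddCommGroup A] [Module ℂ A] [FiniteDimensional ℂ A],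
      Small.{max uX uY} A := fun A _ _ _ =>
    small_map (Module.finBasis ℂ A).equivFun.toEquiv
  have h1 : ∀ x, Small.{max uX uY} (Jet V ι x) := fun x => by
    have := finiteDimensional_fibre _ (mem_baseSet_trivializationAt F V x)
    have : FiniteDimensional ℂ (TangentSpace 𝓘(ℂ, EY) (ι x)) :=
      inferInstanceAs (FiniteDimensional ℂ EY)
    have := h0 (V x)
    have : Small.{max uX uY} (TangentSpace 𝓘(ℂ, EY) (ι x) →L[ℂ] V x) := by
      have h2 : Small.{max uX uY} (TangentSpace 𝓘(ℂ, EY) (ι x) →ₗ[ℂ] V x) :=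
        small_map (Module.finBasis ℂ (TangentSpace 𝓘(ℂ, EY) (ι x) →ₗ[ℂ] V x)).equivFun.toEquiv
      exact small_of_injective ContinuousLinearMap.coe_injective
    infer_instance
  infer_instance

variable [FiniteDimensional ℂ F] [FiniteDimensional ℂ EY]

variable (L) in
/-- Sections of the sheaf of jets, as jets. -/
def shrinkEquiv (W : Opens X) : Shrink.{max uX uY} (L.jets W) ≃ₗ[O1 ι W] L.jets W :=
  Shrink.linearEquiv _ _

variable (L) in
/-- The sheaf of first order jets along `Y` of sections of `E` which are compatible with the
cocycle. -/
def sheaf : X1Module ι where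
  sec W := Shrink.{max uX uY} (L.jets W)
  res {W W'} h := ((L.shrinkEquiv W).symm.toAddMonoidHom.comp (restr h)).comp
    (L.shrinkEquiv W').toAddMonoidHom
  res_refl W s := by
    refine (L.shrinkEquiv W).symm_apply_eq.mpr (Subtype.ext (ext_of_mem (Subtype.prop _)
      (Subtype.prop _) fun x hx => restr_apply _ _ hx))
  res_res {W W' W''} h h' s := by
    refine (L.shrinkEquiv W).symm_apply_eq.mpr ?_
    change restr h (L.shrinkEquiv W' ((L.shrinkEquiv W').symm (restr h' (L.shrinkEquiv W'' s)))) =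
      L.shrinkEquiv W ((L.shrinkEquiv W).symm (restr (h.trans h') (L.shrinkEquiv W'' s)))
    rw [LinearEquiv.apply_symm_apply, LinearEquiv.apply_symm_apply]
    refine Subtype.ext (ext_of_mem (Subtype.prop _) (Subtype.prop _) fun x hx => ?_)
    rw [restr_apply _ _ hx, restr_apply _ _ (h hx), restr_apply _ _ hx]
  res_smul {W W'} h a s := by
    refine (L.shrinkEquiv W).symm_apply_eq.mpr ?_
    change restr h (L.shrinkEquiv W' (a • s)) = L.shrinkEquiv W (O1.res ι h a •
      (L.shrinkEquiv W).symm (restr h (L.shrinkEquiv W' s)))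
    rw [LinearEquiv.map_smul, LinearEquiv.map_smul, LinearEquiv.apply_symm_apply]
    refine Subtype.ext (ext_of_mem (Subtype.prop _) (Subtype.prop _) fun x hx => ?_)
    rw [restr_apply _ _ hx, coe_smul, coe_smul, jetSMul, jetSMul, O1.val_res h a hx,
      O1.d_res h a hx, restr_apply _ _ hx]
  existsUnique_glue 𝒰 s hs := by
    have h1 : ∀ {W W' : Opens X} (h : W ≤ W') (u : Shrink.{max uX uY} (L.jets W'))
        (v : Shrink.{max uX uY} (L.jets W)), (L.shrinkEquiv W).symm
        (restr h (L.shrinkEquiv W' u)) = v ↔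
        ∀ x ∈ W, (L.shrinkEquiv W' u).1 x = (L.shrinkEquiv W v).1 x := by
      intro W W' h u v
      rw [LinearEquiv.symm_apply_eq]
      refine ⟨fun h' x hx => ?_, fun h' => Subtype.ext (ext_of_mem (Subtype.prop _)
        (Subtype.prop _) fun x hx => (restr_apply h _ hx).trans (h' x hx))⟩
      rw [← h', restr_apply h _ hx]
    have h2 : ∀ U W : 𝒰, ∀ x ∈ (U : Opens X), x ∈ (W : Opens X) →
        (L.shrinkEquiv _ (s U)).1 x = (L.shrinkEquiv _ (s W)).1 x := by
      intro U W x hU hW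
      have hx : x ∈ (U : Opens X) ⊓ W := ⟨hU, hW⟩
      rw [(h1 inf_le_left _ _).mp (hs U W) x hx]
      change (L.shrinkEquiv _ ((L.shrinkEquiv _).symm (restr _ (L.shrinkEquiv _ (s W))))).1 x = _
      rw [LinearEquiv.apply_symm_apply, restr_apply _ _ hx]
    obtain ⟨t, ht, ht'⟩ := existsUnique_glue 𝒰 (fun U => L.shrinkEquiv _ (s U)) h2
    refine ⟨(L.shrinkEquiv _).symm t, fun U => (h1 (le_sSup U.2) _ _).mpr ?_, fun u hu =>
      (L.shrinkEquiv _).eq_symm_apply.mpr (ht' _ fun U => (h1 (le_sSup U.2) _ _).mp (hu U))⟩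
    rw [LinearEquiv.apply_symm_apply]
    exact ht U

/-- The family of jets given by a section of the sheaf of jets. -/
def toJets {W : Opens X} (s : L.sheaf.sec W) : L.jets W := L.shrinkEquiv W s

/-- The section of the sheaf of jets given by a family of jets. -/
def ofJets {W : Opens X} (σ : L.jets W) : L.sheaf.sec W := (L.shrinkEquiv W).symm σ

lemma toJets_ofJets {W : Opens X} (σ : L.jets W) : toJets (ofJets σ) = σ :=
  (L.shrinkEquiv W).apply_symm_apply σ

lemma toJets_injective {W : Opens X} : Function.Injective (toJets (L := L) (W := W)) :=
  (L.shrinkEquiv W).injective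

lemma toJets_add {W : Opens X} (s t : L.sheaf.sec W) : toJets (s + t) = toJets s + toJets t :=
  map_add (L.shrinkEquiv W) s t

lemma toJets_smul {W : Opens X} (a : O1 ι W) (s : L.sheaf.sec W) :
    toJets (a • s) = a • toJets s :=
  map_smul (L.shrinkEquiv W) a s

lemma toJets_sum {W : Opens X} {κ : Type*} (T : Finset κ) (s : κ → L.sheaf.sec W) :
    toJets (∑ k ∈ T, s k) = ∑ k ∈ T, toJets (s k) :=
  map_sum (L.shrinkEquiv W) s T

lemma toJets_res {W W' : Opens X} (h : W ≤ W') (s : L.sheaf.sec W') {x : X} (hx : x ∈ W) :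
    (toJets (L.sheaf.res h s)).1 x = (toJets s).1 x := by
  refine Eq.trans ?_ (restr_apply h (toJets s) hx)
  exact congrArg (fun σ : L.jets W => σ.1 x) ((L.shrinkEquiv W).apply_symm_apply _)

end AtiyahLift

end Sufficiency


/-! ### The sheaf of jets is locally free and restricts to E -/

section LocallyFree

universe uX uY uEX uEY uF uV

variable {X : Type uX} [TopologicalSpace X]
  {EX : Type uEX} [NormedAddCommGroup EX] [NormedSpace ℂ EX] [ChartedSpace EX X]
  [IsManifold 𝓘(ℂ, EX) ω X]
  {Y : Type uY} [TopologicalSpace Y]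
  {EY : Type uEY} [NormedAddCommGroup EY] [NormedSpace ℂ EY] [ChartedSpace EY Y]
  [IsManifold 𝓘(ℂ, EY) ω Y]
  {ι : C^ω⟮𝓘(ℂ, EX), X; 𝓘(ℂ, EY), Y⟯}

variable (ι) in
/-- A holomorphic left inverse, over `W`, of the differential of `ι`. -/
structure TangentProjection (W : Opens X) where
  /-- the projection -/
  q : ∀ x, TangentSpace 𝓘(ℂ, EY) (ι x) →L[ℂ] TangentSpace 𝓘(ℂ, EX) x
  q_mfderiv : ∀ x ∈ W, ∀ w, q x (mfderiv 𝓘(ℂ, EX) 𝓘(ℂ, EY) ι x w) = w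
  isHolAt_q : ∀ x₀ ∈ W, ∀ w : ∀ x, TangentSpace 𝓘(ℂ, EY) (ι x),
    IsHolAt EX EY (ι *ᵖ (TangentSpace 𝓘(ℂ, EY) : Y → Type uEY)) w x₀ →
    IsHolAt EX EX (TangentSpace 𝓘(ℂ, EX) : X → Type uEX) (fun x => q x (w x)) x₀

lemma AdaptedChart.exists_tangentProjection {x₀ : X} (A : AdaptedChart ι x₀) :
    ∃ W : Opens X, x₀ ∈ W ∧ Nonempty (TangentProjection ι W) := by
  have h1 : ∀ᶠ x in 𝓝 x₀, ContMDiffAt 𝓘(ℂ, EY) 𝓘(ℂ, EX) ω A.p (ι x) ∧ A.p (ι x) = x :=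
    (ι.contMDiff.continuous.continuousAt.eventually
      (contMDiffAt_eventually A.contMDiffAt_p)).and A.p_ι
  obtain ⟨S, hS, hSo, hxS⟩ := eventually_nhds_iff.mp h1
  refine ⟨⟨S, hSo⟩, hxS, ⟨⟨fun x => mfderiv 𝓘(ℂ, EY) 𝓘(ℂ, EX) A.p (ι x), fun x hx w => ?_,
    fun x hx w hw => ?_⟩⟩⟩
  · have h2 := (((hS x hx).1.mdifferentiableAt (by simp)).hasMFDerivAt).comp x
      ((ι.contMDiff.contMDiffAt (x := x)).mdifferentiableAt (by simp)).hasMFDerivAt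
    have h3 : (id : X → X) =ᶠ[𝓝 x] A.p ∘ ι := by
      filter_upwards [hSo.mem_nhds hx] with p hp using (hS p hp).2.symm
    -- The derivative of the identity p ∘ ι = id.
    have h4 := hasMFDerivAt_unique (h2.congr_of_eventuallyEq h3) (hasMFDerivAt_id x)
    exact congrArg (fun T : EX →L[ℂ] EX => T w) h4
  · have h2 := contMDiffAt_mfderiv_apply (hS x hx).1 ι.contMDiff.contMDiffAt
      (isHolAt_pullback_iff.mp hw)
    refine ContMDiffAt.congr_of_eventuallyEq h2 ?_
    filter_upwards [hSo.mem_nhds hx] with p hp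
    have h3 : ∀ p', p' = p → ∀ u : EX, (⟨p, u⟩ : TangentBundle 𝓘(ℂ, EX) X) = ⟨p', u⟩ := by
      rintro _ rfl _; rfl
    exact h3 _ (hS p hp).2 _

/-- Evaluation of a form with values in endomorphisms. -/
def evalForm {A B : Type*} [AddCommGroup A] [Module ℂ A] [TopologicalSpace A]
    [IsTopologicalAddGroup A] [ContinuousSMul ℂ A] [T2Space A] [FiniteDimensional ℂ A]
    [AddCommGroup B] [Module ℂ B] [TopologicalSpace B]
    [IsTopologicalAddGroup B] [ContinuousSMul ℂ B]
    (C : A →L[ℂ] (B →L[ℂ] B)) (v : B) : A →L[ℂ] B :=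
  LinearMap.toContinuousLinearMap
    { toFun := fun w => C w v
      map_add' := fun w w' => by rw [map_add]; rfl
      map_smul' := fun a w => by rw [map_smul]; rfl }

variable {F : Type uF} [NormedAddCommGroup F] [NormedSpace ℂ F]
  {V : X → Type uV} [TopologicalSpace (TotalSpace F V)]
  [∀ x, AddCommGroup (V x)] [∀ x, Module ℂ (V x)] [∀ x, TopologicalSpace (V x)]
  [∀ x, IsTopologicalAddGroup (V x)] [∀ x, ContinuousSMul ℂ (V x)]
  [FiberBundle F V] [VectorBundle ℂ F V] [ContMDiffVectorBundle ω F V 𝓘(ℂ, EX)]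

namespace AtiyahLift

variable (L : AtiyahLift F V ι)

variable [FiniteDimensional ℂ EX] [FiniteDimensional ℂ EY]

/-- The required form is prescribed on T_X only, and the projection q extends it to all tangent
vectors of Y. -/
lemma exists_lift {W : Opens X} (Q : TangentProjection ι W) {i : X} (hi : W ≤ L.U i)
    (t : ∀ x, V x) : ∃ σ : ∀ x, Jet V ι x, (∀ x, (σ x).1 = t x) ∧
      (∀ x w, L.form i σ x w =
        conn EX (trivializationAt F V i) t x (Q.q x w) + L.b i x (Q.q x w) (t x)) ∧
      ∀ x ∈ W, IsHolAt EX F V t x → L.IsGood σ x := by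
  have hfX : ∀ x : X, FiniteDimensional ℂ (TangentSpace 𝓘(ℂ, EX) x) := fun x =>
    inferInstanceAs (FiniteDimensional ℂ EX)
  have hfY : ∀ x : X, FiniteDimensional ℂ (TangentSpace 𝓘(ℂ, EY) (ι x)) := fun x =>
    inferInstanceAs (FiniteDimensional ℂ EY)
  have htX : ∀ x : X, T2Space (TangentSpace 𝓘(ℂ, EX) x) := fun x => inferInstanceAs (T2Space EX)
  have htY : ∀ x : X, T2Space (TangentSpace 𝓘(ℂ, EY) (ι x)) := fun x => inferInstanceAs (T2Space EY)
  let C : ∀ x, TangentSpace 𝓘(ℂ, EY) (ι x) →L[ℂ] (V x →L[ℂ] V x) := fun x => L.c i x x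
  -- Subtracting c i x applied to t converts the form from the index i to the index x.
  let σ : ∀ x, Jet V ι x := fun x => (t x,
    (conn EX (trivializationAt F V i) t x + evalForm (L.b i x) (t x)) ∘L Q.q x -
      evalForm (C x) (t x))
  have hσ : ∀ x w, L.form i σ x w =
      conn EX (trivializationAt F V i) t x (Q.q x w) + L.b i x (Q.q x w) (t x) := fun x w =>
    sub_add_cancel _ (L.c i x x w (t x))
  refine ⟨σ, fun _ => rfl, hσ, fun x hx ht => IsGood.of_index (hi hx) ht (fun w hw => ?_)
    fun w => ?_⟩
  · have h1 := Q.isHolAt_q x hx w hw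
    exact (((isHolAt_conn (L.mem_baseSet (hi hx)) ht).clm_apply h1).add
      (((L.isHolAt_b (hi hx)).clm_apply h1).clm_apply ht)).congr
      (Filter.Eventually.of_forall fun p => hσ p _)
  · rw [hσ, Q.q_mfderiv x hx]

variable [FiniteDimensional ℂ F]

lemma exists_section_lift {W : Opens X} (Q : TangentProjection ι W) {i : X} (hi : W ≤ L.U i)
    {W' : Opens X} (hW' : W' ≤ W) {t : ∀ x, V x} (ht : ∀ x ∈ W', IsHolAt EX F V t x) :
    ∃ s : L.sheaf.sec W', ∀ x ∈ W', ((toJets s).1 x).1 = t x ∧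
      ∀ w, L.form i (toJets s).1 x w =
        conn EX (trivializationAt F V i) t x (Q.q x w) + L.b i x (Q.q x w) (t x) := by
  classical
  obtain ⟨σ, h1, h2, h3⟩ := L.exists_lift Q hi t
  let τ : L.jets W' := ⟨fun x => if x ∈ W' then σ x else 0, fun x hx => if_neg hx, fun x hx =>
    (h3 x (hW' hx) (ht x hx)).congr (by
      filter_upwards [W'.isOpen.mem_nhds hx] with p hp using if_pos hp)⟩
  have hτ : ∀ x ∈ W', τ.1 x = σ x := fun x hx => if_pos hx
  refine ⟨ofJets τ, fun x hx => ?_⟩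
  rw [toJets_ofJets]
  exact ⟨(congrArg Prod.fst (hτ x hx)).trans (h1 x), fun w =>
    (form_congr (hτ x hx) w).trans (h2 x w)⟩

variable {L}

omit [FiniteDimensional ℂ EX] [FiniteDimensional ℂ EY] [FiniteDimensional ℂ F] in
lemma form_sum {κ : Type*} (T : Finset κ) (i : X) (σ : κ → ∀ x, Jet V ι x) (x : X)
    (w : TangentSpace 𝓘(ℂ, EY) (ι x)) :
    L.form i (∑ k ∈ T, σ k) x w = ∑ k ∈ T, L.form i (σ k) x w :=
  map_sum (AddMonoidHom.mk' (fun σ => L.form i σ x w) fun σ τ => form_add i σ τ x w) σ T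

/-- Over the domain of a projection of the tangent spaces the sheaf of jets is free. -/
lemma exists_frame (hA : ∀ x, Nonempty (AdaptedChart ι x)) {W : Opens X}
    (Q : TangentProjection ι W) {i : X} (hi : W ≤ L.U i) :
    ∃ fr : L.sheaf.Frame W, ∀ (W' : Opens X) (h : W' ≤ W) (s : L.sheaf.sec W'),
      (∀ x ∈ W', ((toJets s).1 x).1 = 0) → ∀ k, ∀ x ∈ W', (fr.coord h s k).val x = 0 := by
  let e := trivializationAt F V i
  have he : ∀ x ∈ W, x ∈ e.baseSet := fun x hx => L.mem_baseSet (hi hx)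
  let β := Module.finBasis ℂ F
  have h1 : ∀ k, ∃ s : L.sheaf.sec W, ∀ x ∈ W, ((toJets s).1 x).1 = e.symmL ℂ x (β k) ∧
      ∀ w, L.form i (toJets s).1 x w = conn EX e (fun x => e.symmL ℂ x (β k)) x (Q.q x w) +
        L.b i x (Q.q x w) (e.symmL ℂ x (β k)) := fun k =>
    L.exists_section_lift Q hi le_rfl fun x hx => isHolAt_symmL e (he x hx) contMDiffAt_const
  choose s hs hs' using h1
  -- The frame of E is constant in the trivialisation, hence parallel, and only the term with b
  -- remains.
  have hs'' : ∀ k, ∀ x ∈ W, ∀ w, L.form i (toJets (s k)).1 x w =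
      L.b i x (Q.q x w) (e.symmL ℂ x (β k)) := fun k x hx w => by
    rw [hs' k x hx, conn_symmL (he x hx)]
    exact zero_add _
  have hfst : ∀ (W' : Opens X) (h : W' ≤ W) (a : Fin (Module.finrank ℂ F) → O1 ι W'), ∀ x ∈ W',
      ((toJets (∑ k, a k • L.sheaf.res h (s k))).1 x).1 =
        e.symmL ℂ x (∑ k, (a k).val x • β k) := by
    intro W' h a x hx
    rw [toJets_sum, AddSubmonoidClass.coe_finsetSum, Finset.sum_apply, Prod.fst_sum, map_sum]
    refine Finset.sum_congr rfl fun k _ => ?_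
    rw [toJets_smul, coe_smul]
    change (a k).val x • ((toJets (L.sheaf.res h (s k))).1 x).1 = _
    rw [toJets_res h _ hx, hs k x (h hx), _root_.map_smul]
  have hform : ∀ (W' : Opens X) (h : W' ≤ W) (a : Fin (Module.finrank ℂ F) → O1 ι W'), ∀ x ∈ W',
      ∀ w, L.form i (toJets (∑ k, a k • L.sheaf.res h (s k))).1 x w =
        L.b i x (Q.q x w) (e.symmL ℂ x (∑ k, (a k).val x • β k)) +
          e.symmL ℂ x (∑ k, (a k).d x w • β k) := by
    intro W' h a x hx w
    rw [toJets_sum, AddSubmonoidClass.coe_finsetSum, form_sum, map_sum, map_sum, map_sum,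
      ← Finset.sum_add_distrib]
    refine Finset.sum_congr rfl fun k _ => ?_
    rw [toJets_smul, coe_smul, form_jetSMul, form_congr (toJets_res h _ hx), toJets_res h _ hx,
      hs'' k x (h hx), hs k x (h hx), _root_.map_smul, _root_.map_smul, _root_.map_smul]
  have hinj : ∀ x ∈ W, Function.Injective (e.symmL ℂ x) := fun x hx =>
    Function.LeftInverse.injective fun u => e.continuousLinearMapAt_symmL (R := ℂ) (he x hx) u
  have hlin : ∀ z z' : Fin (Module.finrank ℂ F) → ℂ, ∑ k, z k • β k = ∑ k, z' k • β k → z = z' :=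
    fun z z' h => β.equivFun.symm.injective (by simpa [Module.Basis.equivFun_symm_apply] using h)
  have hval : ∀ (W' : Opens X) (h : W' ≤ W) (a : Fin (Module.finrank ℂ F) → O1 ι W')
      (z : Fin (Module.finrank ℂ F) → ℂ), ∀ x ∈ W',
      ((toJets (∑ k, a k • L.sheaf.res h (s k))).1 x).1 = e.symmL ℂ x (∑ k, z k • β k) →
      ∀ k, (a k).val x = z k := by
    intro W' h a z x hx heq k
    rw [hfst W' h a x hx] at heq
    exact congrFun (hlin _ _ (hinj x (h hx) heq)) k
  have hbij : ∀ (W' : Opens X) (h : W' ≤ W), Function.Bijective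
      fun a : Fin (Module.finrank ℂ F) → O1 ι W' => ∑ k, a k • L.sheaf.res h (s k) := by
    refine fun W' h => ⟨fun a a' haa' => ?_, fun t => ?_⟩
    · have hv : ∀ k, ∀ x ∈ W', (a k).val x = (a' k).val x := fun k x hx => by
        refine hval W' h a (fun k => (a' k).val x) x hx ?_ k
        rw [← hfst W' h a' x hx]
        exact congrArg (fun t => ((toJets t).1 x).1) haa'
      -- Once the values agree the terms with b cancel in the forms, which leaves equality of the
      -- differentials.
      refine funext fun k => O1.ext_jet hA (hv k) fun x hx => ?_
      ext w
      have h2 : L.form i (toJets (∑ k, a k • L.sheaf.res h (s k))).1 x w =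
          L.form i (toJets (∑ k, a' k • L.sheaf.res h (s k))).1 x w :=
        congrArg (fun t => L.form i (toJets t).1 x w) haa'
      rw [hform W' h a x hx, hform W' h a' x hx,
        Finset.sum_congr rfl fun k _ => by rw [hv k x hx]] at h2
      exact congrFun (hlin _ _ (hinj x (h hx) (add_left_cancel h2))) k
    · have hg := (toJets t).2.2
      have hfX : ∀ x : X, FiniteDimensional ℂ (TangentSpace 𝓘(ℂ, EX) x) := fun x =>
        inferInstanceAs (FiniteDimensional ℂ EX)
      have hfY : ∀ x : X, FiniteDimensional ℂ (TangentSpace 𝓘(ℂ, EY) (ι x)) := fun x =>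
        inferInstanceAs (FiniteDimensional ℂ EY)
      have htX : ∀ x : X, T2Space (TangentSpace 𝓘(ℂ, EX) x) := fun x => inferInstanceAs (T2Space EX)
      have htY : ∀ x : X, T2Space (TangentSpace 𝓘(ℂ, EY) (ι x)) := fun x => inferInstanceAs (T2Space EY)
      let f : Fin (Module.finrank ℂ F) → X → ℂ := fun k x =>
        LinearMap.toContinuousLinearMap (β.coord k) (e.continuousLinearMapAt ℂ x ((toJets t).1 x).1)
      let C : ∀ x, TangentSpace 𝓘(ℂ, EY) (ι x) →L[ℂ] (V x →L[ℂ] V x) := fun x => L.c i x x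
      -- The coordinates of φ_i - (b_i s) ∘ q, where (s, φ) is the given jet. On T_X this difference
      -- is ∇_i s, whose coordinates are the d f_k, so (f_k, θ_k) is the jet of a section of O_{X₁}.
      let θ : Fin (Module.finrank ℂ F) → ∀ x, TangentSpace 𝓘(ℂ, EY) (ι x) →L[ℂ] ℂ := fun k x =>
        LinearMap.toContinuousLinearMap (β.coord k) ∘L e.continuousLinearMapAt ℂ x ∘L
          (((toJets t).1 x).2 + evalForm (C x)
            ((toJets t).1 x).1 - evalForm (L.b i x) ((toJets t).1 x).1 ∘L Q.q x)
      have hθ : ∀ k x w, θ k x w = LinearMap.toContinuousLinearMap (β.coord k)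
        (e.continuousLinearMapAt ℂ x
          (L.form i (toJets t).1 x w - L.b i x (Q.q x w) ((toJets t).1 x).1)) := fun _ _ _ => rfl
      have hex : ∀ k, ∃ a : O1 ι W', ∀ x ∈ W', a.val x = f k x ∧ a.d x = θ k x := by
        intro k
        refine O1.exists_of_jet hA (fun x hx => ?_) (fun x hx w hw => ?_) fun x hx w => ?_
        · exact (ContinuousLinearMap.contMDiff _).contMDiffAt.comp x
            ((isHolAt_iff_coord e (he x (h hx))).mp (hg x hx).isHolAt_fst)
        · simp only [hθ]
          refine (ContinuousLinearMap.contMDiff _).contMDiffAt.comp x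
            ((isHolAt_iff_coord e (he x (h hx))).mp ?_)
          exact ((hg x hx).isHolAt_form i (hi (h hx)) w hw).sub
            (((L.isHolAt_b (hi (h hx))).clm_apply (Q.isHolAt_q x (h hx) w hw)).clm_apply
              (hg x hx).isHolAt_fst)
        · rw [hθ, (hg x hx).form_mfderiv i (hi (h hx)), Q.q_mfderiv x (h hx), add_sub_cancel_right]
          have h2 := hasMFDerivAt_coord (he x (h hx)) (hg x hx).isHolAt_fst
          have h3 := (((LinearMap.toContinuousLinearMap (β.coord k)).hasMFDerivAt).comp x h2).mfderiv
          refine Eq.trans ?_ (congrArg (fun T : EX →L[ℂ] ℂ => T w) h3).symm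
          rw [conn_eq h2, e.continuousLinearMapAt_symmL (he x (h hx))]
          rfl
      choose a ha ha' using hex
      refine ⟨a, toJets_injective (Subtype.ext (ext_of_mem (Subtype.prop _) (Subtype.prop _)
        fun x hx => ?_))⟩
      have h2 : e.symmL ℂ x (∑ k, (a k).val x • β k) = ((toJets t).1 x).1 := by
        refine Eq.trans ?_ (e.symmL_continuousLinearMapAt (R := ℂ) (he x (h hx)) _)
        refine congrArg _ (Eq.trans ?_ (β.sum_repr _))
        exact Finset.sum_congr rfl fun k _ => by rw [ha k x hx]; rfl
      refine jet_ext (L := L) (i := i) ((hfst W' h a x hx).trans h2) fun w => ?_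
      have h3 : e.symmL ℂ x (∑ k, (a k).d x w • β k) =
          L.form i (toJets t).1 x w - L.b i x (Q.q x w) ((toJets t).1 x).1 := by
        refine Eq.trans ?_ (e.symmL_continuousLinearMapAt (R := ℂ) (he x (h hx)) _)
        refine congrArg _ (Eq.trans ?_ (β.sum_repr _))
        exact Finset.sum_congr rfl fun k _ => by rw [ha' k x hx, hθ]; rfl
      rw [hform W' h a x hx, h2, h3, add_sub_cancel]
  let fr : L.sheaf.Frame W := ⟨Module.finrank ℂ F, s, hbij⟩
  refine ⟨fr, fun W' h t ht k x hx => hval W' h (fr.coord h t) (fun _ => 0) x hx ?_ k⟩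
  refine (congrArg (fun u => ((toJets u).1 x).1) (fr.sum_coord h t)).trans ?_
  simp [ht x hx]

variable (L)

lemma exists_tangentProjection_le (hA : ∀ x, Nonempty (AdaptedChart ι x)) (x : X) :
    ∃ W ≤ L.U x, x ∈ W ∧ Nonempty (TangentProjection ι W) := by
  obtain ⟨W, hx, ⟨Q⟩⟩ := (hA x).some.exists_tangentProjection
  exact ⟨W ⊓ L.U x, inf_le_right, ⟨hx, L.mem x⟩, ⟨⟨Q.q, fun p hp => Q.q_mfderiv p hp.1,
    fun p hp => Q.isHolAt_q p hp.1⟩⟩⟩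

/-- The sheaf of jets restricts to `E` on `X`. -/
def pullbackIso (hA : ∀ x, Nonempty (AdaptedChart ι x)) : PullbackIso F V L.sheaf where
  ρ W s x := ((toJets s).1 x).1
  isHolOn W s := isHolOn_iff.mpr fun x hx => ((toJets s).2.2 x hx).isHolAt_fst
  map_add W s t x hx := by rw [toJets_add]; rfl
  map_smul W a s x hx := by rw [toJets_smul, coe_smul, O1.toFun_eq_val]; rfl
  map_res {W W'} h s x hx := congrArg Prod.fst (toJets_res h s hx)
  surjective W t ht x hx := by
    obtain ⟨W₀, hW₀, hx₀, ⟨Q⟩⟩ := L.exists_tangentProjection_le hA x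
    obtain ⟨s, hs⟩ := L.exists_section_lift Q hW₀ (W' := W₀ ⊓ W) inf_le_left (t := t)
      fun p hp => isHolOn_iff.mp ht p hp.2
    exact ⟨W₀ ⊓ W, inf_le_right, ⟨hx₀, hx⟩, s, fun p hp => (hs p hp).1⟩
  ker W s hs x hx := by
    obtain ⟨W₀, hW₀, hx₀, ⟨Q⟩⟩ := L.exists_tangentProjection_le hA x
    obtain ⟨fr, hfr⟩ := exists_frame hA Q hW₀
    refine ⟨W₀ ⊓ W, inf_le_right, ⟨hx₀, hx⟩, ?_⟩
    -- In the frame a jet with zero image in E has coordinates of value zero, which are sections of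
    -- I / I².
    have h1 := hfr (W₀ ⊓ W) inf_le_left (L.sheaf.res inf_le_right s) fun p hp => by
      rw [toJets_res _ _ hp, hs p hp.2]
    rw [← fr.sum_coord inf_le_left (L.sheaf.res inf_le_right s)]
    refine Submodule.sum_mem _ fun k _ => Submodule.smul_mem_smul ?_ trivial
    refine RingHom.mem_ker.mpr (funext fun p => ?_)
    exact (O1.toFun_eq_val _ p.2).trans (h1 k p p.2)

lemma isVectorBundle_sheaf (hA : ∀ x, Nonempty (AdaptedChart ι x)) : L.sheaf.IsVectorBundle :=
  fun x => by
    obtain ⟨W, hW, hx, ⟨Q⟩⟩ := L.exists_tangentProjection_le hA x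
    obtain ⟨fr, -⟩ := exists_frame hA Q hW
    exact ⟨W, hx, fr.r, fr.e, fr.bijective⟩

end AtiyahLift

theorem hasExtension_of_atiyahClass_mem_range [FiniteDimensional ℂ EX] [FiniteDimensional ℂ EY]
    [FiniteDimensional ℂ F] (hA : ∀ x, Nonempty (AdaptedChart ι x))
    (h : atiyahClass EX F V ∈ Set.range (restrictH1 F V ι)) : HasExtension ι F V := by
  obtain ⟨L⟩ := nonempty_atiyahLift h
  exact ⟨L.sheaf, L.isVectorBundle_sheaf hA, ⟨L.pullbackIso hA⟩⟩

end LocallyFree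

end HolExt

end

theorem proposition1
    {EX : Type*} [NormedAddCommGroup EX] [NormedSpace ℂ EX] [FiniteDimensional ℂ EX]
    {EY : Type*} [NormedAddCommGroup EY] [NormedSpace ℂ EY] [FiniteDimensional ℂ EY]
    {X : Type*} [TopologicalSpace X] [CompactSpace X] [ChartedSpace EX X]
    [IsManifold 𝓘(ℂ, EX) ω X]
    {Y : Type*} [TopologicalSpace Y] [T2Space Y] [ChartedSpace EY Y]
    [IsManifold 𝓘(ℂ, EY) ω Y]
    (ι : C^ω⟮𝓘(ℂ, EX), X; 𝓘(ℂ, EY), Y⟯)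
    (hι : Manifold.IsSmoothEmbedding 𝓘(ℂ, EX) 𝓘(ℂ, EY) ω ι)
    (F : Type*) [NormedAddCommGroup F] [NormedSpace ℂ F] [FiniteDimensional ℂ F]
    (V : X → Type*) [TopologicalSpace (TotalSpace F V)]
    [∀ x, AddCommGroup (V x)] [∀ x, Module ℂ (V x)] [∀ x, TopologicalSpace (V x)]
    [∀ x, IsTopologicalAddGroup (V x)] [∀ x, ContinuousSMul ℂ (V x)]
    [FiberBundle F V] [VectorBundle ℂ F V] [ContMDiffVectorBundle ω F V 𝓘(ℂ, EX)] :
    HolExt.HasExtension ι F V ↔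
      HolExt.atiyahClass EX F V ∈ Set.range (HolExt.restrictH1 F V ι) := by
  have hA : ∀ x, Nonempty (HolExt.AdaptedChart ι x) := fun x =>
    HolExt.exists_adaptedChart ι (hι.isImmersion.isImmersionAt x)
  exact ⟨HolExt.atiyahClass_mem_range_of_hasExtension hA,
    HolExt.hasExtension_of_atiyahClass_mem_range hA⟩
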